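/- A \emph{Whitney stratified manifold} is a smooth manifold (without boundary) with a locally finite decomposition into disjoint connected smooth submanifolds (strata) which satisfies the frontier condition ($A\cap\overline{B}\neq\emptyset \Rightarrow A\subset\overline{B}$ for strata $A,B$) and Whitney's condition B. It is \emph{based} if it has a basepoint $\star$ lying in an open stratum. Products carry the product stratification, whose strata are the products $A\times B$ of strata, and the basepoint $(\star,\star)$. A smooth map $f:M\to X$ from a manifold to a Whitney stratified manifold is \emph{transversal} if for all $p\in M$ the composite $T_pM\to T_{f(p)}X\to T_{f(p)}X/T_{f(p)}A$ is surjective, where $A$ is the stratum containing $f(p)$. A \emph{stratified normal submersion} is a smooth map $s:X\to Y$ such that the inverse image of each stratum is a union of strata and such that the induced maps of normal spaces $N_xA\to N_{s(x)}B$ are surjective. Let $n\geq 1$ and fix a closed disk $B^n\subset S^n$ around the basepoint of $S^n$. Let $\psi_n(X)$ be the set of smooth transversal maps $(S^n,B^n)\to(X,\star)$ modulo smooth homotopy through such maps (constant for $t$ near $0$ and near $1$), with product $[f]\cdot[g]=[(f\vee g)\circ\mu]$, where $\mu:S^n\to S^n\vee S^n$ is the pinch map, unit the class of the constant map, and $[f]^\dagger=[f\circ\rho]$,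 where $\rho$ is the reflection of $S^n$ in a hyperplane through the basepoint. A \emph{dagger monoid} is a monoid with an anti-involution $a\mapsto a^\dagger$, $1^\dagger=1$, $(ab)^\dagger=b^\dagger a^\dagger$; maps of dagger monoids preserve unit, product and anti-involution. A based stratified normal submersion $s:X\to Y$ induces $\psi_n(s):\psi_n(X)\to\psi_n(Y)$, $[f]\mapsto[s\circ f]$. \textbf{Proposition.} Let $X$ and $Y$ be based Whitney stratified manifolds and $n\geq 1$. Let $\imath_X:X\to X\times Y$, $x\mapsto(x,\star)$ and $\imath_Y:Y\to X\times Y$, $y\mapsto(\star,y)$ be the inclusions and $\pi_X,\pi_Y$ the projections of $X\times Y$. Then $$1\to\psi_n(X)\xrightarrow{\psi_n(\imath_X)}\psi_n(X\times Y)\xrightarrow{\psi_n(\pi_Y)}\psi_n(Y)\to 1$$ is a short exact sequence of dagger monoids: the three terms are dagger monoids, the maps are maps of dagger monoids, $\psi_n(\imath_X)$ is injective, $\psi_n(\pi_Y)$ is surjective, and the image of $\psi_n(\imath_X)$ is the set of elements that $\psi_n(\pi_Y)$ maps to $1$. The sequence is split: $\psi_n(\pi_X)$ and $\psi_n(\imath_Y)$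 are maps of dagger monoids, $\psi_n(\pi_X)\circ\psi_n(\imath_X)=\mathrm{id}$ and $\psi_n(\pi_Y)\circ\psi_n(\imath_Y)=\mathrm{id}$. In general $\psi_n(X\times Y)$ is not the product of $\psi_n(X)$ and $\psi_n(Y)$: there are based Whitney stratified manifolds $X$ and $Y$ such that $\psi_1(X\times Y)$ and $\psi_1(X)\times\psi_1(Y)$ are not isomorphic, even as monoids. -/

import Mathlib

open scoped Manifold ContDiff Topology
open Set Filter

noncomputable section

namespace TransHtpy

/-! ### Submanifolds and Whitney stratifications -/

section Stratifications

variable {E H X : Type*} [NormedAddCommGroup E] [NormedSpace ℝ E] [TopologicalSpace H]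
  [TopologicalSpace X] [ChartedSpace H X]
variable {F G Y : Type*} [NormedAddCommGroup F] [NormedSpace ℝ F] [TopologicalSpace G]
  [TopologicalSpace Y] [ChartedSpace G Y]

/-- `S` is a smooth (embedded, hence locally closed) submanifold of `X`: around each of its points
there is a smooth chart of `X` in which `S` is a linear subspace. -/
def IsSubmanifold (I : ModelWithCorners ℝ E H) (S : Set X) : Prop :=
  ∀ p ∈ S, ∃ φ ∈ IsManifold.maximalAtlas I ∞ X, p ∈ φ.source ∧ ∃ V : Submodule ℝ E,
    ∀ x ∈ φ.source, x ∈ S ↔ φ.extend I x - φ.extend I p ∈ V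

/-- The tangent space `T_p S` of a submanifold `S`, as a subspace of `T_p X`: the tangent vectors
of `X` at `p` that are killed by the differential of every smooth function germ at `p` that
vanishes on `S`.  (In a slice chart of `S` at `p` this is the subspace that defines `S`.) -/
def tangentOf (I : ModelWithCorners ℝ E H) (S : Set X) (p : X) :
    Submodule ℝ (TangentSpace I p) where
  carrier := {v | ∀ g : X → ℝ, ContMDiffAt I 𝓘(ℝ, ℝ) ∞ g p → (∀ᶠ x in 𝓝[S] p, g x = 0) →
    (mfderiv I 𝓘(ℝ, ℝ) g p v : ℝ) = 0}
  add_mem' := by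
    intro a b ha hb g hg h0
    have h1 := ha g hg h0
    have h2 := hb g hg h0
    rw [map_add]
    exact (congrArg₂ (fun s t : ℝ => s + t) h1 h2).trans (add_zero 0)
  zero_mem' := by
    intro g _ _
    rw [map_zero]
  smul_mem' := by
    intro c a ha g hg h0
    have h1 := ha g hg h0
    rw [map_smul]
    exact (congrArg (fun s : ℝ => c * s) h1).trans (mul_zero c)

/-- A stratification of the manifold `X`: a locally finite partition into connected smooth
submanifolds satisfying the frontier condition.  The poset structure on the set of strata is
`A ≤ B ↔ A ⊆ closure B`. -/
structure Stratification (I : ModelWithCorners ℝ E H) (X : Type*) [TopologicalSpace X]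
    [ChartedSpace H X] where
  /-- the set of strata -/
  strata : Set (Set X)
  isPartition : Setoid.IsPartition strata
  locallyFinite : LocallyFinite (fun A : strata => (A : Set X))
  frontier : ∀ A ∈ strata, ∀ B ∈ strata, (A ∩ closure B).Nonempty → A ⊆ closure B
  isConnected : ∀ A ∈ strata, IsConnected A
  isSubmanifold : ∀ A ∈ strata, IsSubmanifold I A

/-- Convergence `V k → P` of linear subspaces of a finite-dimensional space in the Grassmannian:
the dimensions eventually agree, and every vector of `P` is a limit of vectors of the `V k`. -/
def SubspaceTendsto (V : ℕ → Submodule ℝ E) (P : Submodule ℝ E) : Prop :=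
  (∀ᶠ k in atTop, Module.finrank ℝ (V k) = Module.finrank ℝ P) ∧
    ∀ v ∈ P, ∃ u : ℕ → E, (∀ k, u k ∈ V k) ∧ Tendsto u atTop (𝓝 v)

/-- Whitney's condition B: whenever `x k ∈ A` and `y k ∈ B` converge to `p ∈ A` in such a way that
the secant lines through `x k` and `y k` converge to a line `L`, and the tangent planes of `B`
at `y k` converge to a plane `P`, one has `L ≤ P`.  Secants and limits are taken in the preferred
chart at `p`. -/
def Stratification.IsWhitney {I : ModelWithCorners ℝ E H} (S : Stratification I X) : Prop :=
  ∀ A ∈ S.strata, ∀ B ∈ S.strata, ∀ p ∈ A, ∀ x y : ℕ → X,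
    (∀ k, x k ∈ A) → (∀ k, y k ∈ B) → (∀ k, x k ≠ y k) →
    Tendsto x atTop (𝓝 p) → Tendsto y atTop (𝓝 p) →
    ∀ L P : Submodule ℝ E,
      SubspaceTendsto
        (fun k => Submodule.span ℝ {extChartAt I p (y k) - extChartAt I p (x k)}) L →
      SubspaceTendsto
        (fun k => (tangentOf I B (y k)).map
          (mfderiv I 𝓘(ℝ, E) (extChartAt I p) (y k)).toLinearMap) P →
      L ≤ P

/-- The product stratification of `X × Y`, with strata `A ×ˢ B`. -/
def prodStrata (S : Set (Set X)) (T : Set (Set Y)) : Set (Set (X × Y)) :=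
  Set.image2 (fun A B => A ×ˢ B) S T

theorem isPartition_prodStrata {X Y : Type*} {S : Set (Set X)} {T : Set (Set Y)}
    (hS : Setoid.IsPartition S) (hT : Setoid.IsPartition T) :
    Setoid.IsPartition (prodStrata S T) := by
  refine ⟨?_, ?_⟩
  · rintro ⟨A, hA, B, hB, h⟩
    rcases Set.prod_eq_empty_iff.1 h with h | h
    · exact hS.1 (h ▸ hA)
    · exact hT.1 (h ▸ hB)
  · rintro ⟨x, y⟩
    obtain ⟨A, ⟨hA, hxA⟩, hA'⟩ := hS.2 x
    obtain ⟨B, ⟨hB, hyB⟩, hB'⟩ := hT.2 y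
    refine ⟨A ×ˢ B, ⟨⟨A, hA, B, hB, rfl⟩, hxA, hyB⟩, ?_⟩
    rintro _ ⟨⟨A', hA1, B', hB1, rfl⟩, hx, hy⟩
    rw [hA' A' ⟨hA1, hx⟩, hB' B' ⟨hB1, hy⟩]

theorem IsSubmanifold.prod {I : ModelWithCorners ℝ E H} {J : ModelWithCorners ℝ F G}
    [IsManifold I ∞ X] [IsManifold J ∞ Y]
    {A : Set X} {B : Set Y} (hA : IsSubmanifold I A) (hB : IsSubmanifold J B) :
    IsSubmanifold (I.prod J) (A ×ˢ B) := by
  rintro ⟨p, q⟩ ⟨hp, hq⟩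
  obtain ⟨φ, hφ, hpφ, V, hV⟩ := hA p hp
  obtain ⟨ψ, hψ, hqψ, W, hW⟩ := hB q hq
  refine ⟨φ.prod ψ, IsManifold.mem_maximalAtlas_prod hφ hψ, ⟨hpφ, hqψ⟩, V.prod W, ?_⟩
  rintro ⟨x, y⟩ ⟨hx, hy⟩
  exact and_congr (hV x hx) (hW y hy)

/-- The product of two stratified manifolds. -/
def Stratification.prod {I : ModelWithCorners ℝ E H} {J : ModelWithCorners ℝ F G}
    [IsManifold I ∞ X] [IsManifold J ∞ Y] (S : Stratification I X) (T : Stratification J Y) :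
    Stratification (I.prod J) (X × Y) where
  strata := prodStrata S.strata T.strata
  isPartition := isPartition_prodStrata S.isPartition T.isPartition
  locallyFinite := by
    rintro ⟨x, y⟩
    obtain ⟨U, hU, hUf⟩ := S.locallyFinite x
    obtain ⟨V, hV, hVf⟩ := T.locallyFinite y
    refine ⟨U ×ˢ V, prod_mem_nhds hU hV, ?_⟩
    have key : {C : prodStrata S.strata T.strata | ((C : Set (X × Y)) ∩ U ×ˢ V).Nonempty} ⊆
        Subtype.val ⁻¹' (Set.image2 (fun A B => A ×ˢ B)
          (Subtype.val '' {A : S.strata | ((A : Set X) ∩ U).Nonempty})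
          (Subtype.val '' {B : T.strata | ((B : Set Y) ∩ V).Nonempty})) := by
      rintro ⟨_, A, hA, B, hB, rfl⟩ ⟨⟨a, b⟩, ⟨ha, hb⟩, ha', hb'⟩
      exact ⟨A, ⟨⟨A, hA⟩, ⟨a, ha, ha'⟩, rfl⟩, B, ⟨⟨B, hB⟩, ⟨b, hb, hb'⟩, rfl⟩, rfl⟩
    refine Set.Finite.subset (Set.Finite.preimage Subtype.val_injective.injOn ?_) key
    exact Set.Finite.image2 _ (hUf.image _) (hVf.image _)
  frontier := by
    rintro _ ⟨A, hA, B, hB, rfl⟩ _ ⟨A', hA', B', hB', rfl⟩ ⟨⟨x, y⟩, ⟨hx, hy⟩, h⟩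
    rw [closure_prod_eq] at h ⊢
    exact Set.prod_mono (S.frontier A hA A' hA' ⟨x, hx, h.1⟩)
      (T.frontier B hB B' hB' ⟨y, hy, h.2⟩)
  isConnected := by
    rintro _ ⟨A, hA, B, hB, rfl⟩
    exact (S.isConnected A hA).prod (T.isConnected B hB)
  isSubmanifold := by
    rintro _ ⟨A, hA, B, hB, rfl⟩
    exact (S.isSubmanifold A hA).prod (T.isSubmanifold B hB)

/-- A stratification together with a generic basepoint, i.e. one lying in an open stratum. -/
structure BasedStratification (I : ModelWithCorners ℝ E H) (X : Type*) [TopologicalSpace X]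
    [ChartedSpace H X] extends Stratification I X where
  /-- the basepoint -/
  pt : X
  generic : ∃ U ∈ strata, IsOpen U ∧ pt ∈ U

/-- The product of based stratified manifolds. -/
def BasedStratification.prod {I : ModelWithCorners ℝ E H} {J : ModelWithCorners ℝ F G}
    [IsManifold I ∞ X] [IsManifold J ∞ Y]
    (S : BasedStratification I X) (T : BasedStratification J Y) :
    BasedStratification (I.prod J) (X × Y) where
  toStratification := S.toStratification.prod T.toStratification
  pt := (S.pt, T.pt)
  generic := by
    obtain ⟨U, hU, hUo, hU'⟩ := S.generic
    obtain ⟨V, hV, hVo, hV'⟩ := T.generic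
    exact ⟨U ×ˢ V, ⟨U, hU, V, hV, rfl⟩, hUo.prod hVo, hU', hV'⟩

/-! ### Transversal maps and stratified normal submersions -/

/-- At `p`, the composite `T_p M → T_{f p} X → N_{f p} A` is surjective, where `A` is the stratum
of `X` through `f p`. -/
def NormallySurjectiveAt (J : ModelWithCorners ℝ F G) {I : ModelWithCorners ℝ E H}
    (S : Stratification I X) (f : Y → X) (p : Y) : Prop :=
  ∀ A ∈ S.strata, f p ∈ A →
    Function.Surjective ((tangentOf I A (f p)).mkQ ∘ₗ (mfderiv J I f p).toLinearMap)

/-- A smooth map `f` from a manifold to a stratified manifold is transversal. -/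
def IsTransversal (J : ModelWithCorners ℝ F G) {I : ModelWithCorners ℝ E H}
    (S : Stratification I X) (f : Y → X) : Prop :=
  ∀ p, NormallySurjectiveAt J S f p

/-- Based stratified normal submersions: smooth based maps `s` such that the preimage of each
stratum is a union of strata, and such that the induced maps of normal spaces
`N_x A → N_{s x} B` are surjective.  (As `T_x X → N_x A` is surjective, the latter says that
`T_x X → N_{s x} B` is surjective.) -/
structure IsNormalSubmersion {I : ModelWithCorners ℝ E H} {J : ModelWithCorners ℝ F G}
    (S : BasedStratification I X) (T : BasedStratification J Y) (s : X → Y) : Prop where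
  smooth : ContMDiff I J ∞ s
  based : s S.pt = T.pt
  stratified : ∀ A ∈ S.strata, ∀ B ∈ T.strata, (A ∩ s ⁻¹' B).Nonempty → A ⊆ s ⁻¹' B
  normal : ∀ x, NormallySurjectiveAt I T.toStratification s x

theorem normallySurjectiveAt_iff {J : ModelWithCorners ℝ F G} {I : ModelWithCorners ℝ E H}
    {S : Stratification I X} {f : Y → X} {p : Y} :
    NormallySurjectiveAt J S f p ↔ ∀ A ∈ S.strata, f p ∈ A → ∀ w : TangentSpace I (f p),
      ∃ v : TangentSpace J p, w - mfderiv J I f p v ∈ tangentOf I A (f p) := by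
  refine forall_congr' fun A => forall_congr' fun _ => forall_congr' fun _ => ?_
  constructor
  · intro h w
    obtain ⟨v, hv⟩ := h (Submodule.Quotient.mk w)
    exact ⟨v, (Submodule.Quotient.eq _).1 hv.symm⟩
  · intro h q
    obtain ⟨w, rfl⟩ := Submodule.Quotient.mk_surjective _ q
    obtain ⟨v, hv⟩ := h w
    exact ⟨v, ((Submodule.Quotient.eq _).2 hv).symm⟩

theorem mfderiv_mem_tangentOf {I : ModelWithCorners ℝ E H} {J : ModelWithCorners ℝ F G}
    {s : X → Y} (hs : ContMDiff I J ∞ s) {A : Set X} {B : Set Y} (h : A ⊆ s ⁻¹' B) {x : X}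
    {v : TangentSpace I x} (hv : v ∈ tangentOf I A x) :
    mfderiv I J s x v ∈ tangentOf J B (s x) := by
  intro g hg h0
  have h1 : ContMDiffAt I 𝓘(ℝ, ℝ) ∞ (g ∘ s) x := hg.comp x (hs x)
  have h2 : ∀ᶠ z in 𝓝[A] x, (g ∘ s) z = 0 := by
    have : Tendsto s (𝓝[A] x) (𝓝[B] (s x)) :=
      (hs.continuous.continuousAt.continuousWithinAt).tendsto_nhdsWithin h
    exact this.eventually h0
  have h3 := hv _ h1 h2
  rw [mfderiv_comp x (hg.mdifferentiableAt (by simp)) ((hs x).mdifferentiableAt (by simp))] at h3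
  exact h3

/-- The composite of a transversal map with a stratified normal submersion is transversal. -/
theorem IsTransversal.comp {E' H' M : Type*} [NormedAddCommGroup E'] [NormedSpace ℝ E']
    [TopologicalSpace H'] [TopologicalSpace M] [ChartedSpace H' M]
    {K : ModelWithCorners ℝ E' H'} {I : ModelWithCorners ℝ E H} {J : ModelWithCorners ℝ F G}
    {S : BasedStratification I X} {T : BasedStratification J Y} {s : X → Y}
    (hs : IsNormalSubmersion S T s) {f : M → X} (hf : ContMDiff K I ∞ f)
    (hft : IsTransversal K S.toStratification f) :
    IsTransversal K T.toStratification (s ∘ f) := by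
  intro p
  rw [normallySurjectiveAt_iff]
  intro B hB hp
  have key : ∀ w : TangentSpace J (s (f p)), ∃ u : TangentSpace K p,
      w - mfderiv I J s (f p) (mfderiv K I f p u) ∈ tangentOf J B (s (f p)) := by
    intro w
    obtain ⟨v, hv⟩ := normallySurjectiveAt_iff.1 (hs.normal (f p)) B hB hp w
    obtain ⟨A, ⟨hA, hpA⟩, -⟩ := S.isPartition.2 (f p)
    obtain ⟨u, hu⟩ := normallySurjectiveAt_iff.1 (hft p) A hA hpA v
    have h1 := mfderiv_mem_tangentOf hs.smooth (hs.stratified A hA B hB ⟨f p, hpA, hp⟩) hu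
    refine ⟨u, ?_⟩
    have h2 := add_mem hv h1
    rwa [map_sub, sub_add_sub_cancel] at h2
  rw [mfderiv_comp p ((hs.smooth (f p)).mdifferentiableAt (by simp))
    ((hf p).mdifferentiableAt (by simp))]
  exact key

theorem tangentOf_eq_top_of_isOpen {I : ModelWithCorners ℝ E H} {A : Set X} (hA : IsOpen A)
    {x : X} (hx : x ∈ A) : tangentOf I A x = ⊤ := by
  rw [eq_top_iff]
  intro v _ g hg h0
  rw [hA.nhdsWithin_eq hx] at h0
  have h1 : g =ᶠ[𝓝 x] fun _ => (0 : ℝ) := h0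
  rw [h1.mfderiv_eq, mfderiv_const]
  rfl

theorem isNormalSubmersion_fst {I : ModelWithCorners ℝ E H} {J : ModelWithCorners ℝ F G}
    [IsManifold I ∞ X] [IsManifold J ∞ Y]
    (S : BasedStratification I X) (T : BasedStratification J Y) :
    IsNormalSubmersion (S.prod T) S (Prod.fst : X × Y → X) where
  smooth := contMDiff_fst
  based := rfl
  stratified := by
    rintro _ ⟨A, hA, B, hB, rfl⟩ A' hA' ⟨⟨x, y⟩, ⟨hx, hy⟩, hx'⟩
    obtain rfl : A = A' := (S.isPartition.2 x).unique ⟨hA, hx⟩ ⟨hA', hx'⟩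
    exact fun z hz => hz.1
  normal := by
    intro z
    rw [normallySurjectiveAt_iff]
    intro A hA _ w
    refine ⟨(w, 0), ?_⟩
    rw [mfderiv_fst]
    have : w - (ContinuousLinearMap.fst ℝ (TangentSpace I z.1) (TangentSpace J z.2)) (w, 0) = 0 :=
      sub_self w
    exact this ▸ zero_mem _

theorem isNormalSubmersion_snd {I : ModelWithCorners ℝ E H} {J : ModelWithCorners ℝ F G}
    [IsManifold I ∞ X] [IsManifold J ∞ Y]
    (S : BasedStratification I X) (T : BasedStratification J Y) :
    IsNormalSubmersion (S.prod T) T (Prod.snd : X × Y → Y) where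
  smooth := contMDiff_snd
  based := rfl
  stratified := by
    rintro _ ⟨A, hA, B, hB, rfl⟩ B' hB' ⟨⟨x, y⟩, ⟨hx, hy⟩, hy'⟩
    obtain rfl : B = B' := (T.isPartition.2 y).unique ⟨hB, hy⟩ ⟨hB', hy'⟩
    exact fun z hz => hz.2
  normal := by
    intro z
    rw [normallySurjectiveAt_iff]
    intro A hA _ w
    refine ⟨(0, w), ?_⟩
    rw [mfderiv_snd]
    have : w - (ContinuousLinearMap.snd ℝ (TangentSpace I z.1) (TangentSpace J z.2)) (0, w) = 0 :=
      sub_self w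
    exact this ▸ zero_mem _

theorem isNormalSubmersion_inl {I : ModelWithCorners ℝ E H} {J : ModelWithCorners ℝ F G}
    [IsManifold I ∞ X] [IsManifold J ∞ Y]
    (S : BasedStratification I X) (T : BasedStratification J Y) :
    IsNormalSubmersion S (S.prod T) (fun x : X => (x, T.pt)) where
  smooth := contMDiff_id.prodMk contMDiff_const
  based := rfl
  stratified := by
    rintro A hA _ ⟨A', hA', B, hB, rfl⟩ ⟨x, hx, hx', hp⟩
    obtain rfl : A = A' := (S.isPartition.2 x).unique ⟨hA, hx⟩ ⟨hA', hx'⟩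
    exact fun z hz => ⟨hz, hp⟩
  normal := by
    intro x
    rw [normallySurjectiveAt_iff]
    rintro _ ⟨A, hA, B, hB, rfl⟩ ⟨hx, hp⟩ w
    obtain ⟨U, hU, hUo, hU'⟩ := T.generic
    obtain rfl : B = U := (T.isPartition.2 T.pt).unique ⟨hB, hp⟩ ⟨hU, hU'⟩
    refine ⟨w.1, ?_⟩
    have h1 : mfderiv I (I.prod J) (fun x : X => (x, T.pt)) x w.1 = (w.1, 0) := by
      rw [mfderiv_prod_left]
      rfl
    have h2 : w - mfderiv I (I.prod J) (fun x : X => (x, T.pt)) x w.1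
        = mfderiv J (I.prod J) (fun y : Y => (x, y)) T.pt w.2 := by
      rw [h1, mfderiv_prod_right]
      exact Prod.ext (sub_self w.1) (sub_zero w.2)
    rw [h2]
    have hsub : B ⊆ (fun y : Y => (x, y)) ⁻¹' (A ×ˢ B) := fun y hy => ⟨hx, hy⟩
    refine mfderiv_mem_tangentOf (contMDiff_const.prodMk contMDiff_id) hsub ?_
    rw [tangentOf_eq_top_of_isOpen hUo hU']
    trivial

theorem isNormalSubmersion_inr {I : ModelWithCorners ℝ E H} {J : ModelWithCorners ℝ F G}
    [IsManifold I ∞ X] [IsManifold J ∞ Y]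
    (S : BasedStratification I X) (T : BasedStratification J Y) :
    IsNormalSubmersion T (S.prod T) (fun y : Y => (S.pt, y)) where
  smooth := contMDiff_const.prodMk contMDiff_id
  based := rfl
  stratified := by
    rintro B hB _ ⟨A, hA, B', hB', rfl⟩ ⟨y, hy, hp, hy'⟩
    obtain rfl : B = B' := (T.isPartition.2 y).unique ⟨hB, hy⟩ ⟨hB', hy'⟩
    exact fun z hz => ⟨hp, hz⟩
  normal := by
    intro y
    rw [normallySurjectiveAt_iff]
    rintro _ ⟨A, hA, B, hB, rfl⟩ ⟨hp, hy⟩ w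
    obtain ⟨U, hU, hUo, hU'⟩ := S.generic
    obtain rfl : A = U := (S.isPartition.2 S.pt).unique ⟨hA, hp⟩ ⟨hU, hU'⟩
    refine ⟨w.2, ?_⟩
    have h1 : mfderiv J (I.prod J) (fun y : Y => (S.pt, y)) y w.2 = (0, w.2) := by
      rw [mfderiv_prod_right]
      rfl
    have h2 : w - mfderiv J (I.prod J) (fun y : Y => (S.pt, y)) y w.2
        = mfderiv I (I.prod J) (fun x : X => (x, y)) S.pt w.1 := by
      rw [h1, mfderiv_prod_left]
      exact Prod.ext (sub_zero w.1) (sub_self w.2)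
    rw [h2]
    have hsub : A ⊆ (fun x : X => (x, y)) ⁻¹' (A ×ˢ B) := fun x hx => ⟨hx, hy⟩
    refine mfderiv_mem_tangentOf (contMDiff_id.prodMk contMDiff_const) hsub ?_
    rw [tangentOf_eq_top_of_isOpen hUo hU']
    trivial

end Stratifications
/-! ### The sphere, the disk around its basepoint, the pinch map and the reflection -/

section Spheres

/-- The unit sphere `S^n` in `ℝ^(n+1)`. -/
abbrev Sph (n : ℕ) : Type := Metric.sphere (0 : EuclideanSpace ℝ (Fin (n + 1))) 1

theorem norm_single_one {n : ℕ} (i : Fin (n + 1)) :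
    ‖(EuclideanSpace.single i 1 : EuclideanSpace ℝ (Fin (n + 1)))‖ = 1 := by
  simp

/-- The basepoint of `S^n`: the north pole. -/
def pole (n : ℕ) : Sph n :=
  ⟨EuclideanSpace.single (Fin.last n) 1, by simp⟩

theorem norm_pole (n : ℕ) : ‖(pole n : EuclideanSpace ℝ (Fin (n + 1)))‖ = 1 :=
  norm_single_one _

/-- The closed disk `B^n ⊂ S^n` around the basepoint: a polar cap.  Under stereographic projection
from the basepoint, its complement is the open ball of radius `4`. -/
def cap (n : ℕ) : Set (Sph n) := {x | 3 / 5 ≤ x.1 (Fin.last n)}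

/-- The hyperplane orthogonal to the basepoint, which is the target of the stereographic projection
from the basepoint. -/
abbrev Equator (n : ℕ) : Submodule ℝ (EuclideanSpace ℝ (Fin (n + 1))) :=
  (ℝ ∙ (pole n : EuclideanSpace ℝ (Fin (n + 1))))ᗮ

/-- The zeroth standard basis vector; for `n ≠ 0` it is orthogonal to the basepoint. -/
def side (n : ℕ) [NeZero n] : Equator n :=
  ⟨EuclideanSpace.single 0 1, by
    rw [Submodule.mem_orthogonal_singleton_iff_inner_right]
    have h : (0 : Fin (n + 1)) ≠ Fin.last n := fun h => NeZero.ne n (by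
      simpa using congrArg Fin.val h.symm)
    simp [pole, EuclideanSpace.inner_single_left, h]⟩

/-- In stereographic coordinates `w` the map `w ↦ 4 w + c`, as a self-map of `S^n`. -/
def enlarge {n : ℕ} (c : Equator n) (x : Sph n) : Sph n :=
  (stereographic (norm_pole n)).symm ((4 : ℝ) • stereographic (norm_pole n) x + c)

/-- The pinch map `μ : S^n → S^n ∨ S^n`, the target being presented as a disjoint union of two
spheres: in stereographic coordinates, the open balls of radius `1` around `∓ 2 e₀`
are mapped by `w ↦ 4 w ± 8 e₀` diffeomorphically onto `S^n - B^n` in the first, respectively the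
second sphere, and everything else is mapped into the two disks `B^n`, which all our maps
collapse to the basepoint. -/
def pinch {n : ℕ} [NeZero n] (x : Sph n) : Sph n ⊕ Sph n :=
  if x.1 0 < 0 then Sum.inl (enlarge ((8 : ℝ) • side n) x)
  else Sum.inr (enlarge (-((8 : ℝ) • side n)) x)

/-- The reflection `ρ` of `S^n` in the hyperplane `x 0 = 0`, which contains the basepoint. -/
def reflect {n : ℕ} (x : Sph n) : Sph n :=
  ⟨(ℝ ∙ (EuclideanSpace.single 0 1 : EuclideanSpace ℝ (Fin (n + 1))))ᗮ.reflection x.1, by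
    simp⟩

theorem reflect_apply {n : ℕ} (x : Sph n) :
    (reflect x).1 = x.1 - (2 * x.1 0) • EuclideanSpace.single 0 (1 : ℝ) := by
  simp only [reflect, Submodule.reflection_orthogonal_apply, Submodule.reflection_singleton_apply,
    EuclideanSpace.inner_single_left, norm_single_one]
  simp [two_smul, two_mul, add_smul]

theorem reflect_mem_cap {n : ℕ} [NeZero n] {x : Sph n} (hx : x ∈ cap n) : reflect x ∈ cap n := by
  have h : Fin.last n ≠ (0 : Fin (n + 1)) := fun h => NeZero.ne n (by
    simpa using congrArg Fin.val h)
  simpa [cap, reflect_apply, h] using hx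

theorem reflect_reflect {n : ℕ} (x : Sph n) : reflect (reflect x) = x := by
  apply Subtype.ext
  simp [reflect]

theorem contMDiff_reflect {n : ℕ} : ContMDiff (𝓡 n) (𝓡 n) ∞ (reflect : Sph n → Sph n) := by
  have : Fact (Module.finrank ℝ (EuclideanSpace ℝ (Fin (n + 1))) = n + 1) := ⟨by simp⟩
  refine ContMDiff.codRestrict_sphere (f := fun x : Sph n =>
    (ℝ ∙ (EuclideanSpace.single 0 1 : EuclideanSpace ℝ (Fin (n + 1))))ᗮ.reflection x.1) ?_ _
  exact (LinearIsometryEquiv.contDiff _).contMDiff.comp contMDiff_coe_sphere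

/-! Elementary properties of the stereographic projection. -/

/-- Stereographic projection from the basepoint. -/
abbrev ster {n : ℕ} (x : Sph n) : Equator n := stereographic (norm_pole n) x

/-- Inverse stereographic projection. -/
abbrev sterInv {n : ℕ} (w : Equator n) : Sph n := (stereographic (norm_pole n)).symm w

theorem inner_pole {n : ℕ} (x : EuclideanSpace ℝ (Fin (n + 1))) :
    inner ℝ (pole n : EuclideanSpace ℝ (Fin (n + 1))) x = x (Fin.last n) := by
  simp [pole, EuclideanSpace.inner_single_left]

theorem ster_sterInv {n : ℕ} (w : Equator n) : ster (sterInv w) = w :=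
  (stereographic (norm_pole n)).right_inv (by simp)

theorem sterInv_ster {n : ℕ} {x : Sph n} (hx : x ≠ pole n) : sterInv (ster x) = x :=
  (stereographic (norm_pole n)).left_inv hx

theorem sterInv_ne_pole {n : ℕ} (w : Equator n) : sterInv w ≠ pole n :=
  stereoInvFun_ne_north_pole (norm_pole n) w

theorem sterInv_last {n : ℕ} (w : Equator n) :
    (sterInv w).1 (Fin.last n) = (‖w‖ ^ 2 - 4) / (‖w‖ ^ 2 + 4) := by
  have h : ((sterInv w : Sph n) : EuclideanSpace ℝ (Fin (n + 1)))
      = (‖w‖ ^ 2 + 4)⁻¹ • ((4 : ℝ) • (w : EuclideanSpace ℝ (Fin (n + 1)))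
        + (‖w‖ ^ 2 - 4) • (pole n : EuclideanSpace ℝ (Fin (n + 1)))) :=
    stereoInvFun_apply (norm_pole n) w
  have h2 : (w : EuclideanSpace ℝ (Fin (n + 1))) (Fin.last n) = 0 := by
    rw [← inner_pole]
    exact Submodule.mem_orthogonal_singleton_iff_inner_right.mp w.2
  rw [h]
  simp only [PiLp.smul_apply, PiLp.add_apply, h2, smul_eq_mul]
  simp [pole]
  ring

theorem sterInv_mem_cap_iff {n : ℕ} (w : Equator n) : sterInv w ∈ cap n ↔ 4 ≤ ‖w‖ := by
  have h : sterInv w ∈ cap n ↔ 3 / 5 ≤ (sterInv w).1 (Fin.last n) := Iff.rfl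
  rw [h, sterInv_last, le_div_iff₀ (by positivity)]
  constructor
  · intro h
    by_contra! h'
    nlinarith [norm_nonneg w]
  · intro h
    nlinarith [norm_nonneg w]

theorem contMDiff_sterInv {n : ℕ} :
    ContMDiff 𝓘(ℝ, Equator n) (𝓡 n) ∞ (sterInv : Equator n → Sph n) := by
  have : Fact (Module.finrank ℝ (EuclideanSpace ℝ (Fin (n + 1))) = n + 1) := ⟨by simp⟩
  refine ContMDiff.codRestrict_sphere (f := fun w : Equator n =>
    stereoInvFunAux (pole n : EuclideanSpace ℝ (Fin (n + 1))) w) ?_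
    (fun w => stereoInvFunAux_mem (norm_pole n) w.2)
  exact (contDiff_stereoInvFunAux.comp (Submodule.subtypeL (Equator n)).contDiff).contMDiff

theorem contMDiffAt_ster {n : ℕ} {x : Sph n} (hx : x ≠ pole n) :
    ContMDiffAt (𝓡 n) 𝓘(ℝ, Equator n) ∞ (ster : Sph n → Equator n) x := by
  have : Fact (Module.finrank ℝ (EuclideanSpace ℝ (Fin (n + 1))) = n + 1) := ⟨by simp⟩
  have h1 : IsOpen {y : EuclideanSpace ℝ (Fin (n + 1)) |
      innerSL ℝ (pole n : EuclideanSpace ℝ (Fin (n + 1))) y ≠ (1 : ℝ)} :=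
    isOpen_ne_fun (ContinuousLinearMap.continuous _) continuous_const
  have h2 : innerSL ℝ (pole n : EuclideanSpace ℝ (Fin (n + 1))) (x : EuclideanSpace ℝ (Fin (n + 1)))
      ≠ (1 : ℝ) := by
    intro h
    exact hx ((sphere_ext_iff (pole n) x).2 h).symm
  have h3 := (contDiffOn_stereoToFun (v := (pole n : EuclideanSpace ℝ (Fin (n + 1))))
    (n := ∞)).contDiffAt (h1.mem_nhds h2)
  exact h3.contMDiffAt.comp x (contMDiff_coe_sphere x)

theorem contMDiffAt_enlarge {n : ℕ} (c : Equator n) {x : Sph n} (hx : x ≠ pole n) :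
    ContMDiffAt (𝓡 n) (𝓡 n) ∞ (enlarge c) x := by
  have h : ContDiff ℝ ∞ (fun w : Equator n => (4 : ℝ) • w + c) := by fun_prop
  exact (contMDiff_sterInv _).comp x ((h.contMDiff _).comp x (contMDiffAt_ster hx))

/-- The inverse of `enlarge c`. -/
def reduce {n : ℕ} (c : Equator n) (x : Sph n) : Sph n :=
  sterInv ((4 : ℝ)⁻¹ • (ster x - c))

theorem contMDiffAt_reduce {n : ℕ} (c : Equator n) {x : Sph n} (hx : x ≠ pole n) :
    ContMDiffAt (𝓡 n) (𝓡 n) ∞ (reduce c) x := by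
  have h : ContDiff ℝ ∞ (fun w : Equator n => (4 : ℝ)⁻¹ • (w - c)) := by fun_prop
  exact (contMDiff_sterInv _).comp x ((h.contMDiff _).comp x (contMDiffAt_ster hx))

theorem enlarge_reduce {n : ℕ} (c : Equator n) {x : Sph n} (hx : x ≠ pole n) :
    enlarge c (reduce c x) = x := by
  have h : enlarge c (reduce c x) = sterInv ((4 : ℝ) • ster (reduce c x) + c) := rfl
  rw [h, reduce, ster_sterInv, smul_smul]
  norm_num
  exact sterInv_ster hx

theorem reduce_enlarge {n : ℕ} (c : Equator n) {x : Sph n} (hx : x ≠ pole n) :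
    reduce c (enlarge c x) = x := by
  have h : reduce c (enlarge c x)
    = sterInv ((4 : ℝ)⁻¹ • (ster (sterInv ((4 : ℝ) • ster x + c)) - c)) := rfl
  rw [h, ster_sterInv, add_sub_cancel_right, smul_smul]
  norm_num
  exact sterInv_ster hx

theorem mfderiv_surjective_of_inverse {E H M : Type*} [NormedAddCommGroup E] [NormedSpace ℝ E]
    [TopologicalSpace H] [TopologicalSpace M] [ChartedSpace H M] {I : ModelWithCorners ℝ E H}
    {f g : M → M} {x y : M} (hx : g y = x) (hfg : ∀ᶠ z in 𝓝 y, f (g z) = z)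
    (hg : MDifferentiableAt I I g y) (hf : MDifferentiableAt I I f x) :
    Function.Surjective (mfderiv I I f x) := by
  subst hx
  have hy : f (g y) = y := hfg.self_of_nhds
  have h1 : (f ∘ g) =ᶠ[𝓝 y] id := hfg
  have h2 : (mfderiv I I f (g y)).comp (mfderiv I I g y) = mfderiv I I id y := by
    rw [← mfderiv_comp y hf hg]
    exact h1.mfderiv_eq
  rw [mfderiv_id] at h2
  exact fun v => ⟨mfderiv I I g y v, DFunLike.congr_fun h2 v⟩

theorem mfderiv_enlarge_surjective {n : ℕ} (c : Equator n) {x : Sph n} (hx : x ≠ pole n) :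
    Function.Surjective (mfderiv (𝓡 n) (𝓡 n) (enlarge c) x) := by
  have hy : enlarge c x ≠ pole n := sterInv_ne_pole _
  refine mfderiv_surjective_of_inverse (reduce_enlarge c hx) ?_
    ((contMDiffAt_reduce c hy).mdifferentiableAt (by simp))
    ((contMDiffAt_enlarge c hx).mdifferentiableAt (by simp))
  filter_upwards [isOpen_ne.mem_nhds hy] with z hz
  exact enlarge_reduce c hz

theorem mfderiv_reflect_surjective {n : ℕ} (x : Sph n) :
    Function.Surjective (mfderiv (𝓡 n) (𝓡 n) reflect x) := by
  exact mfderiv_surjective_of_inverse (reflect_reflect x) (.of_forall reflect_reflect)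
    ((contMDiff_reflect _).mdifferentiableAt (by simp))
    ((contMDiff_reflect _).mdifferentiableAt (by simp))

end Spheres
section PinchLocal

theorem inner_side_ster {n : ℕ} [NeZero n] (x : Sph n) :
    inner ℝ (side n) (ster x) = 2 / (1 - x.1 (Fin.last n)) * x.1 0 := by
  have h : ster x = (2 / ((1 : ℝ) - inner ℝ (pole n : EuclideanSpace ℝ (Fin (n + 1))) x.1)) •
      (Equator n).orthogonalProjectionOnto x.1 := stereographic_apply (norm_pole n) x
  rw [h, inner_smul_right, inner_pole,
    Submodule.inner_orthogonalProjectionOnto_eq_of_mem_left]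
  simp [side, EuclideanSpace.inner_single_left]

theorem norm_side (n : ℕ) [NeZero n] : ‖side n‖ = 1 := norm_single_one 0

theorem enlarge_mem_cap_iff {n : ℕ} (c : Equator n) (x : Sph n) :
    enlarge c x ∈ cap n ↔ 4 ≤ ‖(4 : ℝ) • ster x + c‖ := sterInv_mem_cap_iff _

theorem enlarge_mem_cap {n : ℕ} {c : Equator n} (hc : ‖c‖ = 8) {x : Sph n} (hx : x ∈ cap n) :
    enlarge c x ∈ cap n := by
  rw [enlarge_mem_cap_iff]
  by_cases h : x = pole n
  · have h0 : ster (pole n) = 0 := by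
      have h1 : ster (pole n) =
          (2 / ((1 : ℝ) - inner ℝ (pole n : EuclideanSpace ℝ (Fin (n + 1))) (pole n).1)) •
          (Equator n).orthogonalProjectionOnto (pole n).1 := stereographic_apply (norm_pole n) _
      rw [h1, real_inner_self_eq_norm_sq, norm_pole]
      simp
    rw [h, h0, smul_zero, zero_add, hc]
    norm_num
  · rw [← sterInv_ster h, sterInv_mem_cap_iff] at hx
    have h1 : ‖(4 : ℝ) • ster x‖ = 4 * ‖ster x‖ := by
      rw [norm_smul]
      norm_num
    have h2 := norm_sub_norm_le ((4 : ℝ) • ster x) (-c)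
    rw [norm_neg, sub_neg_eq_add] at h2
    linarith

theorem norm_eight_side (n : ℕ) [NeZero n] : ‖(8 : ℝ) • side n‖ = 8 := by
  rw [norm_smul, norm_side]
  norm_num

theorem pinch_mem_cap {n : ℕ} [NeZero n] {x : Sph n} (hx : x ∈ cap n) :
    Sum.elim (· ∈ cap n) (· ∈ cap n) (pinch x) := by
  unfold pinch
  split_ifs
  · exact enlarge_mem_cap (norm_eight_side n) hx
  · exact enlarge_mem_cap (by rw [norm_neg, norm_eight_side]) hx

/-- Near every point, the pinch map is one of the two enlargements, or maps into the disks. -/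
theorem pinch_local {n : ℕ} [NeZero n] (x : Sph n) :
    (x ≠ pole n ∧ ∀ᶠ y in 𝓝 x, pinch y = Sum.inl (enlarge ((8 : ℝ) • side n) y)) ∨
    (x ≠ pole n ∧ ∀ᶠ y in 𝓝 x, pinch y = Sum.inr (enlarge (-((8 : ℝ) • side n)) y)) ∨
    ∀ᶠ y in 𝓝 x, Sum.elim (· ∈ cap n) (· ∈ cap n) (pinch y) := by
  have hcont : ∀ i : Fin (n + 1), Continuous fun y : Sph n => y.1 i := fun i => by fun_prop
  have hp0 : (pole n).1 0 = 0 := by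
    have h : (0 : Fin (n + 1)) ≠ Fin.last n := fun h => NeZero.ne n (by
      simpa using congrArg Fin.val h.symm)
    simp [pole, h]
  rcases lt_trichotomy (x.1 0) 0 with h | h | h
  · refine Or.inl ⟨fun hx => by rw [hx, hp0] at h; exact lt_irrefl _ h, ?_⟩
    filter_upwards [(isOpen_lt (hcont 0) continuous_const).mem_nhds h] with y hy
    exact if_pos hy
  · refine Or.inr (Or.inr ?_)
    by_cases hx : x = pole n
    · have h1 : (3 / 5 : ℝ) < x.1 (Fin.last n) := by
        rw [hx]
        norm_num [pole]
      filter_upwards [(isOpen_lt continuous_const (hcont (Fin.last n))).mem_nhds h1] with y hy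
      exact pinch_mem_cap (le_of_lt hy)
    · have key : ∀ r : ℝ, |r| = 8 → ∀ᶠ y in 𝓝 x, 4 < ‖(4 : ℝ) • ster y + r • side n‖ := by
        intro r hr
        have h1 : ContinuousAt (fun y : Sph n => ‖(4 : ℝ) • ster y + r • side n‖) x := by
          have := (contMDiffAt_ster hx).continuousAt
          fun_prop
        refine h1.eventually (isOpen_Ioi.mem_nhds ?_)
        have h2 : inner ℝ (side n) ((4 : ℝ) • ster x + r • side n) = r := by
          rw [inner_add_right, inner_smul_right, inner_smul_right, inner_side_ster, h,
            real_inner_self_eq_norm_sq, norm_side]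
          ring
        have h3 := abs_real_inner_le_norm (side n) ((4 : ℝ) • ster x + r • side n)
        rw [h2, norm_side, hr] at h3
        have : (4 : ℝ) < ‖(4 : ℝ) • ster x + r • side n‖ := by linarith
        exact this
      filter_upwards [key 8 (by norm_num), key (-8) (by norm_num)] with y h1 h2
      unfold pinch
      split_ifs
      · exact (enlarge_mem_cap_iff _ _).2 h1.le
      · rw [neg_smul] at h2
        exact (enlarge_mem_cap_iff _ _).2 h2.le
  · refine Or.inr (Or.inl ⟨fun hx => by rw [hx, hp0] at h; exact lt_irrefl _ h, ?_⟩)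
    filter_upwards [(isOpen_lt continuous_const (hcont 0)).mem_nhds h] with y hy
    exact if_neg (not_lt.2 (le_of_lt hy))

end PinchLocal

/-! ### The transversal homotopy monoids -/

section Monoids

variable {E H X : Type*} [NormedAddCommGroup E] [NormedSpace ℝ E] [TopologicalSpace H]
  [TopologicalSpace X] [ChartedSpace H X] {I : ModelWithCorners ℝ E H}
variable {F G Y : Type*} [NormedAddCommGroup F] [NormedSpace ℝ F] [TopologicalSpace G]
  [TopologicalSpace Y] [ChartedSpace G Y] {J : ModelWithCorners ℝ F G}

/-- A smooth transversal map `(S^n, B^n) → (X, ⋆)`. -/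
structure TransMap (n : ℕ) (S : BasedStratification I X) where
  /-- the underlying map -/
  toFun : Sph n → X
  smooth : ContMDiff (𝓡 n) I ∞ toFun
  transversal : IsTransversal (𝓡 n) S.toStratification toFun
  based : ∀ x ∈ cap n, toFun x = S.pt

/-- Homotopy through transversal maps `(S^n, B^n) → (X, ⋆)`, constant near both ends.  The
homotopy, with parameter `t ∈ [0, 1]`, is extended to all `t ∈ ℝ` as a constant homotopy outside
`[0, 1]`. -/
def Homotopic {n : ℕ} {S : BasedStratification I X} (f g : TransMap n S) : Prop :=
  ∃ h : Sph n × ℝ → X, ContMDiff ((𝓡 n).prod 𝓘(ℝ, ℝ)) I ∞ h ∧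
    (∀ t, IsTransversal (𝓡 n) S.toStratification fun x => h (x, t)) ∧
    (∀ t, ∀ x ∈ cap n, h (x, t) = S.pt) ∧
    ∃ ε > 0, ∀ x t, (t < ε → h (x, t) = f.toFun x) ∧ (1 - ε < t → h (x, t) = g.toFun x)

theorem NormallySurjectiveAt.congr {S : Stratification I X} {f g : Y → X} {p : Y}
    (hf : NormallySurjectiveAt J S f p) (h : f =ᶠ[𝓝 p] g) : NormallySurjectiveAt J S g p := by
  have h0 : f p = g p := h.eq_of_nhds
  have h1 : HEq (mfderiv J I f p) (mfderiv J I g p) := heq_of_eq h.mfderiv_eq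
  unfold NormallySurjectiveAt at *
  revert hf h1
  generalize mfderiv J I f p = D
  generalize mfderiv J I g p = D'
  revert D D'
  rw [h0]
  intro D D' hf h1
  rw [← eq_of_heq h1]
  exact hf

theorem NormallySurjectiveAt.of_eq_pt {S : BasedStratification I X} {f : Y → X} {p : Y}
    (hp : f p = S.pt) : NormallySurjectiveAt J S.toStratification f p := by
  rw [normallySurjectiveAt_iff]
  intro A hA hpA w
  obtain ⟨U, hU, hUo, hU'⟩ := S.generic
  obtain rfl : A = U := (S.isPartition.2 S.pt).unique ⟨hA, hp ▸ hpA⟩ ⟨hU, hU'⟩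
  refine ⟨0, ?_⟩
  rw [tangentOf_eq_top_of_isOpen hUo hpA]
  trivial

theorem NormallySurjectiveAt.comp_of_surjective {S : Stratification I X} {f : Y → X} {r : Y → Y}
    {p : Y} (hf : NormallySurjectiveAt J S f (r p)) (hfd : MDifferentiableAt J I f (r p))
    (hr : MDifferentiableAt J J r p) (hs : Function.Surjective (mfderiv J J r p)) :
    NormallySurjectiveAt J S (f ∘ r) p := by
  rw [normallySurjectiveAt_iff] at *
  intro A hA hp
  rw [mfderiv_comp p hfd hr]
  intro w
  obtain ⟨v, hv⟩ := hf A hA hp w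
  obtain ⟨u, rfl⟩ := hs v
  exact ⟨u, hv⟩

/-- The composite `(f ∨ g) ∘ μ`. -/
def pinchMap {X : Type*} {n : ℕ} [NeZero n] (f g : Sph n → X) (x : Sph n) : X :=
  Sum.elim f g (pinch x)

theorem pinchMap_eq_pt {X : Type*} {n : ℕ} [NeZero n] {f g : Sph n → X} {a : X} (hf : ∀ x ∈ cap n, f x = a)
    (hg : ∀ x ∈ cap n, g x = a) {x : Sph n} (hx : Sum.elim (· ∈ cap n) (· ∈ cap n) (pinch x)) :
    pinchMap f g x = a := by
  unfold pinchMap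
  generalize pinch x = z at *
  rcases z with z | z
  · exact hf z hx
  · exact hg z hx

theorem contMDiff_pinchMap {n : ℕ} [NeZero n] {a : X} {h k : Sph n × ℝ → X}
    (hh : ContMDiff ((𝓡 n).prod 𝓘(ℝ, ℝ)) I ∞ h) (hk : ContMDiff ((𝓡 n).prod 𝓘(ℝ, ℝ)) I ∞ k)
    (hh' : ∀ t, ∀ x ∈ cap n, h (x, t) = a) (hk' : ∀ t, ∀ x ∈ cap n, k (x, t) = a) :
    ContMDiff ((𝓡 n).prod 𝓘(ℝ, ℝ)) I ∞ fun z : Sph n × ℝ =>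
      pinchMap (fun x => h (x, z.2)) (fun x => k (x, z.2)) z.1 := by
  rintro ⟨x, t⟩
  have htend : Tendsto (Prod.fst : Sph n × ℝ → Sph n) (𝓝 (x, t)) (𝓝 x) := continuousAt_fst
  have henl : ∀ c : Equator n, x ≠ pole n →
      ContMDiffAt ((𝓡 n).prod 𝓘(ℝ, ℝ)) ((𝓡 n).prod 𝓘(ℝ, ℝ)) ∞
        (fun z : Sph n × ℝ => (enlarge c z.1, z.2)) (x, t) := fun c hx =>
    ((contMDiffAt_enlarge c hx).comp (x, t) contMDiffAt_fst).prodMk contMDiffAt_snd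
  rcases pinch_local x with ⟨hx, h1⟩ | ⟨hx, h1⟩ | h1
  · refine ((hh _).comp (x, t) (henl ((8 : ℝ) • side n) hx)).congr_of_eventuallyEq ?_
    filter_upwards [htend.eventually h1] with z hz
    simp [pinchMap, hz]
  · refine ((hk _).comp (x, t) (henl (-((8 : ℝ) • side n)) hx)).congr_of_eventuallyEq ?_
    filter_upwards [htend.eventually h1] with z hz
    simp [pinchMap, hz]
  · refine (contMDiffAt_const (c := a)).congr_of_eventuallyEq ?_
    filter_upwards [htend.eventually h1] with z hz
    exact pinchMap_eq_pt (hh' z.2) (hk' z.2) hz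

theorem isTransversal_pinchMap {n : ℕ} [NeZero n] {S : BasedStratification I X} {f g : Sph n → X}
    (hf : ContMDiff (𝓡 n) I ∞ f) (hg : ContMDiff (𝓡 n) I ∞ g)
    (hf' : ∀ x ∈ cap n, f x = S.pt) (hg' : ∀ x ∈ cap n, g x = S.pt)
    (hft : IsTransversal (𝓡 n) S.toStratification f)
    (hgt : IsTransversal (𝓡 n) S.toStratification g) :
    IsTransversal (𝓡 n) S.toStratification (pinchMap f g) := by
  intro x
  rcases pinch_local x with ⟨hx, h1⟩ | ⟨hx, h1⟩ | h1
  · refine ((hft _).comp_of_surjective ((hf _).mdifferentiableAt (by simp))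
      ((contMDiffAt_enlarge ((8 : ℝ) • side n) hx).mdifferentiableAt (by simp))
      (mfderiv_enlarge_surjective _ hx)).congr ?_
    filter_upwards [h1] with z hz
    simp [pinchMap, hz]
  · refine ((hgt _).comp_of_surjective ((hg _).mdifferentiableAt (by simp))
      ((contMDiffAt_enlarge (-((8 : ℝ) • side n)) hx).mdifferentiableAt (by simp))
      (mfderiv_enlarge_surjective _ hx)).congr ?_
    filter_upwards [h1] with z hz
    simp [pinchMap, hz]
  · exact NormallySurjectiveAt.of_eq_pt (pinchMap_eq_pt hf' hg' h1.self_of_nhds)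

theorem IsTransversal.comp_reflect {n : ℕ} {S : Stratification I X} {f : Sph n → X}
    (hf : ContMDiff (𝓡 n) I ∞ f) (hft : IsTransversal (𝓡 n) S f) :
    IsTransversal (𝓡 n) S (f ∘ reflect) := fun x =>
  (hft _).comp_of_surjective ((hf _).mdifferentiableAt (by simp))
    ((contMDiff_reflect x).mdifferentiableAt (by simp)) (mfderiv_reflect_surjective x)

namespace TransMap

/-- The constant map to the basepoint. -/
def const (n : ℕ) (S : BasedStratification I X) : TransMap n S where
  toFun _ := S.pt
  smooth := contMDiff_const
  transversal _ := NormallySurjectiveAt.of_eq_pt rfl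
  based _ _ := rfl

/-- `(f ∨ g) ∘ μ`. -/
def mul {n : ℕ} [NeZero n] {S : BasedStratification I X} (f g : TransMap n S) :
    TransMap n S where
  toFun := pinchMap f.toFun g.toFun
  smooth := by
    have h := contMDiff_pinchMap (a := S.pt) (f.smooth.comp contMDiff_fst)
      (g.smooth.comp contMDiff_fst) (fun _ => f.based) (fun _ => g.based)
    exact h.comp (contMDiff_id.prodMk (contMDiff_const (c := (0 : ℝ))))
  transversal :=
    isTransversal_pinchMap f.smooth g.smooth f.based g.based f.transversal g.transversal
  based _ hx := pinchMap_eq_pt f.based g.based (pinch_mem_cap hx)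

/-- `f ∘ ρ`. -/
def dagger {n : ℕ} [NeZero n] {S : BasedStratification I X} (f : TransMap n S) :
    TransMap n S where
  toFun := f.toFun ∘ reflect
  smooth := f.smooth.comp contMDiff_reflect
  transversal := IsTransversal.comp_reflect f.smooth f.transversal
  based _ hx := f.based _ (reflect_mem_cap hx)

/-- `s ∘ f`, for a based stratified normal submersion `s`. -/
def map {n : ℕ} {S : BasedStratification I X} {T : BasedStratification J Y} {s : X → Y}
    (hs : IsNormalSubmersion S T s) (f : TransMap n S) : TransMap n T where
  toFun := s ∘ f.toFun
  smooth := hs.smooth.comp f.smooth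
  transversal := IsTransversal.comp hs f.smooth f.transversal
  based _ hx := (congrArg s (f.based _ hx)).trans hs.based

end TransMap

namespace Homotopic

theorem refl {n : ℕ} {S : BasedStratification I X} (f : TransMap n S) : Homotopic f f :=
  ⟨fun z => f.toFun z.1, f.smooth.comp contMDiff_fst, fun _ => f.transversal, fun _ => f.based,
    1, one_pos, fun _ _ => ⟨fun _ => rfl, fun _ => rfl⟩⟩

theorem symm {n : ℕ} {S : BasedStratification I X} {f g : TransMap n S} (h : Homotopic f g) :
    Homotopic g f := by
  obtain ⟨h, hs, ht, hb, ε, hε, he⟩ := h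
  refine ⟨fun z => h (z.1, 1 - z.2), ?_, fun t => ht (1 - t), fun t => hb (1 - t), ε, hε,
    fun x t => ⟨fun h1 => (he x (1 - t)).2 (by linarith), fun h1 => (he x (1 - t)).1 (by linarith)⟩⟩
  have h1 : ContMDiff 𝓘(ℝ, ℝ) 𝓘(ℝ, ℝ) ∞ fun t : ℝ => 1 - t :=
    (contDiff_const.sub contDiff_id).contMDiff
  exact hs.comp (contMDiff_fst.prodMk (h1.comp contMDiff_snd))

theorem trans {n : ℕ} {S : BasedStratification I X} {f g k : TransMap n S} (h1 : Homotopic f g)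
    (h2 : Homotopic g k) : Homotopic f k := by
  obtain ⟨h, hs, ht, hb, ε, hε, he⟩ := h1
  obtain ⟨h', hs', ht', hb', ε', hε', he'⟩ := h2
  have a1 : ContMDiff 𝓘(ℝ, ℝ) 𝓘(ℝ, ℝ) ∞ fun t : ℝ => 2 * t :=
    (contDiff_const.mul contDiff_id).contMDiff
  have a2 : ContMDiff 𝓘(ℝ, ℝ) 𝓘(ℝ, ℝ) ∞ fun t : ℝ => 2 * t - 1 :=
    ((contDiff_const.mul contDiff_id).sub contDiff_const).contMDiff
  have b1 := hs.comp (contMDiff_fst.prodMk (a1.comp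
    (contMDiff_snd (I := 𝓡 n) (J := 𝓘(ℝ, ℝ)) (M := Sph n) (N := ℝ))))
  have b2 := hs'.comp (contMDiff_fst.prodMk (a2.comp
    (contMDiff_snd (I := 𝓡 n) (J := 𝓘(ℝ, ℝ)) (M := Sph n) (N := ℝ))))
  refine ⟨fun z => if z.2 < 1 / 2 then h (z.1, 2 * z.2) else h' (z.1, 2 * z.2 - 1),
    ?_, ?_, ?_, min (1 / 2) (min (ε / 2) (ε' / 2)), by positivity, ?_⟩
  · rintro ⟨x, t⟩
    have hsnd : ContinuousAt (Prod.snd : Sph n × ℝ → ℝ) (x, t) := continuousAt_snd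
    rcases lt_trichotomy t (1 / 2) with h | h | h
    · refine (b1 (x, t)).congr_of_eventuallyEq ?_
      filter_upwards [hsnd.eventually (isOpen_Iio.mem_nhds h)] with z hz
      exact if_pos hz
    · refine ((g.smooth.comp contMDiff_fst) (x, t)).congr_of_eventuallyEq ?_
      have hm : Ioo (1 / 2 - ε / 2) (1 / 2 + ε' / 2) ∈ 𝓝 t :=
        isOpen_Ioo.mem_nhds ⟨by linarith, by linarith⟩
      filter_upwards [hsnd.eventually hm] with z hz
      simp only [Function.comp]
      split_ifs with hc
      · exact (he _ _).2 (by linarith [hz.1])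
      · exact (he' _ _).1 (by linarith [hz.2])
    · refine (b2 (x, t)).congr_of_eventuallyEq ?_
      filter_upwards [hsnd.eventually (isOpen_Ioi.mem_nhds h)] with z hz
      exact if_neg (not_lt.2 (le_of_lt hz))
  · intro t
    by_cases hc : t < 1 / 2
    · simpa only [if_pos hc] using ht (2 * t)
    · simpa only [if_neg hc] using ht' (2 * t - 1)
  · intro t x hx
    by_cases hc : t < 1 / 2
    · simpa only [if_pos hc] using hb (2 * t) x hx
    · simpa only [if_neg hc] using hb' (2 * t - 1) x hx
  · intro x t
    have m1 : min (1 / 2) (min (ε / 2) (ε' / 2)) ≤ 1 / 2 := min_le_left _ _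
    have m2 : min (1 / 2) (min (ε / 2) (ε' / 2)) ≤ ε / 2 :=
      (min_le_right _ _).trans (min_le_left _ _)
    have m3 : min (1 / 2) (min (ε / 2) (ε' / 2)) ≤ ε' / 2 :=
      (min_le_right _ _).trans (min_le_right _ _)
    constructor
    · intro h1
      simp only [if_pos (h1.trans_le m1)]
      exact (he _ _).1 (by linarith)
    · intro h1
      have : ¬ t < 1 / 2 := by linarith
      simp only [if_neg this]
      exact (he' _ _).2 (by linarith)

theorem mul {n : ℕ} [NeZero n] {S : BasedStratification I X} {f f' g g' : TransMap n S}
    (h1 : Homotopic f f') (h2 : Homotopic g g') : Homotopic (f.mul g) (f'.mul g') := by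
  obtain ⟨h, hs, ht, hb, ε, hε, he⟩ := h1
  obtain ⟨h', hs', ht', hb', ε', hε', he'⟩ := h2
  refine ⟨fun z => pinchMap (fun x => h (x, z.2)) (fun x => h' (x, z.2)) z.1,
    contMDiff_pinchMap hs hs' hb hb', ?_, ?_, min ε ε', lt_min hε hε', ?_⟩
  · intro t
    exact isTransversal_pinchMap (hs.comp (contMDiff_id.prodMk contMDiff_const))
      (hs'.comp (contMDiff_id.prodMk contMDiff_const)) (hb t) (hb' t) (ht t) (ht' t)
  · intro t x hx
    exact pinchMap_eq_pt (hb t) (hb' t) (pinch_mem_cap hx)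
  · intro x t
    have m1 := min_le_left ε ε'
    have m2 := min_le_right ε ε'
    constructor
    · intro h1
      have e1 : (fun x => h (x, t)) = f.toFun := funext fun y => (he y t).1 (by linarith)
      have e2 : (fun x => h' (x, t)) = g.toFun := funext fun y => (he' y t).1 (by linarith)
      change pinchMap (fun x => h (x, t)) (fun x => h' (x, t)) x = _
      rw [e1, e2]
      rfl
    · intro h1
      have e1 : (fun x => h (x, t)) = f'.toFun := funext fun y => (he y t).2 (by linarith)
      have e2 : (fun x => h' (x, t)) = g'.toFun := funext fun y => (he' y t).2 (by linarith)
      change pinchMap (fun x => h (x, t)) (fun x => h' (x, t)) x = _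
      rw [e1, e2]
      rfl

theorem dagger {n : ℕ} [NeZero n] {S : BasedStratification I X} {f g : TransMap n S}
    (h : Homotopic f g) : Homotopic f.dagger g.dagger := by
  obtain ⟨h, hs, ht, hb, ε, hε, he⟩ := h
  refine ⟨fun z => h (reflect z.1, z.2), ?_, ?_, fun t x hx => hb t _ (reflect_mem_cap hx), ε, hε,
    fun x t => he (reflect x) t⟩
  · exact hs.comp ((contMDiff_reflect.comp contMDiff_fst).prodMk contMDiff_snd)
  · intro t
    exact IsTransversal.comp_reflect (hs.comp (contMDiff_id.prodMk contMDiff_const)) (ht t)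

theorem map {n : ℕ} {S : BasedStratification I X} {T : BasedStratification J Y} {s : X → Y}
    (hs : IsNormalSubmersion S T s) {f g : TransMap n S} (h : Homotopic f g) :
    Homotopic (f.map hs) (g.map hs) := by
  obtain ⟨h, hsm, ht, hb, ε, hε, he⟩ := h
  refine ⟨s ∘ h, hs.smooth.comp hsm, ?_, ?_, ε, hε, ?_⟩
  · intro t
    exact IsTransversal.comp hs (hsm.comp (contMDiff_id.prodMk contMDiff_const)) (ht t)
  · intro t x hx
    exact (congrArg s (hb t x hx)).trans hs.based
  · intro x t
    exact ⟨fun h1 => congrArg s ((he x t).1 h1), fun h1 => congrArg s ((he x t).2 h1)⟩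

end Homotopic

/-- Homotopy through transversal maps, as an equivalence relation. -/
def homotopySetoid (n : ℕ) (S : BasedStratification I X) : Setoid (TransMap n S) :=
  ⟨Homotopic, Homotopic.refl, Homotopic.symm, Homotopic.trans⟩

/-- The transversal homotopy monoid `ψ_n(X)`: smooth transversal maps `(S^n, B^n) → (X, ⋆)` modulo
homotopy through such maps. -/
def Psi (n : ℕ) (S : BasedStratification I X) : Type _ := Quotient (homotopySetoid n S)

namespace Psi

/-- The class `[f]`. -/
def mk {n : ℕ} {S : BasedStratification I X} (f : TransMap n S) : Psi n S :=
  Quotient.mk (homotopySetoid n S) f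

/-- `[f] * [g] = [(f ∨ g) ∘ μ]`. -/
instance {n : ℕ} [NeZero n] {S : BasedStratification I X} : Mul (Psi n S) :=
  ⟨Quotient.map₂ TransMap.mul fun _ _ h1 _ _ h2 => Homotopic.mul h1 h2⟩

/-- The unit is the class of the constant map. -/
instance {n : ℕ} {S : BasedStratification I X} : One (Psi n S) :=
  ⟨mk (TransMap.const n S)⟩

/-- `[f]† = [f ∘ ρ]`. -/
instance {n : ℕ} [NeZero n] {S : BasedStratification I X} : Star (Psi n S) :=
  ⟨Quotient.map TransMap.dagger fun _ _ h => Homotopic.dagger h⟩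

/-- The induced map `ψ_n(s) : ψ_n(X) → ψ_n(Y)`, `[f] ↦ [s ∘ f]`, of a based stratified normal
submersion `s : X → Y`. -/
def map (n : ℕ) {S : BasedStratification I X} {T : BasedStratification J Y} {s : X → Y}
    (hs : IsNormalSubmersion S T s) : Psi n S → Psi n T :=
  Quotient.map (TransMap.map hs) fun _ _ h => Homotopic.map hs h

end Psi

end Monoids

/-! ### Dagger monoids -/

section Dagger

/-- The operations `*`, `1` and `† = star` make `M` a dagger monoid: an associative monoid with an
anti-involution. -/
structure IsDaggerMonoid (M : Type*) [Mul M] [One M] [Star M] : Prop where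
  mul_assoc : ∀ a b c : M, a * b * c = a * (b * c)
  one_mul : ∀ a : M, 1 * a = a
  mul_one : ∀ a : M, a * 1 = a
  dagger_dagger : ∀ a : M, star (star a) = a
  dagger_one : star (1 : M) = 1
  dagger_mul : ∀ a b : M, star (a * b) = star b * star a

/-- Maps of dagger monoids preserve the unit, the product and the anti-involution. -/
structure IsDaggerHom {M N : Type*} [Mul M] [One M] [Star M] [Mul N] [One N] [Star N]
    (φ : M → N) : Prop where
  map_one : φ 1 = 1
  map_mul : ∀ a b : M, φ (a * b) = φ a * φ b
  map_dagger : ∀ a : M, φ (star a) = star (φ a)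

/-- `1 → L → M → N → 1` is a short exact sequence of dagger monoids: all terms are dagger monoids,
both maps are maps of dagger monoids, the first one is injective, the second one is
surjective, and the image of the first is the kernel of the second. -/
structure IsShortExact {L M N : Type*} [Mul L] [One L] [Star L] [Mul M] [One M] [Star M]
    [Mul N] [One N] [Star N] (i : L → M) (p : M → N) : Prop where
  left_monoid : IsDaggerMonoid L
  mid_monoid : IsDaggerMonoid M
  right_monoid : IsDaggerMonoid N
  left_hom : IsDaggerHom i
  right_hom : IsDaggerHom p
  injective : Function.Injective i
  surjective : Function.Surjective p
  exact : ∀ m : M, (∃ l, i l = m) ↔ p m = 1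

end Dagger

end TransHtpy

end

open TransHtpy

noncomputable section

namespace TransHtpy

/-! ### Rescaling maps into balls of the stereographic chart -/

section Insertion

/-! Monoid laws. In stereographic coordinates a map that is constant on the cap lives on the ball of
radius 4, and `ins` shrinks it into a ball with center on the axis of `side`. A product is two such
pieces, in the balls of radius 1 around -2 and 2 (`pinchMap_eq_join`), so the unit laws and
associativity are proved by moving balls along segments while keeping them disjoint and away from
the cap (`isFamily_movingIns`, `movingIns_separated`). Each piece is precomposed with an affine
diffeomorphism, so transversality is never lost. The laws for the dagger hold on representatives.

Exactness. Injectivity, surjectivity and the splitting are functoriality. For the kernel, let `f =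
(f₁, f₂)` with `f₂` null homotopic through transversal maps. Such a homotopy cannot leave the open
stratum `U` of the basepoint: meeting `U` only is an open condition on the parameter because the
sphere is compact, and a closed one because a transversal meeting with another stratum persists
(`eventually_exists_mem_stratum`). While the second component is in `U`, transversality of the pair
is transversality of `f₁` alone, so the homotopy deforms `f` to `(f₁, ⋆)` (`exists_map_inl_eq`).

Not a product. Take for both factors the line stratified by the origin and two half-lines. A
transversal loop in the plane crosses the two axes nondegenerately and avoids their intersection, so
it spells a word in two letters. The set of all subwords of this word, `pattern`, is a homotopy
invariant, since each membership is both open and closed in the parameter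
(`GenericFamily.pattern_eq`), and it turns products into products of sets of words. Subwords serve
better than the word itself, since membership is just the existence of increasing zeros. The two
loops that cross one axis and return are irreducible and do not commute. Under an isomorphism with a
product of monoids each would lie in one factor, both in the same one as they do not commute, and
the other factor would commute with both; but only 1 does (`isEmpty_mulEquiv_of_words`). -/

theorem mfderiv_surjective_of_rightInverse {E H M : Type*} [NormedAddCommGroup E] [NormedSpace ℝ E]
    [TopologicalSpace H] [TopologicalSpace M] [ChartedSpace H M] {I : ModelWithCorners ℝ E H}
    {E' H' N : Type*} [NormedAddCommGroup E'] [NormedSpace ℝ E']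
    [TopologicalSpace H'] [TopologicalSpace N] [ChartedSpace H' N] {J : ModelWithCorners ℝ E' H'}
    {f : M → N} {g : N → M} {x : M} {y : N} (hx : g y = x) (hfg : ∀ᶠ z in 𝓝 y, f (g z) = z)
    (hg : MDifferentiableAt J I g y) (hf : MDifferentiableAt I J f x) :
    Function.Surjective (mfderiv I J f x) := by
  subst hx
  have hy : f (g y) = y := hfg.self_of_nhds
  have h1 : (f ∘ g) =ᶠ[𝓝 y] id := hfg
  have h2 : (mfderiv I J f (g y)).comp (mfderiv J I g y) = mfderiv J J id y := by
    rw [← mfderiv_comp y hf hg]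
    exact h1.mfderiv_eq
  rw [mfderiv_id] at h2
  exact fun v => ⟨mfderiv J I g y v, DFunLike.congr_fun h2 v⟩

theorem mfderiv_sterInv_surjective {n : ℕ} (w : Equator n) :
    Function.Surjective (mfderiv 𝓘(ℝ, Equator n) (𝓡 n) (sterInv : Equator n → Sph n) w) := by
  refine mfderiv_surjective_of_rightInverse (ster_sterInv w) ?_
    ((contMDiffAt_ster (sterInv_ne_pole w)).mdifferentiableAt (by simp))
    ((contMDiff_sterInv w).mdifferentiableAt (by simp))
  filter_upwards [isOpen_ne.mem_nhds (sterInv_ne_pole w)] with z hz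
  exact sterInv_ster hz

theorem pole_last (n : ℕ) : (pole n).1 (Fin.last n) = 1 := by
  simp [pole]

theorem pole_zero (n : ℕ) [NeZero n] : (pole n).1 0 = 0 := by
  have h : (0 : Fin (n + 1)) ≠ Fin.last n := fun h => NeZero.ne n (by
    simpa using congrArg Fin.val h.symm)
  simp [pole, h]

theorem cap_mem_nhds_pole (n : ℕ) : cap n ∈ 𝓝 (pole n) := by
  have h1 : (3 / 5 : ℝ) < (pole n).1 (Fin.last n) := by
    rw [pole_last]
    norm_num
  have hc : Continuous fun y : Sph n => y.1 (Fin.last n) := by fun_prop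
  filter_upwards [(isOpen_lt continuous_const hc).mem_nhds h1] with y hy
  exact le_of_lt hy

theorem pole_mem_cap (n : ℕ) : pole n ∈ cap n := mem_of_mem_nhds (cap_mem_nhds_pole n)

theorem four_le_norm_ster {n : ℕ} {x : Sph n} (hx : x ∈ cap n) (hp : x ≠ pole n) :
    4 ≤ ‖ster x‖ := by
  rwa [← sterInv_ster hp, sterInv_mem_cap_iff] at hx

variable {X : Type*}

open Classical in
/-- The map `f : S^n → X`, which is constant with value `a` outside of the ball of radius `4`
in stereographic coordinates, rescaled to the ball of radius `r` around `c e₀`. -/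
def ins {n : ℕ} [NeZero n] (a : X) (f : Sph n → X) (c r : ℝ) (x : Sph n) : X :=
  -- `ster` has a junk value at the pole, so this point gets its value separately.
  if x = pole n then a else f (sterInv ((4 / r) • (ster x - c • side n)))

theorem ins_pole {n : ℕ} [NeZero n] (a : X) (f : Sph n → X) (c r : ℝ) :
    ins a f c r (pole n) = a := if_pos rfl

theorem ins_of_ne {n : ℕ} [NeZero n] (a : X) (f : Sph n → X) (c r : ℝ) {x : Sph n}
    (hx : x ≠ pole n) : ins a f c r x = f (sterInv ((4 / r) • (ster x - c • side n))) := if_neg hx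

theorem ins_eq_of_le {n : ℕ} [NeZero n] {a : X} {f : Sph n → X} (hf : ∀ x ∈ cap n, f x = a)
    {c r : ℝ} (hr : 0 < r) {x : Sph n} (hx : r ≤ ‖ster x - c • side n‖) : ins a f c r x = a := by
  by_cases hp : x = pole n
  · rw [hp, ins_pole]
  · rw [ins_of_ne _ _ _ _ hp]
    refine hf _ ((sterInv_mem_cap_iff _).2 ?_)
    rw [norm_smul, Real.norm_of_nonneg (by positivity), div_mul_eq_mul_div, le_div_iff₀ hr]
    linarith

/-- The bound `|c| + r ≤ 4` puts the ball inside the ball of radius 4, which is the complement of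
the cap. -/
theorem ins_eq_of_mem_cap {n : ℕ} [NeZero n] {a : X} {f : Sph n → X} (hf : ∀ x ∈ cap n, f x = a)
    {c r : ℝ} (hr : 0 < r) (hcr : |c| + r ≤ 4) {x : Sph n} (hx : x ∈ cap n) :
    ins a f c r x = a := by
  by_cases hp : x = pole n
  · rw [hp, ins_pole]
  · refine ins_eq_of_le hf hr ?_
    have h1 := four_le_norm_ster hx hp
    have h2 := norm_sub_norm_le (ster x) (c • side n)
    rw [norm_smul, norm_side, Real.norm_eq_abs, mul_one] at h2
    linarith

theorem eventually_ins_eq {n : ℕ} [NeZero n] {a : X} {f : Sph n → X}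
    (hf : ∀ x ∈ cap n, f x = a) {c r : ℝ → ℝ} (hr : ∀ t, 0 < r t)
    (hcr : ∀ t, |c t| + r t ≤ 4) (t : ℝ) :
    ∀ᶠ z in 𝓝 (pole n, t), ins a f (c z.2) (r z.2) z.1 = a := by
  have : Tendsto (Prod.fst : Sph n × ℝ → Sph n) (𝓝 (pole n, t)) (𝓝 (pole n)) := continuousAt_fst
  filter_upwards [this.eventually (cap_mem_nhds_pole n)] with z hz
  exact ins_eq_of_mem_cap hf (hr _) (hcr _) hz

/-- By Cauchy–Schwarz, a point beyond the hyperplane tangent to the ball is outside the open ball.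
-/
theorem ins_eq_of_side_le {n : ℕ} [NeZero n] {a : X} {f : Sph n → X}
    (hf : ∀ x ∈ cap n, f x = a) {c r : ℝ} (hr : 0 < r) {x : Sph n}
    (hx : c + r ≤ inner ℝ (side n) (ster x)) : ins a f c r x = a := by
  refine ins_eq_of_le hf hr ?_
  have h3 := real_inner_le_norm (side n) (ster x - c • side n)
  rw [norm_side, inner_sub_right, inner_smul_right, real_inner_self_eq_norm_sq, norm_side] at h3
  linarith

theorem ins_eq_of_le_side {n : ℕ} [NeZero n] {a : X} {f : Sph n → X}
    (hf : ∀ x ∈ cap n, f x = a) {c r : ℝ} (hr : 0 < r) {x : Sph n}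
    (hx : inner ℝ (side n) (ster x) ≤ c - r) : ins a f c r x = a := by
  refine ins_eq_of_le hf hr ?_
  have h3 := neg_le_of_abs_le (abs_real_inner_le_norm (side n) (ster x - c • side n))
  rw [norm_side, inner_sub_right, inner_smul_right, real_inner_self_eq_norm_sq, norm_side] at h3
  linarith

/-- A moving hyperplane orthogonal to `side n` separates the two balls, so near each point of the
sphere and each time one of the pieces is constant. This is the hypothesis under which `join`
preserves smoothness and transversality. The pole is handled by the cap. -/
theorem ins_separated {n : ℕ} [NeZero n] {a : X} {f g : Sph n → X}
    (hf : ∀ x ∈ cap n, f x = a) (hg : ∀ x ∈ cap n, g x = a) {c r c' r' : ℝ → ℝ}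
    (hc : Continuous c) (hrc : Continuous r) (hc' : Continuous c') (hrc' : Continuous r')
    (hr : ∀ t, 0 < r t) (hr' : ∀ t, 0 < r' t)
    (hcr : ∀ t, |c t| + r t ≤ 4) (hs : ∀ t, c t + r t < c' t - r' t) (z : Sph n × ℝ) :
    (∀ᶠ y in 𝓝 z, ins a f (c y.2) (r y.2) y.1 = a) ∨
      ∀ᶠ y in 𝓝 z, ins a g (c' y.2) (r' y.2) y.1 = a := by
  obtain ⟨x, t⟩ := z
  by_cases hp : x = pole n
  · subst hp
    exact Or.inl (eventually_ins_eq hf hr hcr t)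
  · have h1 : ContinuousAt (fun z : Sph n × ℝ => inner ℝ (side n) (ster z.1)) (x, t) := by
      have h2 : ContinuousAt (ster : Sph n → Equator n) x := (contMDiffAt_ster hp).continuousAt
      have h3 : ContinuousAt (fun z : Sph n × ℝ => ster z.1) (x, t) :=
        h2.comp (f := Prod.fst) (x := (x, t)) continuousAt_fst
      exact continuousAt_const.inner h3
    have h2 : ContinuousAt (fun z : Sph n × ℝ => c z.2 + r z.2) (x, t) := by fun_prop
    have h3 : ContinuousAt (fun z : Sph n × ℝ => c' z.2 - r' z.2) (x, t) := by fun_prop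
    rcases lt_or_ge (c t + r t) (inner ℝ (side n) (ster x)) with h | h
    · left
      filter_upwards [h2.eventually_lt h1 h] with y hy
      exact ins_eq_of_side_le hf (hr _) hy.le
    · right
      filter_upwards [h1.eventually_lt h3 (lt_of_le_of_lt h (hs t))] with y hy
      exact ins_eq_of_le_side hg (hr' _) hy.le

/-- Composition of affine maps, as for little disks; the factor `r' / 4` appears because the
standard ball has radius 4. -/
theorem ins_ins {n : ℕ} [NeZero n] (a : X) (f : Sph n → X) (c r c' : ℝ) {r' : ℝ}
    (hr' : r' ≠ 0) : ins a (ins a f c r) c' r' = ins a f (c' + r' / 4 * c) (r * r' / 4) := by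
  funext x
  by_cases hp : x = pole n
  · rw [hp, ins_pole, ins_pole]
  · rw [ins_of_ne _ _ _ _ hp, ins_of_ne _ _ _ _ hp, ins_of_ne _ _ _ _ (sterInv_ne_pole _),
      ster_sterInv]
    congr 2
    by_cases hr : r = 0
    · simp [hr]
    · match_scalars
      · field_simp
      · field_simp
        ring

theorem ins_zero_four {n : ℕ} [NeZero n] {a : X} {f : Sph n → X} (hf : ∀ x ∈ cap n, f x = a) :
    ins a f 0 4 = f := by
  funext x
  by_cases hp : x = pole n
  · rw [hp, ins_pole, hf _ (pole_mem_cap n)]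
  · rw [ins_of_ne _ _ _ _ hp, div_self four_ne_zero, one_smul, zero_smul, sub_zero,
      sterInv_ster hp]

theorem ins_const {n : ℕ} [NeZero n] (a : X) (c r : ℝ) :
    ins a (fun _ : Sph n => a) c r = fun _ => a := by
  funext x
  simp [ins]

open Classical in
/-- The map that is `f` where `f` differs from `a`, and `g` elsewhere. -/
def join {Z : Type*} (a : X) (f g : Z → X) (z : Z) : X := if f z = a then g z else f z

theorem join_of_left {Z : Type*} {a : X} {f g : Z → X} {z : Z} (h : f z = a) :
    join a f g z = g z := if_pos h

theorem join_of_right {Z : Type*} {a : X} {f g : Z → X} {z : Z} (h : g z = a) :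
    join a f g z = f z := by
  unfold join
  split_ifs with h1
  · rw [h, h1]
  · rfl

theorem join_congr {Z Z' : Type*} {a : X} {f g : Z → X} {f' g' : Z' → X} {z : Z} {z' : Z'}
    (hf : f z = f' z') (hg : g z = g' z') : join a f g z = join a f' g' z' := by
  unfold join
  rw [hf, hg]

theorem join_assoc {Z : Type*} (a : X) (f g h : Z → X) :
    join a (join a f g) h = join a f (join a g h) := by
  funext z
  by_cases hf : f z = a
  · rw [join_of_left hf]
    exact join_congr (join_of_left hf) rfl
  · have h1 : join a f g z = f z := if_neg hf
    have h2 : join a (join a f g) h z = join a f g z := if_neg (h1 ▸ hf)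
    rw [h2, h1]
    exact (if_neg hf).symm

theorem ins_join {n : ℕ} [NeZero n] (a : X) (f g : Sph n → X) (c r : ℝ) :
    ins a (join a f g) c r = join a (ins a f c r) (ins a g c r) := by
  funext x
  by_cases hp : x = pole n
  · rw [hp, join_of_left] <;> simp only [ins_pole]
  · rw [ins_of_ne _ _ _ _ hp]
    exact join_congr (ins_of_ne _ _ _ _ hp).symm (ins_of_ne _ _ _ _ hp).symm

theorem inner_side_ster_neg_iff {n : ℕ} [NeZero n] (x : Sph n) :
    inner ℝ (side n) (ster x) < 0 ↔ x.1 0 < 0 := by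
  by_cases hp : x = pole n
  · rw [inner_side_ster, hp, pole_zero, mul_zero]
  · have h1 : x.1 (Fin.last n) < 1 := by
      rw [← sterInv_ster hp, sterInv_last, div_lt_one (by positivity)]
      linarith
    rw [inner_side_ster]
    have : 0 < 2 / (1 - x.1 (Fin.last n)) := by
      apply div_pos two_pos
      linarith
    constructor
    · intro h
      by_contra! h'
      exact absurd h (not_lt.2 (mul_nonneg this.le h'))
    · exact mul_neg_of_pos_of_neg this

/-- The enlargements `w ↦ 4 w ± 8 e₀` are the rescalings from the unit balls around `∓ 2 e₀`. In
each half of the sphere, the piece of the other half is constant. -/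
theorem pinchMap_eq_join {n : ℕ} [NeZero n] {a : X} {f g : Sph n → X}
    (hf : ∀ x ∈ cap n, f x = a) (hg : ∀ x ∈ cap n, g x = a) :
    pinchMap f g = join a (ins a f (-2) 1) (ins a g 2 1) := by
  funext x
  unfold pinchMap pinch
  split_ifs with h
  · have hp : x ≠ pole n := by
      rintro rfl
      rw [pole_zero] at h
      exact lt_irrefl _ h
    rw [← inner_side_ster_neg_iff] at h
    rw [join_of_right (ins_eq_of_le_side hg one_pos (by linarith)), ins_of_ne _ _ _ _ hp]
    simp only [Sum.elim_inl, enlarge]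
    congr 2
    module
  · rw [← inner_side_ster_neg_iff] at h
    rw [join_of_left (ins_eq_of_side_le hf one_pos (by linarith))]
    by_cases hp : x = pole n
    · rw [hp, ins_pole]
      exact hg _ (enlarge_mem_cap (by rw [norm_neg, norm_eight_side]) (pole_mem_cap n))
    · rw [ins_of_ne _ _ _ _ hp]
      simp only [Sum.elim_inr, enlarge]
      congr 2
      module

end Insertion

/-! ### Smooth families of inserted maps -/

section Families

variable {E H X : Type*} [NormedAddCommGroup E] [NormedSpace ℝ E] [TopologicalSpace H]
  [TopologicalSpace X] [ChartedSpace H X] {I : ModelWithCorners ℝ E H}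

/-- A smooth family of transversal maps `(S^n, B^n) → (X, ⋆)`. -/
structure IsFamily {n : ℕ} (S : BasedStratification I X) (h : Sph n × ℝ → X) : Prop where
  smooth : ContMDiff ((𝓡 n).prod 𝓘(ℝ, ℝ)) I ∞ h
  transversal : ∀ t, IsTransversal (𝓡 n) S.toStratification fun x => h (x, t)
  based : ∀ t, ∀ x ∈ cap n, h (x, t) = S.pt

/-- Smoothness and transversality are local, and locally the join is one of the two families. -/
theorem IsFamily.join {n : ℕ} {S : BasedStratification I X} {h k : Sph n × ℝ → X}
    (hh : IsFamily S h) (hk : IsFamily S k)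
    (hs : ∀ z, (∀ᶠ y in 𝓝 z, h y = S.pt) ∨ ∀ᶠ y in 𝓝 z, k y = S.pt) :
    IsFamily S (join S.pt h k) where
  smooth z := by
    rcases hs z with h1 | h1
    · exact (hk.smooth z).congr_of_eventuallyEq (h1.mono fun y hy => join_of_left hy)
    · exact (hh.smooth z).congr_of_eventuallyEq (h1.mono fun y hy => join_of_right hy)
  transversal t x := by
    have hc : Tendsto (fun y : Sph n => (y, t)) (𝓝 x) (𝓝 (x, t)) :=
      (Continuous.prodMk_left t).continuousAt
    rcases hs (x, t) with h1 | h1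
    · exact (hk.transversal t x).congr
        ((hc.eventually h1).mono fun y hy => (join_of_left hy).symm)
    · exact (hh.transversal t x).congr
        ((hc.eventually h1).mono fun y hy => (join_of_right hy).symm)
  based t x hx := (join_of_left (hh.based t x hx)).trans (hk.based t x hx)

/-- The inverse affine map, read on the sphere, is a local inverse. Hence rescaling a map preserves
its transversality. -/
theorem mfderiv_smul_add_surjective {n : ℕ} {k : ℝ} (hk : k ≠ 0) (b : Equator n) {x : Sph n}
    (hx : x ≠ pole n) : Function.Surjective
      (mfderiv (𝓡 n) (𝓡 n) (fun y : Sph n => (sterInv (k • (ster y - b)) : Sph n)) x) := by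
  have hsm : ∀ (k : ℝ) (b c : Equator n) {x : Sph n} (hx : x ≠ pole n), ContMDiffAt (𝓡 n) (𝓡 n) ∞
      (fun y : Sph n => (sterInv (k • (ster y - b) + c) : Sph n)) x := by
    intro k b c x hx
    have h : ContDiff ℝ ∞ (fun w : Equator n => k • (w - b) + c) := by fun_prop
    exact (contMDiff_sterInv _).comp x ((h.contMDiff _).comp x (contMDiffAt_ster hx))
  have hsm0 := hsm k b 0 hx
  simp only [add_zero] at hsm0
  -- The inverse is `w ↦ k⁻¹ w + b`, written with `- 0` so that `hsm` covers its smoothness too.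
  refine mfderiv_surjective_of_rightInverse
    (g := fun y : Sph n => sterInv (k⁻¹ • (ster y - 0) + b))
    (y := sterInv (k • (ster x - b))) ?_ ?_
    ((hsm _ _ _ (sterInv_ne_pole _)).mdifferentiableAt (by simp))
    (hsm0.mdifferentiableAt (by simp))
  · simp only [ster_sterInv, sub_zero]
    rw [inv_smul_smul₀ hk, sub_add_cancel, sterInv_ster hx]
  · filter_upwards [isOpen_ne.mem_nhds (sterInv_ne_pole (k • (ster x - b)))] with z hz
    simp only [ster_sterInv, sub_zero]
    rw [add_sub_cancel_right, smul_inv_smul₀ hk, sterInv_ster hz]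

/-- Away from the pole this is `f` after a smooth family of affine diffeomorphisms; near the pole it
is constant, since the ball stays off the cap. -/
theorem isFamily_ins {n : ℕ} [NeZero n] {S : BasedStratification I X} (f : TransMap n S)
    {c r : ℝ → ℝ} (hc : ContDiff ℝ ∞ c) (hrc : ContDiff ℝ ∞ r) (hr : ∀ t, 0 < r t)
    (hcr : ∀ t, |c t| + r t ≤ 4) :
    IsFamily S fun z : Sph n × ℝ => ins S.pt f.toFun (c z.2) (r z.2) z.1 where
  smooth := by
    rintro ⟨x, t⟩
    by_cases hp : x = pole n
    · subst hp
      exact (contMDiffAt_const (c := S.pt)).congr_of_eventuallyEq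
        (eventually_ins_eq f.based hr hcr t)
    · have hk : ContDiff ℝ ∞ (fun w : Equator n × ℝ =>
          (4 / r w.2) • (w.1 - c w.2 • side n)) := by
        have k1 : ContDiff ℝ ∞ (fun w : Equator n × ℝ => 4 / r w.2) :=
          contDiff_const.div (hrc.comp contDiff_snd) fun w => (hr _).ne'
        have k2 : ContDiff ℝ ∞ (fun w : Equator n × ℝ => c w.2) := hc.comp contDiff_snd
        exact k1.smul (contDiff_fst.sub (k2.smul contDiff_const))
      have h1 : ContMDiffAt ((𝓡 n).prod 𝓘(ℝ, ℝ)) 𝓘(ℝ, Equator n × ℝ) ∞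
          (fun z : Sph n × ℝ => (ster z.1, z.2)) (x, t) :=
        (((contMDiffAt_ster hp).comp (x, t) contMDiffAt_fst)).prodMk_space contMDiffAt_snd
      refine ((f.smooth _).comp (x, t) ((contMDiff_sterInv _).comp (x, t)
        ((hk.contMDiff _).comp (x, t) h1))).congr_of_eventuallyEq ?_
      have hfst : ContinuousAt (Prod.fst : Sph n × ℝ → Sph n) (x, t) := continuousAt_fst
      filter_upwards [hfst.eventually (isOpen_ne.mem_nhds hp)] with z hz
      exact ins_of_ne _ _ _ _ hz
  transversal t x := by
    by_cases hp : x = pole n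
    · subst hp
      exact NormallySurjectiveAt.of_eq_pt (ins_pole _ _ _ _)
    · have h : ContDiff ℝ ∞ (fun w : Equator n => (4 / r t) • (w - c t • side n)) := by fun_prop
      refine ((f.transversal _).comp_of_surjective ((f.smooth _).mdifferentiableAt (by simp))
        (ContMDiffAt.mdifferentiableAt (n := ∞) ?_ (by simp))
        (mfderiv_smul_add_surjective (k := 4 / r t) ?_ (c t • side n) hp)).congr ?_
      · exact (contMDiff_sterInv _).comp x ((h.contMDiff _).comp x (contMDiffAt_ster hp))
      · have := hr t
        positivity
      · filter_upwards [isOpen_ne.mem_nhds hp] with z hz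
        exact (ins_of_ne _ _ _ _ hz).symm
  based t x hx := ins_eq_of_mem_cap f.based (hr t) (hcr t) hx

/-- A smooth function which is `0` for `t ≤ 1 / 3` and `1` for `2 / 3 ≤ t`. -/
def step (t : ℝ) : ℝ := Real.smoothTransition (3 * t - 1)

theorem step_nonneg (t : ℝ) : 0 ≤ step t := Real.smoothTransition.nonneg _

theorem step_le_one (t : ℝ) : step t ≤ 1 := Real.smoothTransition.le_one _

theorem contDiff_step : ContDiff ℝ ∞ step :=
  Real.smoothTransition.contDiff.comp ((contDiff_const.mul contDiff_id).sub contDiff_const)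

theorem step_of_lt {t : ℝ} (ht : t < 1 / 3) : step t = 0 :=
  Real.smoothTransition.zero_of_nonpos (by linarith)

theorem step_of_gt {t : ℝ} (ht : 1 - 1 / 3 < t) : step t = 1 :=
  Real.smoothTransition.one_of_one_le (by linarith)

/-- A smooth path from `a` to `b` along a line segment. -/
def path (a b t : ℝ) : ℝ := (1 - step t) * a + step t * b

theorem contDiff_path (a b : ℝ) : ContDiff ℝ ∞ (path a b) :=
  ((contDiff_const.sub contDiff_step).mul contDiff_const).add (contDiff_step.mul contDiff_const)

theorem path_of_lt {t : ℝ} (ht : t < 1 / 3) (a b : ℝ) : path a b t = a := by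
  simp [path, step_of_lt ht]

theorem path_of_gt {t : ℝ} (ht : 1 - 1 / 3 < t) (a b : ℝ) : path a b t = b := by
  simp [path, step_of_gt ht]

theorem path_pos {a b : ℝ} (ha : 0 < a) (hb : 0 < b) (t : ℝ) : 0 < path a b t := by
  have h0 := step_nonneg t
  have h1 := step_le_one t
  have h2 := mul_nonneg (sub_nonneg.2 h1) ha.le
  have h3 := mul_nonneg h0 hb.le
  unfold path
  rcases h0.eq_or_lt with h | h
  · rw [← h]
    linarith
  · have := mul_pos h hb
    linarith

theorem path_sub (a b a' b' t : ℝ) : path a b t - path a' b' t = path (a - a') (b - b') t := by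
  unfold path
  ring

theorem path_add (a b a' b' t : ℝ) : path a b t + path a' b' t = path (a + a') (b + b') t := by
  unfold path
  ring

theorem path_mono {a b a' b' : ℝ} (ha : a ≤ a') (hb : b ≤ b') (t : ℝ) :
    path a b t ≤ path a' b' t := by
  have h2 := mul_le_mul_of_nonneg_left ha (sub_nonneg.2 (step_le_one t))
  have h3 := mul_le_mul_of_nonneg_left hb (step_nonneg t)
  unfold path
  linarith

theorem path_const (a t : ℝ) : path a a t = a := by
  unfold path
  ring

/-- Convexity of the absolute value: bounds such as `|c| + r ≤ 4` need only be checked at the two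
ends of a path. -/
theorem abs_path_le (a b t : ℝ) : |path a b t| ≤ path |a| |b| t := by
  rw [abs_le]
  refine ⟨?_, path_mono (le_abs_self a) (le_abs_self b) t⟩
  have h := path_mono (neg_abs_le a) (neg_abs_le b) t
  unfold path at *
  linarith

theorem IsFamily.homotopic {n : ℕ} {S : BasedStratification I X} {h : Sph n × ℝ → X}
    (hh : IsFamily S h) {f g : TransMap n S} (hf : ∀ x t, t < 1 / 3 → h (x, t) = f.toFun x)
    (hg : ∀ x t, 1 - 1 / 3 < t → h (x, t) = g.toFun x) : Homotopic f g :=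
  ⟨h, hh.smooth, hh.transversal, hh.based, 1 / 3, by norm_num, fun x t => ⟨hf x t, hg x t⟩⟩

/-- A map inserted into a ball that moves along a segment, from radius `r` and center `c` to radius
`r'` and center `c'`. -/
def movingIns {n : ℕ} [NeZero n] {S : BasedStratification I X} (f : TransMap n S)
    (c c' r r' : ℝ) (z : Sph n × ℝ) : X :=
  ins S.pt f.toFun (path c c' z.2) (path r r' z.2) z.1

theorem isFamily_movingIns {n : ℕ} [NeZero n] {S : BasedStratification I X} (f : TransMap n S)
    {c c' r r' : ℝ} (hr : 0 < r) (hr' : 0 < r') (h : |c| + r ≤ 4) (h' : |c'| + r' ≤ 4) :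
    IsFamily S (movingIns f c c' r r') := by
  refine isFamily_ins f (contDiff_path c c') (contDiff_path r r') (path_pos hr hr') fun t => ?_
  have h1 := abs_path_le c c' t
  have h2 := path_mono h h' t
  rw [← path_add, path_const] at h2
  linarith

/-- Being separated is the linear inequality `c + r < d - q`, so it holds along the segment as soon
as it holds at both ends. -/
theorem movingIns_separated {n : ℕ} [NeZero n] {S : BasedStratification I X} (f g : TransMap n S)
    {c c' r r' d d' q q' : ℝ} (hr : 0 < r) (hr' : 0 < r') (hq : 0 < q) (hq' : 0 < q')
    (h : |c| + r ≤ 4) (h' : |c'| + r' ≤ 4) (hs : c + r < d - q) (hs' : c' + r' < d' - q')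
    (z : Sph n × ℝ) :
    (∀ᶠ y in 𝓝 z, movingIns f c c' r r' y = S.pt) ∨
      ∀ᶠ y in 𝓝 z, movingIns g d d' q q' y = S.pt := by
  refine ins_separated f.based g.based (contDiff_path c c').continuous
    (contDiff_path r r').continuous (contDiff_path d d').continuous (contDiff_path q q').continuous
    (path_pos hr hr') (path_pos hq hq') (fun t => ?_) (fun t => ?_) z
  · have h1 := abs_path_le c c' t
    have h2 := path_mono h h' t
    rw [← path_add, path_const] at h2
    linarith
  · have := path_pos (sub_pos.2 hs) (sub_pos.2 hs') t
    rw [← path_sub, ← path_sub, ← path_add] at this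
    linarith

theorem movingIns_of_lt {n : ℕ} [NeZero n] {S : BasedStratification I X} (f : TransMap n S)
    (c c' r r' : ℝ) {t : ℝ} (ht : t < 1 / 3) (x : Sph n) :
    movingIns f c c' r r' (x, t) = ins S.pt f.toFun c r x := by
  simp only [movingIns, path_of_lt ht]

theorem movingIns_of_gt {n : ℕ} [NeZero n] {S : BasedStratification I X} (f : TransMap n S)
    (c c' r r' : ℝ) {t : ℝ} (ht : 1 - 1 / 3 < t) (x : Sph n) :
    movingIns f c c' r r' (x, t) = ins S.pt f.toFun c' r' x := by
  simp only [movingIns, path_of_gt ht]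

/-! ### The dagger monoid laws -/

theorem TransMap.mul_toFun {n : ℕ} [NeZero n] {S : BasedStratification I X} (f g : TransMap n S) :
    (f.mul g).toFun = TransHtpy.join S.pt (ins S.pt f.toFun (-2) 1) (ins S.pt g.toFun 2 1) :=
  pinchMap_eq_join f.based g.based

/-- The product is `f` in the ball of radius 1 around 2, which grows to the ball of radius 4 around
0, where the insertion is `f` itself. -/
theorem Homotopic.one_mul {n : ℕ} [NeZero n] {S : BasedStratification I X} (f : TransMap n S) :
    Homotopic ((TransMap.const n S).mul f) f := by
  have e : ((TransMap.const n S).mul f).toFun = ins S.pt f.toFun 2 1 := by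
    rw [TransMap.mul_toFun]
    funext x
    exact join_of_left (congrFun (ins_const S.pt _ _) x)
  refine (isFamily_movingIns f (c := 2) (c' := 0) (r := 1) (r' := 4) one_pos four_pos
    (by norm_num) (by norm_num)).homotopic (fun x t ht => ?_) (fun x t ht => ?_)
  · rw [movingIns_of_lt _ _ _ _ _ ht, e]
  · rw [movingIns_of_gt _ _ _ _ _ ht, ins_zero_four f.based]

theorem Homotopic.mul_one {n : ℕ} [NeZero n] {S : BasedStratification I X} (f : TransMap n S) :
    Homotopic (f.mul (TransMap.const n S)) f := by
  have e : (f.mul (TransMap.const n S)).toFun = ins S.pt f.toFun (-2) 1 := by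
    rw [TransMap.mul_toFun]
    funext x
    exact join_of_right (congrFun (ins_const S.pt _ _) x)
  refine (isFamily_movingIns f (c := -2) (c' := 0) (r := 1) (r' := 4) one_pos four_pos
    (by norm_num) (by norm_num)).homotopic (fun x t ht => ?_) (fun x t ht => ?_)
  · rw [movingIns_of_lt _ _ _ _ _ ht, e]
  · rw [movingIns_of_gt _ _ _ _ _ ht, ins_zero_four f.based]

/-- Both bracketings put the three maps, in the same order along the axis, into disjoint balls:
centers -5/2, -3/2, 2 with radii 1/4, 1/4, 1, and centers -2, 3/2, 5/2 with radii 1, 1/4, 1/4. The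
balls move along segments. -/
theorem Homotopic.mul_assoc {n : ℕ} [NeZero n] {S : BasedStratification I X}
    (f g h : TransMap n S) : Homotopic ((f.mul g).mul h) (f.mul (g.mul h)) := by
  have e1 : ((f.mul g).mul h).toFun = TransHtpy.join S.pt (ins S.pt f.toFun (-5 / 2) (1 / 4))
      (TransHtpy.join S.pt (ins S.pt g.toFun (-3 / 2) (1 / 4)) (ins S.pt h.toFun 2 1)) := by
    rw [TransMap.mul_toFun, TransMap.mul_toFun, ins_join, ins_ins _ _ _ _ _ one_ne_zero,
      ins_ins _ _ _ _ _ one_ne_zero, join_assoc]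
    norm_num
  have e2 : (f.mul (g.mul h)).toFun = TransHtpy.join S.pt (ins S.pt f.toFun (-2) 1)
      (TransHtpy.join S.pt (ins S.pt g.toFun (3 / 2) (1 / 4))
        (ins S.pt h.toFun (5 / 2) (1 / 4))) := by
    rw [TransMap.mul_toFun, TransMap.mul_toFun, ins_join, ins_ins _ _ _ _ _ one_ne_zero,
      ins_ins _ _ _ _ _ one_ne_zero]
    norm_num
  have s1 := movingIns_separated f g (c := -5 / 2) (c' := -2) (r := 1 / 4) (r' := 1)
    (d := -3 / 2) (d' := 3 / 2) (q := 1 / 4) (q' := 1 / 4) (by norm_num) (by norm_num)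
    (by norm_num) (by norm_num) (by norm_num [abs_div]) (by norm_num) (by norm_num) (by norm_num)
  have s2 := movingIns_separated f h (c := -5 / 2) (c' := -2) (r := 1 / 4) (r' := 1)
    (d := 2) (d' := 5 / 2) (q := 1) (q' := 1 / 4) (by norm_num) (by norm_num)
    (by norm_num) (by norm_num) (by norm_num [abs_div]) (by norm_num) (by norm_num) (by norm_num)
  have s3 := movingIns_separated g h (c := -3 / 2) (c' := 3 / 2) (r := 1 / 4) (r' := 1 / 4)
    (d := 2) (d' := 5 / 2) (q := 1) (q' := 1 / 4) (by norm_num) (by norm_num)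
    (by norm_num) (by norm_num) (by norm_num [abs_div]) (by norm_num [abs_div])
    (by norm_num) (by norm_num)
  have F1 := isFamily_movingIns f (c := -5 / 2) (c' := -2) (r := 1 / 4) (r' := 1)
    (by norm_num) (by norm_num) (by norm_num [abs_div]) (by norm_num)
  have F2 := isFamily_movingIns g (c := -3 / 2) (c' := 3 / 2) (r := 1 / 4) (r' := 1 / 4)
    (by norm_num) (by norm_num) (by norm_num [abs_div]) (by norm_num [abs_div])
  have F3 := isFamily_movingIns h (c := 2) (c' := 5 / 2) (r := 1) (r' := 1 / 4)
    (by norm_num) (by norm_num) (by norm_num) (by norm_num [abs_div])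
  refine (F1.join (F2.join F3 s3) fun z => ?_).homotopic (fun x t ht => ?_) (fun x t ht => ?_)
  -- The piece of `f` must be separated from the join of the other two: either it is constant
  -- nearby, or both of them are.
  · rcases s1 z with h1 | h1
    · exact Or.inl h1
    · rcases s2 z with h2 | h2
      · exact Or.inl h2
      · exact Or.inr ((h1.and h2).mono fun y hy => (join_of_left hy.1).trans hy.2)
  · rw [e1]
    exact join_congr (movingIns_of_lt _ _ _ _ _ ht _)
      (join_congr (movingIns_of_lt _ _ _ _ _ ht _) (movingIns_of_lt _ _ _ _ _ ht _))
  · rw [e2]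
    exact join_congr (movingIns_of_gt _ _ _ _ _ ht _)
      (join_congr (movingIns_of_gt _ _ _ _ _ ht _) (movingIns_of_gt _ _ _ _ _ ht _))

theorem TransMap.ext' {n : ℕ} {S : BasedStratification I X} {f g : TransMap n S}
    (h : f.toFun = g.toFun) : f = g := by
  cases f
  cases g
  cases h
  rfl

/-- The mirror contains the pole, so the reflection acts in the stereographic chart as a linear
reflection, which preserves the norm. -/
theorem ster_reflect_aux {n : ℕ} [NeZero n] (w : Equator n) :
    reflect (sterInv w) = sterInv (w - (2 * inner ℝ (side n) w) • side n) := by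
  have hs : ∀ v : Equator n, ((sterInv v : Sph n) : EuclideanSpace ℝ (Fin (n + 1)))
      = (‖v‖ ^ 2 + 4)⁻¹ • ((4 : ℝ) • (v : EuclideanSpace ℝ (Fin (n + 1)))
        + (‖v‖ ^ 2 - 4) • (pole n : EuclideanSpace ℝ (Fin (n + 1)))) :=
    fun v => stereoInvFun_apply (norm_pole n) v
  have hnorm : ‖w - (2 * inner ℝ (side n) w) • side n‖ ^ 2 = ‖w‖ ^ 2 := by
    rw [norm_sub_sq_real, norm_smul, norm_side, inner_smul_right, real_inner_comm,
      Real.norm_eq_abs, mul_one, sq_abs]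
    ring
  have h0 : inner ℝ (side n) w = w.1 0 := by
    simp [side, EuclideanSpace.inner_single_left]
  apply Subtype.ext
  rw [reflect_apply, hs, hs, hnorm, h0]
  have h1 : (pole n).1.ofLp 0 = 0 := pole_zero n
  simp only [PiLp.smul_apply, PiLp.add_apply, smul_eq_mul, h1, mul_zero, add_zero]
  have h2 : ((w - (2 * w.1 0) • side n : Equator n) : EuclideanSpace ℝ (Fin (n + 1)))
      = w.1 - (2 * w.1 0) • EuclideanSpace.single 0 1 := rfl
  rw [h2]
  module

theorem ster_reflect {n : ℕ} [NeZero n] {x : Sph n} (hx : x ≠ pole n) :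
    ster (reflect x) = ster x - (2 * inner ℝ (side n) (ster x)) • side n := by
  conv_lhs => rw [← sterInv_ster hx, ster_reflect_aux]
  exact ster_sterInv _

theorem reflect_pole (n : ℕ) [NeZero n] : reflect (pole n) = pole n := by
  apply Subtype.ext
  rw [reflect_apply, pole_zero]
  simp

theorem ins_comp_reflect {X : Type*} {n : ℕ} [NeZero n] (a : X) (f : Sph n → X) (c r : ℝ)
    (x : Sph n) : ins a f c r (reflect x) = ins a (f ∘ reflect) (-c) r x := by
  by_cases hx : x = pole n
  · rw [hx, reflect_pole, ins_pole, ins_pole]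
  · have hx' : reflect x ≠ pole n := fun h => hx (by rw [← reflect_reflect x, h, reflect_pole])
    rw [ins_of_ne _ _ _ _ hx, ins_of_ne _ _ _ _ hx', Function.comp, ster_reflect_aux,
      ster_reflect hx]
    congr 2
    rw [inner_smul_right, inner_sub_right, inner_smul_right, real_inner_self_eq_norm_sq, norm_side]
    module

/-- Reflection exchanges the balls around -2 and 2, so no homotopy is needed. Swapping the arguments
of `join` is harmless, because at each point one of the two pieces is at the basepoint. -/
theorem TransMap.dagger_mul {n : ℕ} [NeZero n] {S : BasedStratification I X}
    (f g : TransMap n S) : (f.mul g).dagger = g.dagger.mul f.dagger := by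
  apply TransMap.ext'
  funext x
  rw [mul_toFun]
  change (f.mul g).toFun (reflect x) = _
  rw [mul_toFun]
  have e1 := ins_comp_reflect S.pt f.toFun (-2) 1 x
  have e2 := ins_comp_reflect S.pt g.toFun 2 1 x
  rw [neg_neg] at e1
  rcases le_or_gt 0 (inner ℝ (side n) (ster x)) with h | h
  · rw [join_of_left (z := x) (ins_eq_of_side_le g.dagger.based one_pos (by linarith))]
    rw [join_of_right, e1]
    · rfl
    · rw [e2]
      exact ins_eq_of_side_le g.dagger.based one_pos (by linarith)
  · rw [join_of_right (z := x) (ins_eq_of_le_side f.dagger.based one_pos (by linarith))]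
    rw [join_of_left, e2]
    · rfl
    · rw [e1]
      exact ins_eq_of_le_side f.dagger.based one_pos (by linarith)

theorem isDaggerMonoid_psi {n : ℕ} [NeZero n] (S : BasedStratification I X) :
    IsDaggerMonoid (Psi n S) where
  mul_assoc := by
    rintro ⟨f⟩ ⟨g⟩ ⟨h⟩
    exact Quotient.sound (Homotopic.mul_assoc f g h)
  one_mul := by
    rintro ⟨f⟩
    exact Quotient.sound (Homotopic.one_mul f)
  mul_one := by
    rintro ⟨f⟩
    exact Quotient.sound (Homotopic.mul_one f)
  dagger_dagger := by
    rintro ⟨f⟩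
    exact congrArg (Quotient.mk (homotopySetoid n S))
      (TransMap.ext' (funext fun x => congrArg f.toFun (reflect_reflect x)))
  dagger_one := congrArg (Quotient.mk (homotopySetoid n S)) (TransMap.ext' rfl)
  dagger_mul := by
    rintro ⟨f⟩ ⟨g⟩
    exact congrArg (Quotient.mk (homotopySetoid n S)) (TransMap.dagger_mul f g)

end Families

/-! ### Persistence of transversal meetings with a stratum -/

section Persistence

variable {F G Y : Type*} [NormedAddCommGroup F] [NormedSpace ℝ F] [FiniteDimensional ℝ F]
  [TopologicalSpace G] {J : ModelWithCorners ℝ F G} [J.Boundaryless]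
  [TopologicalSpace Y] [ChartedSpace G Y]

omit [FiniteDimensional ℝ F] in
theorem mfderiv_extend_surjective {φ : OpenPartialHomeomorph Y G}
    (hφ : φ ∈ IsManifold.maximalAtlas J ∞ Y) {p : Y} (hp : p ∈ φ.source) :
    Function.Surjective (mfderiv J 𝓘(ℝ, F) (φ.extend J) p) := by
  have ht : (φ.extend J).target ∈ 𝓝 (φ.extend J p) := by
    have := φ.extend_target_mem_nhdsWithin (I := J) hp
    rwa [ModelWithCorners.range_eq_univ, nhdsWithin_univ] at this
  refine mfderiv_surjective_of_rightInverse (g := (φ.extend J).symm) (φ.extend_left_inv hp) ?_ ?_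
    ((φ.contMDiffAt_extend hφ hp).mdifferentiableAt (by simp))
  · filter_upwards [ht] with z hz
    exact (φ.extend J).right_inv hz
  · have h1 := contMDiffOn_extend_symm hφ
    rw [← φ.extend_target'] at h1
    exact (h1.contMDiffAt ht).mdifferentiableAt (by simp)

omit [J.Boundaryless] in
-- Otherwise a linear functional that vanishes on `V` but not on the image of `v`, pulled back by
-- the chart, would be a function germ vanishing on `S` whose differential does not kill `v`.
theorem mfderiv_extend_mem_of_mem_tangentOf {φ : OpenPartialHomeomorph Y G}
    (hφ : φ ∈ IsManifold.maximalAtlas J ∞ Y) {p : Y} (hp : p ∈ φ.source) {S : Set Y}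
    {V : Submodule ℝ F} (hV : ∀ x ∈ φ.source, x ∈ S ↔ φ.extend J x - φ.extend J p ∈ V)
    {v : TangentSpace J p} (hv : v ∈ tangentOf J S p) :
    (mfderiv J 𝓘(ℝ, F) (φ.extend J) p v : F) ∈ V := by
  by_contra hc
  obtain ⟨l, hl0, hl⟩ := V.exists_le_ker_of_notMem hc
  let L : F →L[ℝ] ℝ := LinearMap.toContinuousLinearMap l
  have hφs := φ.contMDiffAt_extend hφ hp
  have hL : ContDiff ℝ ∞ (fun y : F => L (y - φ.extend J p)) :=
    L.contDiff.comp (contDiff_id.sub contDiff_const)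
  refine hl0 ?_
  have h1 := hv (fun x => L (φ.extend J x - φ.extend J p))
    ((hL.contMDiff _).comp p hφs) ?_
  · have h2 : mfderiv J 𝓘(ℝ, ℝ) (fun x => L (φ.extend J x - φ.extend J p)) p
        = (mfderiv 𝓘(ℝ, F) 𝓘(ℝ, ℝ) (fun y : F => L (y - φ.extend J p)) (φ.extend J p)).comp
          (mfderiv J 𝓘(ℝ, F) (φ.extend J) p) :=
      mfderiv_comp p ((hL.contMDiff _).mdifferentiableAt (by simp))
        (hφs.mdifferentiableAt (by simp))
    have h3 : fderiv ℝ (fun y : F => L (y - φ.extend J p)) (φ.extend J p) = L :=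
      (L.hasFDerivAt.comp _ ((hasFDerivAt_id _).sub_const _)).fderiv
    rw [h2, mfderiv_eq_fderiv, h3] at h1
    exact h1
  · have h4 : φ.source ∈ 𝓝 p := φ.open_source.mem_nhds hp
    filter_upwards [mem_nhdsWithin_of_mem_nhds h4, self_mem_nhdsWithin] with x hx hxS
    exact hl ((hV x hx).1 hxS)

/-- This turns a slice chart into local equations for the stratum, with values in the normal space.
-/
theorem exists_continuousLinearMap_ker {F : Type*} [NormedAddCommGroup F] [NormedSpace ℝ F]
    [FiniteDimensional ℝ F] (V : Submodule ℝ F) : ∃ (k : ℕ) (Q : F →L[ℝ] (Fin k → ℝ)),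
      Function.Surjective Q ∧ ∀ v, Q v = 0 ↔ v ∈ V := by
  let b := Module.finBasis ℝ (F ⧸ V)
  refine ⟨_, LinearMap.toContinuousLinearMap (b.equivFun.toLinearMap ∘ₗ V.mkQ), ?_, ?_⟩
  · exact b.equivFun.surjective.comp V.mkQ_surjective
  · intro v
    simp

/-- A smooth family of maps that meets a stratum transversally at some point continues to
meet that stratum for nearby parameters. -/
theorem eventually_exists_mem_stratum {n : ℕ} {T : Stratification J Y} {h : Sph n × ℝ → Y}
    (hs : ContMDiff ((𝓡 n).prod 𝓘(ℝ, ℝ)) J ∞ h) {w₀ : Equator n} {t₀ : ℝ}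
    (ht : NormallySurjectiveAt (𝓡 n) T (fun x => h (x, t₀)) (sterInv w₀))
    {B : Set Y} (hB : B ∈ T.strata) (hp : h (sterInv w₀, t₀) ∈ B) :
    ∀ᶠ t in 𝓝 t₀, ∃ x, h (x, t) ∈ B := by
  obtain ⟨φ, hφ, hpφ, V, hV⟩ := T.isSubmanifold B hB _ hp
  obtain ⟨k, Q, hQs, hQ⟩ := exists_continuousLinearMap_ker V
  have hφs := φ.contMDiffAt_extend hφ hpφ
  set p := h (sterInv w₀, t₀) with hpdef
  let σ : Equator n × ℝ → Sph n × ℝ := fun z => (sterInv z.1, z.2)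
  have hσ : ContMDiff 𝓘(ℝ, Equator n × ℝ) ((𝓡 n).prod 𝓘(ℝ, ℝ)) ∞ σ :=
    (contMDiff_sterInv.comp contDiff_fst.contMDiff).prodMk contDiff_snd.contMDiff
  let K : Equator n × ℝ → F := fun z => φ.extend J (h (σ z))
  have hK : ContDiffAt ℝ ∞ K (w₀, t₀) := by
    rw [← contMDiffAt_iff_contDiffAt]
    exact ContMDiffAt.comp (w₀, t₀) (g := φ.extend J) (f := fun z => h (σ z)) hφs
      ((hs _).comp _ (hσ _))
  have hKd : HasStrictFDerivAt K (fderiv ℝ K (w₀, t₀)) (w₀, t₀) :=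
    hK.hasStrictFDerivAt (by simp)
  have hx : MDifferentiableAt (𝓡 n) J (fun x => h (x, t₀)) (sterInv w₀) :=
    ((hs _).comp (sterInv w₀)
      (contMDiff_id.prodMk contMDiff_const).contMDiffAt).mdifferentiableAt (by simp)
  have hpart : ∀ a : Equator n, fderiv ℝ K (w₀, t₀) (a, 0) =
      mfderiv J 𝓘(ℝ, F) (φ.extend J) p (mfderiv (𝓡 n) J (fun x => h (x, t₀)) (sterInv w₀)
        (mfderiv 𝓘(ℝ, Equator n) (𝓡 n) (sterInv : Equator n → Sph n) w₀ a)) := by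
    intro a
    have h1 : HasFDerivAt (fun w : Equator n => K (w, t₀))
        ((fderiv ℝ K (w₀, t₀)).comp (ContinuousLinearMap.inl ℝ (Equator n) ℝ)) w₀ := by
      have hi : HasFDerivAt (fun w : Equator n => (w, t₀))
        (ContinuousLinearMap.inl ℝ (Equator n) ℝ) w₀ := hasFDerivAt_prodMk_left w₀ t₀
      exact HasFDerivAt.comp (g := K) w₀ hKd.hasFDerivAt hi
    have h2 : mfderiv 𝓘(ℝ, Equator n) 𝓘(ℝ, F) (fun w : Equator n => K (w, t₀)) w₀ =
        (mfderiv J 𝓘(ℝ, F) (φ.extend J) p).comp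
          ((mfderiv (𝓡 n) J (fun x => h (x, t₀)) (sterInv w₀)).comp
            (mfderiv 𝓘(ℝ, Equator n) (𝓡 n) (sterInv : Equator n → Sph n) w₀)) := by
      have hy : MDifferentiableAt 𝓘(ℝ, Equator n) (𝓡 n) (sterInv : Equator n → Sph n) w₀ :=
        (contMDiff_sterInv w₀).mdifferentiableAt (by simp)
      rw [← mfderiv_comp w₀ hx hy]
      exact mfderiv_comp w₀ (g := φ.extend J)
        (f := (fun x => h (x, t₀)) ∘ (sterInv : Equator n → Sph n))
        (hφs.mdifferentiableAt (by simp)) (hx.comp w₀ hy)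
    rw [mfderiv_eq_fderiv, h1.fderiv] at h2
    exact DFunLike.congr_fun h2 a
  -- Transversality at the fixed time `t₀`: the sphere directions alone already cover the normal
  -- space.
  have hsurj : ∀ u, ∃ a : Equator n, Q (fderiv ℝ K (w₀, t₀) (a, 0)) = u := by
    intro u
    obtain ⟨y, rfl⟩ := hQs u
    obtain ⟨w, hw⟩ := mfderiv_extend_surjective hφ hpφ y
    obtain ⟨v, hv⟩ := normallySurjectiveAt_iff.1 ht B hB hp w
    obtain ⟨a, ha⟩ := mfderiv_sterInv_surjective w₀ v
    refine ⟨a, ?_⟩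
    have h1 := mfderiv_extend_mem_of_mem_tangentOf hφ hpφ hV hv
    rw [map_sub] at h1
    have hQsub : ∀ b c : F, b - c ∈ V → Q b = Q c := fun b c hbc =>
      sub_eq_zero.1 ((map_sub Q b c).symm.trans ((hQ _).2 hbc))
    have h3 := hQsub (mfderiv J 𝓘(ℝ, F) (φ.extend J) p w)
      (mfderiv J 𝓘(ℝ, F) (φ.extend J) p (mfderiv (𝓡 n) J (fun x => h (x, t₀)) (sterInv w₀) v)) h1
    refine (congrArg Q (hpart a)).trans ?_
    have h4 := congrArg (fun v => Q (mfderiv J 𝓘(ℝ, F) (φ.extend J) p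
      (mfderiv (𝓡 n) J (fun x => h (x, t₀)) (sterInv w₀) v) : F)) ha
    exact h4.trans (h3.symm.trans (congrArg Q hw))
  -- Retaining `t` as a second component makes this map a submersion onto normal space times time.
  -- It is then open at `(w₀, t₀)`, and hits `(0, t)` for every `t` near `t₀`.
  have hG : HasStrictFDerivAt (fun z => (Q (K z - φ.extend J p), z.2))
      ((Q.comp (fderiv ℝ K (w₀, t₀))).prod (ContinuousLinearMap.snd ℝ (Equator n) ℝ)) (w₀, t₀) :=
    (Q.hasStrictFDerivAt.comp _ (hKd.sub_const _)).prodMk hasStrictFDerivAt_snd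
  have hGs : ((Q.comp (fderiv ℝ K (w₀, t₀))).prod
      (ContinuousLinearMap.snd ℝ (Equator n) ℝ)).range = ⊤ := by
    rw [LinearMap.range_eq_top]
    rintro ⟨u, τ⟩
    obtain ⟨a, ha⟩ := hsurj (u - Q (fderiv ℝ K (w₀, t₀) (0, τ)))
    refine ⟨(a, τ), Prod.ext ?_ rfl⟩
    have h1 : ((a, τ) : Equator n × ℝ) = (a, 0) + (0, τ) := by simp
    change Q (fderiv ℝ K (w₀, t₀) (a, τ)) = u
    rw [h1, map_add, map_add, ha, sub_add_cancel]
  -- The local equation decides membership in `B` only inside the domain of the chart.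
  have hnear : ∀ᶠ z in 𝓝 (w₀, t₀), h (σ z) ∈ φ.source :=
    (hs.continuous.comp hσ.continuous).continuousAt.eventually (φ.open_source.mem_nhds hpφ)
  have hmap := hG.map_nhds_eq_of_surj hGs
  have himg := image_mem_map (m := fun z => (Q (K z - φ.extend J p), z.2)) hnear
  rw [hmap] at himg
  have hz : (Q (K (w₀, t₀) - φ.extend J p), t₀) = ((0 : Fin k → ℝ), t₀) := by
    have : K (w₀, t₀) = φ.extend J p := rfl
    rw [this, sub_self, map_zero]
  change _ ∈ 𝓝 (Q (K (w₀, t₀) - φ.extend J p), t₀) at himg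
  rw [hz] at himg
  have hcont : Tendsto (fun t : ℝ => ((0 : Fin k → ℝ), t)) (𝓝 t₀) (𝓝 (0, t₀)) :=
    (Continuous.prodMk_right (0 : Fin k → ℝ)).continuousAt
  filter_upwards [hcont himg] with t hmem
  obtain ⟨⟨w, t'⟩, hw, he⟩ := hmem
  obtain ⟨h1, rfl⟩ : Q (K (w, t') - φ.extend J p) = 0 ∧ t' = t := Prod.mk.inj he
  exact ⟨sterInv w, (hV _ hw).2 ((hQ _).1 h1)⟩

/-- A homotopy through transversal maps that ends at the constant map stays in the stratum of the
basepoint. -/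
theorem mem_of_isFamily {n : ℕ} {T : BasedStratification J Y} {h : Sph n × ℝ → Y}
    (hh : IsFamily T h) {U : Set Y} (hU : U ∈ T.strata) (hUo : IsOpen U) (hpt : T.pt ∈ U)
    {t₁ : ℝ} (h1 : ∀ x, h (x, t₁) ∈ U) (x : Sph n) (t : ℝ) : h (x, t) ∈ U := by
  have hcl : IsClopen {t | ∀ x, h (x, t) ∈ U} := by
    constructor
    -- Closedness: a point outside `U` lies in another stratum, which the family continues to meet
    -- at nearby times. It is not the pole, which goes to the basepoint, so stereographic
    -- coordinates are available.
    · rw [← isOpen_compl_iff, isOpen_iff_mem_nhds]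
      intro t₀ ht₀
      simp only [mem_compl_iff, mem_ofPred_eq, not_forall] at ht₀
      obtain ⟨x, hx⟩ := ht₀
      have hp : x ≠ pole n := by
        rintro rfl
        exact hx (by rwa [hh.based t₀ _ (pole_mem_cap n)])
      obtain ⟨B, ⟨hB, hxB⟩, -⟩ := T.isPartition.2 (h (x, t₀))
      have := hh.transversal t₀ x
      rw [← sterInv_ster hp] at this hxB
      filter_upwards [eventually_exists_mem_stratum hh.smooth this hB hxB] with t ht
      obtain ⟨y, hy⟩ := ht
      intro hc
      obtain rfl : B = U := (T.isPartition.2 _).unique ⟨hB, hy⟩ ⟨hU, hc y⟩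
      rw [sterInv_ster hp] at hxB
      exact hx hxB
    -- Openness: `U` is open and the sphere is compact.
    · rw [isOpen_iff_mem_nhds]
      intro t₀ ht₀
      have h2 : ∀ x ∈ (univ : Set (Sph n)), ∀ᶠ z : ℝ × Sph n in 𝓝 (t₀, x), h (z.2, z.1) ∈ U := by
        intro x _
        have hc : Continuous fun z : ℝ × Sph n => h (z.2, z.1) :=
          hh.smooth.continuous.comp continuous_swap
        exact hc.continuousAt.eventually (hUo.mem_nhds (ht₀ x))
      have h3 := isCompact_univ.eventually_forall_of_forall_eventually
        (P := fun t x => h (x, t) ∈ U) h2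
      filter_upwards [h3] with t ht x
      exact ht x (mem_univ x)
  have h2 : {t | ∀ x, h (x, t) ∈ U} = univ := hcl.eq_univ ⟨t₁, h1⟩
  have h3 : t ∈ {t | ∀ x, h (x, t) ∈ U} := h2 ▸ mem_univ t
  exact h3 x

end Persistence

/-! ### Induced maps are maps of dagger monoids -/

section Functoriality

variable {E H X : Type*} [NormedAddCommGroup E] [NormedSpace ℝ E] [TopologicalSpace H]
  {I : ModelWithCorners ℝ E H} [TopologicalSpace X] [ChartedSpace H X]
variable {F G Y : Type*} [NormedAddCommGroup F] [NormedSpace ℝ F]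
  [TopologicalSpace G] {J : ModelWithCorners ℝ F G} [TopologicalSpace Y] [ChartedSpace G Y]

theorem Psi.map_const {n : ℕ} {S : BasedStratification I X} {T : BasedStratification J Y}
    {s : X → Y} (hs : IsNormalSubmersion S T s) : Psi.map n hs 1 = 1 :=
  congrArg (Quotient.mk (homotopySetoid n T)) (TransMap.ext' (funext fun _ => hs.based))

theorem isDaggerHom_map {n : ℕ} [NeZero n] {S : BasedStratification I X}
    {T : BasedStratification J Y} {s : X → Y} (hs : IsNormalSubmersion S T s) :
    IsDaggerHom (Psi.map n hs) where
  map_one := Psi.map_const hs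
  map_mul := by
    rintro ⟨f⟩ ⟨g⟩
    refine congrArg (Quotient.mk (homotopySetoid n T)) (TransMap.ext' (funext fun x => ?_))
    change s (Sum.elim f.toFun g.toFun (pinch x)) = Sum.elim (s ∘ f.toFun) (s ∘ g.toFun) (pinch x)
    rcases pinch x with y | y <;> rfl
  map_dagger := by
    rintro ⟨f⟩
    rfl

end Functoriality

/-! ### The split short exact sequence -/

section Exactness

variable {E H X : Type*} [NormedAddCommGroup E] [NormedSpace ℝ E] [TopologicalSpace H]
  {I : ModelWithCorners ℝ E H} [TopologicalSpace X] [ChartedSpace H X] [IsManifold I ∞ X]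
variable {F G Y : Type*} [NormedAddCommGroup F] [NormedSpace ℝ F]
  [TopologicalSpace G] {J : ModelWithCorners ℝ F G}
  [TopologicalSpace Y] [ChartedSpace G Y] [IsManifold J ∞ Y]

/-- The tangent space of `A ×ˢ U` contains all vectors along `Y`, so only the component along `X`
must be hit modulo the tangent space of `A`. -/
theorem NormallySurjectiveAt.prodMk_of_isOpen {E' H' M : Type*} [NormedAddCommGroup E']
    [NormedSpace ℝ E'] [TopologicalSpace H'] [TopologicalSpace M] [ChartedSpace H' M]
    {K : ModelWithCorners ℝ E' H'} {S : BasedStratification I X} {T : BasedStratification J Y}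
    {f : M → X} {g : M → Y} {p : M} (hf : MDifferentiableAt K I f p)
    (hg : MDifferentiableAt K J g p) (hft : NormallySurjectiveAt K S.toStratification f p)
    {U : Set Y} (hU : U ∈ T.strata) (hUo : IsOpen U) (hgU : g p ∈ U) :
    NormallySurjectiveAt K (S.prod T).toStratification (fun x => (f x, g x)) p := by
  rw [normallySurjectiveAt_iff]
  rintro _ ⟨A, hA, B, hB, rfl⟩ ⟨hx, hp⟩ w
  obtain rfl : B = U := (T.isPartition.2 (g p)).unique ⟨hB, hp⟩ ⟨hU, hgU⟩
  let w₁ : TangentSpace I (f p) := w.1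
  let w₂ : TangentSpace J (g p) := w.2
  obtain ⟨v, hv⟩ := normallySurjectiveAt_iff.1 hft A hA hx w₁
  refine ⟨v, ?_⟩
  have h1 : mfderiv K (I.prod J) (fun x => (f x, g x)) p v
      = (mfderiv K I f p v, mfderiv K J g p v) := by
    rw [mfderiv_prodMk hf hg]
    rfl
  have h2 : w - mfderiv K (I.prod J) (fun x => (f x, g x)) p v
      = mfderiv I (I.prod J) (fun x : X => (x, g p)) (f p) (w₁ - mfderiv K I f p v) +
        mfderiv J (I.prod J) (fun y : Y => (f p, y)) (g p) (w₂ - mfderiv K J g p v) := by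
    rw [h1, mfderiv_prod_left, mfderiv_prod_right]
    exact Prod.ext (add_zero _).symm (zero_add _).symm
  rw [h2]
  refine add_mem ?_ ?_
  · have hsub : A ⊆ (fun x : X => (x, g p)) ⁻¹' (A ×ˢ B) := fun x hx => ⟨hx, hp⟩
    exact mfderiv_mem_tangentOf (contMDiff_id.prodMk contMDiff_const) hsub hv
  · have hsub : B ⊆ (fun y : Y => (f p, y)) ⁻¹' (A ×ˢ B) := fun y hy => ⟨hx, hy⟩
    refine mfderiv_mem_tangentOf (contMDiff_const.prodMk contMDiff_id) hsub ?_
    rw [tangentOf_eq_top_of_isOpen hUo hgU]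
    trivial

theorem leftInverse_fst_inl (n : ℕ) (S : BasedStratification I X) (T : BasedStratification J Y) :
    Function.LeftInverse (Psi.map n (isNormalSubmersion_fst S T))
      (Psi.map n (isNormalSubmersion_inl S T)) := by
  rintro ⟨f⟩
  rfl

theorem leftInverse_snd_inr (n : ℕ) (S : BasedStratification I X) (T : BasedStratification J Y) :
    Function.LeftInverse (Psi.map n (isNormalSubmersion_snd S T))
      (Psi.map n (isNormalSubmersion_inr S T)) := by
  rintro ⟨f⟩
  rfl

theorem map_snd_map_inl (n : ℕ) (S : BasedStratification I X) (T : BasedStratification J Y)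
    (a : Psi n S) : Psi.map n (isNormalSubmersion_snd S T)
      (Psi.map n (isNormalSubmersion_inl S T) a) = 1 := by
  obtain ⟨f⟩ := a
  rfl

theorem exists_map_inl_eq [FiniteDimensional ℝ F] [J.Boundaryless] {n : ℕ}
    {S : BasedStratification I X} {T : BasedStratification J Y} {m : Psi n (S.prod T)}
    (hm : Psi.map n (isNormalSubmersion_snd S T) m = 1) :
    ∃ l, Psi.map n (isNormalSubmersion_inl S T) l = m := by
  obtain ⟨f⟩ := m
  have hm' : Homotopic (f.map (isNormalSubmersion_snd S T)) (TransMap.const n T) :=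
    Quotient.exact hm
  -- The preimage is the class of the first component `f₁`; the homotopy from `f` to `(f₁, ⋆)` keeps
  -- `f₁` fixed and contracts the second component.
  refine ⟨Psi.mk (f.map (isNormalSubmersion_fst S T)), Quotient.sound (Homotopic.symm ?_)⟩
  obtain ⟨h, hs, ht, hb, ε, hε, he⟩ := hm'
  obtain ⟨U, hU, hUo, hpt⟩ := T.generic
  have hmem : ∀ x t, h (x, t) ∈ U := by
    refine mem_of_isFamily (T := T) ⟨hs, ht, hb⟩ hU hUo hpt (t₁ := 1) fun x => ?_
    rw [(he x 1).2 (by linarith)]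
    exact hpt
  have hfst : ContMDiff (𝓡 n) I ∞ fun x => (f.toFun x).1 := contMDiff_fst.comp f.smooth
  refine ⟨fun z => ((f.toFun z.1).1, h z), (hfst.comp contMDiff_fst).prodMk hs, ?_, ?_,
    ε, hε, ?_⟩
  · intro t p
    refine NormallySurjectiveAt.prodMk_of_isOpen (f := fun x => (f.toFun x).1)
      (g := fun x => h (x, t)) ((hfst _).mdifferentiableAt (by simp))
      (((hs _).comp p (contMDiff_id.prodMk contMDiff_const).contMDiffAt).mdifferentiableAt
        (by simp)) ((f.map (isNormalSubmersion_fst S T)).transversal p) hU hUo (hmem p t)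
  · intro t x hx
    have h1 : (f.toFun x).1 = S.pt := congrArg Prod.fst (f.based x hx)
    exact Prod.ext h1 (hb t x hx)
  · intro x t
    exact ⟨fun h1 => Prod.ext rfl ((he x t).1 h1), fun h1 => Prod.ext rfl ((he x t).2 h1)⟩

theorem isShortExact_psi [FiniteDimensional ℝ F] [J.Boundaryless] (n : ℕ) [NeZero n]
    (S : BasedStratification I X) (T : BasedStratification J Y) :
    IsShortExact (Psi.map n (isNormalSubmersion_inl S T))
      (Psi.map n (isNormalSubmersion_snd S T)) where
  left_monoid := isDaggerMonoid_psi S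
  mid_monoid := isDaggerMonoid_psi (S.prod T)
  right_monoid := isDaggerMonoid_psi T
  left_hom := isDaggerHom_map _
  right_hom := isDaggerHom_map _
  injective := (leftInverse_fst_inl n S T).injective
  surjective := (leftInverse_snd_inr n S T).surjective
  exact _ := ⟨fun ⟨l, hl⟩ => hl ▸ map_snd_map_inl n S T l, exists_map_inl_eq⟩

end Exactness

/-! ### Words of wall crossings -/

section Patterns

/-- The walls in the list `l` are crossed, one after the other, at parameters greater than `a`, where
the wall `i` is crossed at the zeros of `κ i`. -/
def Chain (κ : Bool → ℝ → ℝ) : List Bool → ℝ → Prop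
  | [], _ => True
  | i :: l, a => ∃ s, a < s ∧ κ i s = 0 ∧ Chain κ l s

/-- The subwords of the word of crossings. -/
def pattern (κ : Bool → ℝ → ℝ) : Set (List Bool) := {l | ∃ a, Chain κ l a}

theorem Chain.mono {κ : Bool → ℝ → ℝ} {l : List Bool} {a b : ℝ} (h : Chain κ l a) (hb : b ≤ a) :
    Chain κ l b := by
  cases l with
  | nil => trivial
  | cons i l =>
    obtain ⟨s, hs, h0, h1⟩ := h
    exact ⟨s, hb.trans_lt hs, h0, h1⟩

theorem nil_mem_pattern (κ : Bool → ℝ → ℝ) : [] ∈ pattern κ := ⟨0, trivial⟩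

theorem cons_mem_pattern_iff {κ : Bool → ℝ → ℝ} {i : Bool} {l : List Bool} :
    i :: l ∈ pattern κ ↔ ∃ s, κ i s = 0 ∧ Chain κ l s := by
  constructor
  · rintro ⟨a, s, -, h⟩
    exact ⟨s, h⟩
  · rintro ⟨s, h⟩
    exact ⟨s - 1, s, by linarith, h⟩

theorem singleton_mem_pattern_iff {κ : Bool → ℝ → ℝ} {i : Bool} :
    [i] ∈ pattern κ ↔ ∃ s, κ i s = 0 := by
  simp [cons_mem_pattern_iff, Chain]

theorem exists_zero_of_mem_pattern {κ : Bool → ℝ → ℝ} {l : List Bool} (hl : l ∈ pattern κ)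
    {i : Bool} (hi : i ∈ l) : ∃ s, κ i s = 0 := by
  obtain ⟨a, h⟩ := hl
  induction l generalizing a with
  | nil => simp at hi
  | cons j l ih =>
    obtain ⟨s, -, h0, h1⟩ := h
    rcases List.mem_cons.1 hi with rfl | hi
    · exact ⟨s, h0⟩
    · exact ih hi s h1

/-- The crossings of a chain occur at strictly increasing elements of `Z`, so each one uses up a new
element. -/
theorem chain_length_le {κ : Bool → ℝ → ℝ} {Z : Set ℝ} (hZ : Z.Finite)
    (hκ : ∀ i s, κ i s = 0 → s ∈ Z) {l : List Bool} {a : ℝ} (h : Chain κ l a) :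
    l.length ≤ (Z ∩ Ioi a).ncard := by
  induction l generalizing a with
  | nil => simp
  | cons i l ih =>
    obtain ⟨s, hs, h0, h1⟩ := h
    have hss : Z ∩ Ioi s ⊂ Z ∩ Ioi a := by
      refine ⟨fun z hz => ⟨hz.1, hs.trans hz.2⟩, fun hsub => ?_⟩
      exact lt_irrefl s (hsub ⟨hκ i s h0, hs⟩).2
    have := Set.ncard_lt_ncard hss (hZ.subset inter_subset_left)
    exact (Nat.succ_le_succ (ih h1)).trans this

theorem length_le_of_mem_pattern {κ : Bool → ℝ → ℝ} {Z : Set ℝ} (hZ : Z.Finite)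
    (hκ : ∀ i s, κ i s = 0 → s ∈ Z) {l : List Bool} (h : l ∈ pattern κ) :
    l.length ≤ Z.ncard := by
  obtain ⟨a, h⟩ := h
  exact (chain_length_le hZ hκ h).trans (Set.ncard_le_ncard inter_subset_left hZ)

/-- The crossings of two loops, traversed one after the other. -/
def concat (κ κ' : Bool → ℝ → ℝ) (i : Bool) (s : ℝ) : ℝ :=
  if s < 0 then κ i (4 * s + 8) else κ' i (4 * s - 8)

variable {κ κ' : Bool → ℝ → ℝ}

theorem abs_lt_four (hκ : ∀ i s, 4 ≤ |s| → κ i s ≠ 0) {i : Bool} {s : ℝ} (h : κ i s = 0) :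
    -4 < s ∧ s < 4 := by
  rw [← abs_lt]
  by_contra! hc
  exact hκ i s hc h

theorem chain_concat_right (hκ' : ∀ i s, 4 ≤ |s| → κ' i s ≠ 0) {l : List Bool} {b : ℝ}
    (h : Chain κ' l b) : Chain (concat κ κ') l ((b + 8) / 4) := by
  induction l generalizing b with
  | nil => trivial
  | cons i l ih =>
    obtain ⟨s, hs, h0, h1⟩ := h
    have := abs_lt_four hκ' h0
    refine ⟨(s + 8) / 4, by linarith, ?_, ih h1⟩
    have h2 : ¬ (s + 8) / 4 < 0 := by linarith
    rw [concat, if_neg h2, ← h0]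
    congr 1
    ring

theorem chain_of_chain_concat {l : List Bool} {a : ℝ} (ha : 0 ≤ a)
    (h : Chain (concat κ κ') l a) : Chain κ' l (4 * a - 8) := by
  induction l generalizing a with
  | nil => trivial
  | cons i l ih =>
    obtain ⟨s, hs, h0, h1⟩ := h
    rw [concat, if_neg (by linarith)] at h0
    exact ⟨4 * s - 8, by linarith, h0, ih (by linarith) h1⟩

theorem chain_concat_append (hκ : ∀ i s, 4 ≤ |s| → κ i s ≠ 0)
    (hκ' : ∀ i s, 4 ≤ |s| → κ' i s ≠ 0) {u v : List Bool} {a : ℝ} (ha : a ≤ 1)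
    (hu : Chain κ u (4 * a + 8)) (hv : v ∈ pattern κ') : Chain (concat κ κ') (u ++ v) a := by
  induction u generalizing a with
  | nil =>
    cases v with
    | nil => trivial
    | cons i l =>
      rw [cons_mem_pattern_iff] at hv
      obtain ⟨s, h0, h1⟩ := hv
      have h2 := abs_lt_four hκ' h0
      -- Crossings of the second loop occur after -4, hence after 1 once rescaled. This is where `a
      -- ≤ 1` is used.
      exact Chain.mono (a := (-4 + 8) / 4)
        (chain_concat_right hκ' (⟨s, h2.1, h0, h1⟩ : Chain κ' (i :: l) (-4))) (by linarith)
  | cons i u ih =>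
    obtain ⟨s, hs, h0, h1⟩ := hu
    have h2 := abs_lt_four hκ h0
    refine ⟨(s - 8) / 4, by linarith, ?_, ih (by linarith) (h1.mono (by linarith))⟩
    rw [concat, if_pos (by linarith), ← h0]
    congr 1
    ring

/-- The word is cut at its first crossing with nonnegative parameter. -/
theorem exists_append_of_chain_concat {l : List Bool} {a : ℝ} (h : Chain (concat κ κ') l a) :
    ∃ u v, l = u ++ v ∧ Chain κ u (4 * a + 8) ∧ v ∈ pattern κ' := by
  induction l generalizing a with
  | nil => exact ⟨[], [], rfl, trivial, nil_mem_pattern κ'⟩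
  | cons i l ih =>
    obtain ⟨s, hs, h0, h1⟩ := h
    rcases lt_or_ge s 0 with h2 | h2
    · obtain ⟨u, v, rfl, hu, hv⟩ := ih h1
      rw [concat, if_pos h2] at h0
      exact ⟨i :: u, v, rfl, ⟨4 * s + 8, by linarith, h0, hu⟩, hv⟩
    · refine ⟨[], i :: l, rfl, trivial, cons_mem_pattern_iff.2 ⟨4 * s - 8, ?_, ?_⟩⟩
      · rwa [concat, if_neg h2.not_gt] at h0
      · exact chain_of_chain_concat h2 h1

theorem mem_pattern_concat (hκ : ∀ i s, 4 ≤ |s| → κ i s ≠ 0)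
    (hκ' : ∀ i s, 4 ≤ |s| → κ' i s ≠ 0) {l : List Bool} :
    l ∈ pattern (concat κ κ') ↔ ∃ u ∈ pattern κ, ∃ v ∈ pattern κ', l = u ++ v := by
  constructor
  · rintro ⟨a, h⟩
    obtain ⟨u, v, hl, hu, hv⟩ := exists_append_of_chain_concat h
    exact ⟨u, ⟨_, hu⟩, v, hv, hl⟩
  · rintro ⟨u, ⟨a, hu⟩, v, hv, rfl⟩
    -- The starting parameter must precede the rescaled `a` and be at most 1.
    exact ⟨min ((a - 8) / 4) 0, chain_concat_append hκ hκ' (by linarith [min_le_right ((a - 8) / 4) 0])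
      (hu.mono (by linarith [min_le_left ((a - 8) / 4) 0])) hv⟩

/-- At a nondegenerate zero the slopes on both sides have the sign of `d`, so `f` changes sign.
Unlike the zero itself, a sign change visibly survives small perturbations. -/
theorem exists_mul_neg_of_hasDerivAt {f : ℝ → ℝ} {d s : ℝ} (hf : HasDerivAt f d s) (h0 : f s = 0)
    (hd : d ≠ 0) {δ : ℝ} (hδ : 0 < δ) : ∃ η, 0 < η ∧ η < δ ∧ f (s - η) * f (s + η) < 0 := by
  have h1 := hasDerivAt_iff_tendsto_slope.1 hf
  have h2 : ∀ᶠ y in 𝓝[≠] s, 0 < slope f s y * d := by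
    refine (h1.mul_const d).eventually (isOpen_Ioi.mem_nhds ?_)
    exact mul_self_pos.2 hd
  rw [eventually_nhdsWithin_iff, Metric.eventually_nhds_iff] at h2
  obtain ⟨ε, hε, h3⟩ := h2
  have hη : 0 < min δ ε / 2 := by positivity
  refine ⟨min δ ε / 2, hη, by linarith [min_le_left δ ε], ?_⟩
  set η := min δ ε / 2
  have hηε : η < ε := by
    have := min_le_right δ ε
    simp only [η]
    linarith
  have h4 := h3 (y := s + η) (by simp [abs_of_pos hη, hηε]) (by simp [hη.ne'])
  have h5 := h3 (y := s - η) (by simp [abs_of_pos hη, hηε]) (by simp [hη.ne'])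
  simp only [slope_def_field, h0, sub_zero, add_sub_cancel_left] at h4 h5
  have e5 : s - η - s = -η := by ring
  rw [e5, div_neg] at h5
  have h6 : 0 < f (s + η) * d := by
    have := mul_pos h4 hη
    field_simp at this
    linarith
  have h7 : f (s - η) * d < 0 := by
    have := mul_pos h5 hη
    field_simp at this
    linarith
  have h8 := mul_neg_of_neg_of_pos h7 h6
  have h9 : 0 < d ^ 2 := by positivity
  by_contra! h
  nlinarith [mul_nonneg h h9.le]

theorem exists_zero_of_mul_neg {f : ℝ → ℝ} (hf : Continuous f) {a b : ℝ} (hab : a ≤ b)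
    (h : f a * f b < 0) : ∃ s ∈ Icc a b, f s = 0 := by
  have h0 : (0 : ℝ) ∈ uIcc (f a) (f b) := by
    rw [mem_uIcc]
    rcases mul_neg_iff.1 h with h | h
    · exact Or.inr ⟨h.2.le, h.1.le⟩
    · exact Or.inl ⟨h.1.le, h.2.le⟩
  obtain ⟨s, hs, hs0⟩ := intermediate_value_uIcc hf.continuousOn h0
  rw [uIcc_of_le hab] at hs
  exact ⟨s, hs, hs0⟩

/-- A loop which crosses a wall crosses it twice. -/
theorem pair_mem_pattern {d : ℝ → ℝ} {i : Bool} (hc : Continuous (κ i))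
    (hd : ∀ s, HasDerivAt (κ i) (d s) s) (hd0 : ∀ s, κ i s = 0 → d s ≠ 0)
    (hκ : ∀ s, 4 ≤ |s| → 0 < κ i s) (h : [i] ∈ pattern κ) : [i, i] ∈ pattern κ := by
  obtain ⟨s, hs⟩ := singleton_mem_pattern_iff.1 h
  obtain ⟨η, hη, -, h1⟩ := exists_mul_neg_of_hasDerivAt (hd s) hs (hd0 s hs) one_pos
  -- The sign change provides a negative value; `κ i` is positive at ±4, so there is a zero on each
  -- side of `r`.
  obtain ⟨r, hr⟩ : ∃ r, κ i r < 0 := by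
    rcases mul_neg_iff.1 h1 with h | h
    · exact ⟨_, h.2⟩
    · exact ⟨_, h.1⟩
  have hr4 : |r| < 4 := by
    by_contra! hc
    exact (hκ r hc).not_gt hr
  rw [abs_lt] at hr4
  obtain ⟨s₁, hs₁, z₁⟩ := exists_zero_of_mul_neg hc hr4.1.le
    (mul_neg_of_pos_of_neg (hκ (-4) (by norm_num)) hr)
  obtain ⟨s₂, hs₂, z₂⟩ := exists_zero_of_mul_neg hc hr4.2.le
    (mul_neg_of_neg_of_pos hr (hκ 4 (by norm_num)))
  refine cons_mem_pattern_iff.2 ⟨s₁, z₁, s₂, lt_of_le_of_ne (hs₁.2.trans hs₂.1) ?_, z₂, trivial⟩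
  rintro rfl
  have : s₁ = r := le_antisymm hs₁.2 hs₂.1
  rw [← this, z₁] at hr
  exact lt_irrefl _ hr

/-- Infinitely many zeros in `[-4, 4]` would accumulate at a zero, but nondegenerate zeros are
isolated. -/
theorem finite_zeros {f d : ℝ → ℝ} (hd : ∀ s, HasDerivAt f (d s) s)
    (hd0 : ∀ s, f s = 0 → d s ≠ 0) (hf : ∀ s, 4 ≤ |s| → f s ≠ 0) : {s | f s = 0}.Finite := by
  by_contra hinf
  have hc : Continuous f := continuous_iff_continuousAt.2 fun s => (hd s).continuousAt
  have hsub : {s | f s = 0} ⊆ Icc (-4) 4 := by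
    intro s hs
    have : |s| ≤ 4 := by
      by_contra! h
      exact hf s h.le hs
    exact abs_le.1 this
  obtain ⟨x, -, hx⟩ := Set.Infinite.exists_accPt_of_subset_isCompact hinf isCompact_Icc hsub
  have hx0 : f x = 0 := by
    have hcl : IsClosed {s | f s = 0} := isClosed_eq hc continuous_const
    exact hcl.closure_subset (mem_closure_iff_clusterPt.2 hx.clusterPt)
  rw [accPt_iff_frequently_nhdsNE] at hx
  exact hx ((hd x).eventually_ne (hd0 x hx0))

theorem exists_length_le {d : Bool → ℝ → ℝ} (hd : ∀ i s, HasDerivAt (κ i) (d i s) s)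
    (hd0 : ∀ i s, κ i s = 0 → d i s ≠ 0) (hκ : ∀ i s, 4 ≤ |s| → κ i s ≠ 0) :
    ∃ N, ∀ l ∈ pattern κ, l.length ≤ N := by
  have h : (⋃ i, {s | κ i s = 0}).Finite :=
    Set.finite_iUnion fun i => finite_zeros (hd i) (hd0 i) (hκ i)
  exact ⟨_, fun l hl => length_le_of_mem_pattern h (fun i s hs => mem_iUnion.2 ⟨i, hs⟩) hl⟩

/-! ### Invariance of the crossing words under deformation -/

/-- A family of pairs of functions with nondegenerate zeros and without common zeros. -/
structure GenericFamily (K D : Bool → ℝ × ℝ → ℝ) : Prop where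
  continuous : ∀ i, Continuous (K i)
  continuous_deriv : ∀ i, Continuous (D i)
  hasDerivAt : ∀ i s t, HasDerivAt (fun s => K i (s, t)) (D i (s, t)) s
  deriv_ne : ∀ i z, K i z = 0 → D i z ≠ 0
  ne_of_ne : ∀ i j z, i ≠ j → K i z = 0 → K j z ≠ 0
  ne_zero : ∀ i s t, 4 ≤ |s| → K i (s, t) ≠ 0

namespace GenericFamily

variable {K D : Bool → ℝ × ℝ → ℝ}

theorem eventually_exists_zero (h : GenericFamily K D) {i : Bool} {s t : ℝ} (h0 : K i (s, t) = 0)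
    {O : Set (ℝ × ℝ)} (hO : O ∈ 𝓝 (s, t)) : ∀ᶠ t' in 𝓝 t, ∃ s', K i (s', t') = 0 ∧ (s', t') ∈ O := by
  obtain ⟨δ, hδ, hb⟩ := Metric.mem_nhds_iff.1 hO
  obtain ⟨η, hη, hηδ, h1⟩ := exists_mul_neg_of_hasDerivAt (h.hasDerivAt i s t) h0 (h.deriv_ne i _ h0)
    hδ
  have hc : Continuous fun t' => K i (s - η, t') * K i (s + η, t') := by
    have := h.continuous i
    fun_prop
  filter_upwards [hc.continuousAt.eventually (isOpen_Iio.mem_nhds h1), Metric.ball_mem_nhds t hδ]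
    with t' ht hb'
  have hc' : Continuous fun s' => K i (s', t') := by
    have := h.continuous i
    fun_prop
  obtain ⟨s', hs', hz⟩ := exists_zero_of_mul_neg hc' (by linarith) ht
  refine ⟨s', hz, hb ?_⟩
  rw [Metric.mem_ball, Prod.dist_eq, max_lt_iff]
  refine ⟨?_, hb'⟩
  rw [Real.dist_eq, abs_lt]
  constructor <;> linarith [hs'.1, hs'.2]

theorem isOpen_chain (h : GenericFamily K D) (l : List Bool) :
    IsOpen {z : ℝ × ℝ | Chain (fun i s => K i (s, z.2)) l z.1} := by
  induction l with
  | nil => exact isOpen_univ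
  | cons i l ih =>
    rw [isOpen_iff_mem_nhds]
    rintro ⟨a, t⟩ ⟨s, hs, h0, h1⟩
    -- The midpoint of `a` and `s` protects the strict inequality: the perturbed start stays to its
    -- left and the perturbed zero to its right.
    have hO : {z : ℝ × ℝ | Chain (fun i s => K i (s, z.2)) l z.1} ∩ {z | (a + s) / 2 < z.1} ∈
        𝓝 (s, t) := by
      refine inter_mem (ih.mem_nhds h1) ((isOpen_lt continuous_const continuous_fst).mem_nhds ?_)
      change (a + s) / 2 < s
      dsimp at hs
      linarith
    have h2 := (continuous_snd (X := ℝ) (Y := ℝ)).continuousAt (x := (a, t)) |>.eventually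
      (h.eventually_exists_zero h0 hO)
    have h3 : ∀ᶠ z : ℝ × ℝ in 𝓝 (a, t), z.1 < (a + s) / 2 := by
      refine (isOpen_lt continuous_fst continuous_const).mem_nhds ?_
      change a < (a + s) / 2
      dsimp at hs
      linarith
    filter_upwards [h2, h3] with z hz hz'
    obtain ⟨s', hz0, hz1, hz2⟩ := hz
    exact ⟨s', hz'.trans hz2, hz0, hz1⟩

theorem isOpen_pattern (h : GenericFamily K D) (l : List Bool) :
    IsOpen {t | l ∈ pattern fun i s => K i (s, t)} := by
  have e : {t | l ∈ pattern fun i s => K i (s, t)} =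
      ⋃ a : ℝ, (fun t => (a, t)) ⁻¹' {z : ℝ × ℝ | Chain (fun i s => K i (s, z.2)) l z.1} := by
    ext t
    simp [pattern]
  rw [e]
  exact isOpen_iUnion fun a => (h.isOpen_chain l).preimage (by fun_prop)

/-- Compactness of `[-4, 4]` yields limits of the crossings, and only their strict order could be
lost. Two merging crossings of one wall leave a degenerate zero, by Rolle; merging crossings of
different walls leave a common zero. Requiring `z` to be a crossing itself is essential: a chain
with an arbitrary start is not a closed condition. -/
theorem isClosed_chain (h : GenericFamily K D) (l : List Bool) (i : Bool) :
    IsClosed {z : ℝ × ℝ | K i z = 0 ∧ Chain (fun i s => K i (s, z.2)) l z.1} := by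
  induction l generalizing i with
  | nil =>
    simp only [Chain, and_true]
    exact isClosed_eq (h.continuous i) continuous_const
  | cons j l ih =>
    refine IsSeqClosed.isClosed ?_
    intro z p hz hp
    choose hz0 s hs hs0 hsc using hz
    have hbd : ∀ n, s n ∈ Icc (-4 : ℝ) 4 := by
      intro n
      have := abs_lt_four (κ := fun i s => K i (s, (z n).2)) (fun i s => h.ne_zero i s _) (hs0 n)
      exact ⟨this.1.le, this.2.le⟩
    obtain ⟨r, -, φ, hφ, hr⟩ := isCompact_Icc.tendsto_subseq hbd
    have hp' := hp.comp hφ.tendsto_atTop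
    have hp1 : Tendsto (fun n => (z (φ n)).1) atTop (𝓝 p.1) := hp'.fst_nhds
    have hp2 : Tendsto (fun n => (z (φ n)).2) atTop (𝓝 p.2) := hp'.snd_nhds
    have hr2 : Tendsto (fun n => (s (φ n), (z (φ n)).2)) atTop (𝓝 (r, p.2)) := hr.prodMk_nhds hp2
    have hmem : K j (r, p.2) = 0 ∧ Chain (fun i s => K i (s, p.2)) l r :=
      (ih j).mem_of_tendsto hr2 (.of_forall fun n => ⟨hs0 (φ n), hsc (φ n)⟩)
    have hp0 : K i p = 0 :=
      (isClosed_eq (h.continuous i) continuous_const).mem_of_tendsto hp (.of_forall hz0)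
    refine ⟨hp0, r, lt_of_le_of_ne ?_ ?_, hmem⟩
    · exact le_of_tendsto_of_tendsto' hp1 hr fun n => (hs (φ n)).le
    · intro hpr
      have hpe : p = (r, p.2) := Prod.ext hpr rfl
      by_cases hij : i = j
      · subst hij
        have hrolle : ∀ n, ∃ ξ ∈ Ioo (z (φ n)).1 (s (φ n)), D i (ξ, (z (φ n)).2) = 0 := by
          intro n
          have hc : Continuous fun x => K i (x, (z (φ n)).2) := by
            have := h.continuous i
            fun_prop
          exact exists_hasDerivAt_eq_zero (hs (φ n)) hc.continuousOn
            ((hz0 (φ n)).trans (hs0 (φ n)).symm) fun x _ => h.hasDerivAt i x _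
        choose ξ hξ hD using hrolle
        have hξr : Tendsto ξ atTop (𝓝 p.1) :=
          tendsto_of_tendsto_of_tendsto_of_le_of_le hp1 (hpr ▸ hr) (fun n => (hξ n).1.le)
            fun n => (hξ n).2.le
        have hξ2 : Tendsto (fun n => (ξ n, (z (φ n)).2)) atTop (𝓝 p) := hξr.prodMk_nhds hp2
        exact h.deriv_ne i p hp0 ((isClosed_eq (h.continuous_deriv i)
          continuous_const).mem_of_tendsto hξ2 (.of_forall hD))
      · exact h.ne_of_ne i j p hij hp0 (hpe ▸ hmem.1)

theorem isClosed_pattern (h : GenericFamily K D) (l : List Bool) :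
    IsClosed {t | l ∈ pattern fun i s => K i (s, t)} := by
  cases l with
  | nil =>
    convert isClosed_univ
    exact eq_univ_of_forall fun t => nil_mem_pattern _
  | cons i l =>
    refine IsSeqClosed.isClosed ?_
    intro t t₀ ht ht₀
    have ht' : ∀ n, ∃ s, K i (s, t n) = 0 ∧ Chain (fun i s => K i (s, t n)) l s :=
      fun n => cons_mem_pattern_iff.1 (ht n)
    choose s hs using ht'
    have hbd : ∀ n, s n ∈ Icc (-4 : ℝ) 4 := by
      intro n
      have := abs_lt_four (κ := fun i s => K i (s, t n)) (fun i s => h.ne_zero i s _) (hs n).1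
      exact ⟨this.1.le, this.2.le⟩
    obtain ⟨r, -, φ, hφ, hr⟩ := isCompact_Icc.tendsto_subseq hbd
    have hr2 : Tendsto (fun n => (s (φ n), t (φ n))) atTop (𝓝 (r, t₀)) :=
      hr.prodMk_nhds (ht₀.comp hφ.tendsto_atTop)
    exact cons_mem_pattern_iff.2 ⟨r, (h.isClosed_chain l i).mem_of_tendsto hr2
      (.of_forall fun n => hs (φ n))⟩

/-- Membership of a given word is clopen in the parameter, and the real line is connected. -/
theorem pattern_eq (h : GenericFamily K D) (t t' : ℝ) :
    (pattern fun i s => K i (s, t)) = pattern fun i s => K i (s, t') := by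
  have key : ∀ (l : List Bool) (t t' : ℝ), (l ∈ pattern fun i s => K i (s, t)) →
      l ∈ pattern fun i s => K i (s, t') := by
    intro l t t' hl
    have hcl : IsClopen {t | l ∈ pattern fun i s => K i (s, t)} :=
      ⟨h.isClosed_pattern l, h.isOpen_pattern l⟩
    have : t' ∈ {t | l ∈ pattern fun i s => K i (s, t)} := hcl.eq_univ ⟨t, hl⟩ ▸ mem_univ t'
    exact this
  ext l
  exact ⟨key l t t', key l t' t⟩

end GenericFamily

end Patterns

/-! ### The algebraic obstruction to being a product -/

section Words

/-- A monoid with a homomorphism to the monoid of sets of words in two letters, under which the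
letters are represented by irreducible elements, is not a square. -/
theorem isEmpty_mulEquiv_of_words {M A : Type*} [Mul M] [One M] [Mul A] [One A]
    (one_mul' : ∀ m : M, 1 * m = m) (mul_one' : ∀ m : M, m * 1 = m)
    (one_mul_A : ∀ a : A, 1 * a = a) (mul_one_A : ∀ a : A, a * 1 = a)
    (W : M → Set (List Bool))
    (hmul : ∀ m m' l, l ∈ W (m * m') ↔ ∃ u ∈ W m, ∃ v ∈ W m', l = u ++ v)
    (hnil : ∀ m, [] ∈ W m) (hone : ∀ m, (∀ i, [i] ∉ W m) → m = 1)
    (hpair : ∀ m i, [i] ∈ W m → [i, i] ∈ W m) (hbdd : ∀ m, ∃ N, ∀ l ∈ W m, l.length ≤ N)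
    (x : Bool → M) (hx : ∀ i, [i] ∈ W (x i)) (hx' : ∀ i, ∀ l ∈ W (x i), ∀ j ∈ l, j = i)
    (hx4 : ∀ i, [i, i, i, i] ∉ W (x i)) {a : A} (ha : a ≠ 1) : IsEmpty (M ≃* A × A) := by
  -- If `z` commutes with `x i` and contains `j ≠ i`, then `i ⋯ i j` with any number of `i` is a
  -- word of `z`: put one more `i` in front using `x i * z`, read the result in `z * x i`, and note
  -- that the final `j` cannot come from `x i`. This contradicts boundedness.
  have hcomm : ∀ z i, z * x i = x i * z → ∀ j, j ≠ i → [j] ∉ W z := by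
    intro z i hz j hj hjz
    obtain ⟨N, hN⟩ := hbdd z
    have key : ∀ n, List.replicate n i ++ [j] ∈ W z := by
      intro n
      induction n with
      | zero => exact hjz
      | succ n ih =>
        have h1 : [i] ++ (List.replicate n i ++ [j]) ∈ W (x i * z) :=
          (hmul _ _ _).2 ⟨[i], hx i, _, ih, rfl⟩
        rw [← hz, hmul] at h1
        obtain ⟨u, hu, v, hv, he⟩ := h1
        rcases List.eq_nil_or_concat v with rfl | ⟨v', k, rfl⟩
        · rw [List.append_nil] at he
          rw [← he] at hu
          exact hu
        · have hk : k = i := hx' i _ hv k (by simp)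
          have h2 := congrArg List.getLast? he
          rw [List.concat_eq_append, ← List.append_assoc, ← List.append_assoc] at h2
          simp only [List.getLast?_concat, Option.some.injEq] at h2
          exact absurd (h2.trans hk) hj
    have := hN _ (key N)
    simp at this
  -- A nontrivial factor contains the letter `i`, hence contains it twice, so two nontrivial factors
  -- would give `i` four times.
  have hirr : ∀ i u v, x i = u * v → u = 1 ∨ v = 1 := by
    intro i u v h
    by_contra! hc
    have h1 : ∀ w, w ≠ 1 → (∀ j, [j] ∈ W w → [j] ∈ W (x i)) → [i, i] ∈ W w := by
      intro w hw hs
      obtain ⟨j, hj⟩ : ∃ j, [j] ∈ W w := by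
        by_contra! hn
        exact hw (hone w hn)
      have := hx' i _ (hs j hj) j (by simp)
      exact this ▸ hpair w j hj
    refine hx4 i ?_
    rw [h, hmul]
    refine ⟨[i, i], h1 u hc.1 fun j hj => ?_, [i, i], h1 v hc.2 fun j hj => ?_, rfl⟩
    · rw [h, hmul]
      exact ⟨[j], hj, [], hnil v, rfl⟩
    · rw [h, hmul]
      exact ⟨[], hnil u, [j], hj, rfl⟩
  have hne : ∀ i j, x i * x j = x j * x i → i = j := by
    intro i j h
    by_contra hij
    exact hcomm (x i) j h i hij (hx i)
  refine ⟨fun e => ?_⟩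
  -- A `MulEquiv` respects products only, so preservation of the unit is deduced from the unit laws.
  have he1 : e 1 = 1 := by
    have h1 : e (1 * e.symm 1) = e 1 * 1 := by rw [map_mul, e.apply_symm_apply]
    rw [one_mul', e.apply_symm_apply] at h1
    rw [h1]
    exact Prod.ext (mul_one_A _).symm (mul_one_A _).symm
  have hcomm' : ∀ b c : A, e.symm (b, 1) * e.symm (1, c) = e.symm (1, c) * e.symm (b, 1) := by
    intro b c
    rw [← map_mul, ← map_mul]
    congr 1
    exact Prod.ext ((mul_one_A b).trans (one_mul_A b).symm)
      ((one_mul_A c).trans (mul_one_A c).symm)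
  have hcase : ∀ i, (∃ b, x i = e.symm (b, 1)) ∨ ∃ c, x i = e.symm (1, c) := by
    intro i
    have h1 : x i = e.symm ((e (x i)).1, 1) * e.symm (1, (e (x i)).2) := by
      rw [← map_mul, MulEquiv.eq_symm_apply]
      exact Prod.ext (mul_one_A _).symm (one_mul_A _).symm
    rcases hirr i _ _ h1 with h | h
    · rw [h, one_mul'] at h1
      exact Or.inr ⟨_, h1⟩
    · rw [h, mul_one'] at h1
      exact Or.inl ⟨_, h1⟩
  have hfinal : ∀ z, (∀ i, z * x i = x i * z) → z = 1 := by
    intro z hz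
    refine hone z fun j => ?_
    exact hcomm z (!j) (hz _) j (by simp)
  -- If both lie in the same factor, `a` placed in the other factor commutes with both and is
  -- therefore trivial. In different factors they would commute.
  rcases hcase false with ⟨b, hb⟩ | ⟨b, hb⟩ <;> rcases hcase true with ⟨c, hc⟩ | ⟨c, hc⟩
  · have h1 := hfinal (e.symm (1, a)) (by
      intro i
      cases i
      · rw [hb, hcomm']
      · rw [hc, hcomm'])
    rw [MulEquiv.symm_apply_eq, he1] at h1
    exact ha (congrArg Prod.snd h1)
  · exact absurd (hne false true (by rw [hb, hc, hcomm'])) (by simp)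
  · exact absurd (hne false true (by rw [hb, hc, hcomm'])) (by simp)
  · have h1 := hfinal (e.symm (a, 1)) (by
      intro i
      cases i
      · rw [hb, hcomm']
      · rw [hc, hcomm'])
    rw [MulEquiv.symm_apply_eq, he1] at h1
    exact ha (congrArg Prod.fst h1)

end Words

/-! ### The line stratified by the origin and two half-lines -/

section Line

/-- The Euclidean line. -/
abbrev Line : Type := EuclideanSpace ℝ (Fin 1)

/-- The coordinate of the Euclidean line. -/
def coord : Line →L[ℝ] ℝ := EuclideanSpace.proj 0

theorem coord_injective : Function.Injective coord := by
  intro x y h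
  ext i
  obtain rfl := Subsingleton.elim i 0
  exact h

/-- The point with a given coordinate. -/
def linePt (u : ℝ) : Line := u • EuclideanSpace.single 0 1

theorem coord_linePt (u : ℝ) : coord (linePt u) = u := by
  simp [coord, linePt]

theorem isOpenMap_coord : IsOpenMap coord :=
  coord.isOpenMap fun u => ⟨linePt u, coord_linePt u⟩

/-- The partition of the line into the origin and the two open half-lines. -/
def lineStrata : Set (Set Line) := {coord ⁻¹' {0}, coord ⁻¹' Iio 0, coord ⁻¹' Ioi 0}

theorem isPartition_lineStrata : Setoid.IsPartition lineStrata := by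
  have hne : ∀ s : Set ℝ, s.Nonempty → (coord ⁻¹' s).Nonempty := by
    rintro s ⟨u, hu⟩
    exact ⟨linePt u, by rwa [mem_preimage, coord_linePt]⟩
  refine ⟨?_, fun x => ?_⟩
  · rintro (h | h | h)
    · exact (hne {0} (singleton_nonempty 0)).ne_empty h.symm
    · exact (hne (Iio 0) nonempty_Iio).ne_empty h.symm
    · exact (hne (Ioi 0) nonempty_Ioi).ne_empty h.symm
  · rcases lt_trichotomy (coord x) 0 with h | h | h
    · refine ⟨coord ⁻¹' Iio 0, ⟨Or.inr (Or.inl rfl), h⟩, ?_⟩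
      rintro _ ⟨rfl | rfl | rfl, hx⟩
      · exact absurd hx h.ne
      · rfl
      · exact absurd hx h.not_gt
    · refine ⟨coord ⁻¹' {0}, ⟨Or.inl rfl, h⟩, ?_⟩
      rintro _ ⟨rfl | rfl | rfl, hx⟩
      · rfl
      · exact absurd h (ne_of_lt hx)
      · exact absurd h (ne_of_gt hx)
    · refine ⟨coord ⁻¹' Ioi 0, ⟨Or.inr (Or.inr rfl), h⟩, ?_⟩
      rintro _ ⟨rfl | rfl | rfl, hx⟩
      · exact absurd hx h.ne'
      · exact absurd hx h.not_gt
      · rfl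

theorem isSubmanifold_of_isOpen {E H X : Type*} [NormedAddCommGroup E] [NormedSpace ℝ E]
    [TopologicalSpace H] [TopologicalSpace X] [ChartedSpace H X] {I : ModelWithCorners ℝ E H}
    [IsManifold I ∞ X] {U : Set X} (hU : IsOpen U) : IsSubmanifold I U := by
  intro p hp
  refine ⟨(chartAt H p).restr U, ?_, ?_, ⊤, ?_⟩
  · exact restr_mem_maximalAtlas (contDiffGroupoid ∞ I)
      (IsManifold.chart_mem_maximalAtlas p) hU
  · rw [OpenPartialHomeomorph.restr_source' _ _ hU]
    exact ⟨mem_chart_source H p, hp⟩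
  · intro x hx
    rw [OpenPartialHomeomorph.restr_source' _ _ hU] at hx
    simpa using hx.2

theorem isSubmanifold_zero : IsSubmanifold (𝓡 1) (coord ⁻¹' {0}) := by
  intro p hp
  refine ⟨chartAt Line p, IsManifold.chart_mem_maximalAtlas p, mem_chart_source Line p, ⊥, ?_⟩
  intro x _
  have hp' : coord p = 0 := hp
  simp only [mem_preimage, mem_singleton_iff, Submodule.mem_bot, mfld_simps]
  rw [sub_eq_zero]
  change coord x = 0 ↔ x = p
  rw [← coord_injective.eq_iff, hp']

theorem closure_preimage_coord (s : Set ℝ) : closure (coord ⁻¹' s) = coord ⁻¹' closure s :=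
  (isOpenMap_coord.preimage_closure_eq_closure_preimage coord.continuous s).symm

/-- The line, stratified by the origin and the two open half-lines. -/
def lineStratification : Stratification (𝓡 1) Line where
  strata := lineStrata
  isPartition := isPartition_lineStrata
  locallyFinite := by
    have : Finite lineStrata := by
      unfold lineStrata
      infer_instance
    exact locallyFinite_of_finite _
  frontier := by
    rintro _ (rfl | rfl | rfl) _ (rfl | rfl | rfl) ⟨x, hx, hx'⟩ <;>
      rw [closure_preimage_coord] at hx' ⊢ <;>
      refine preimage_mono ?_ <;>
      simp only [mem_preimage, closure_singleton, closure_Iio, closure_Ioi, mem_singleton_iff,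
        mem_Iio, mem_Ioi, mem_Iic, mem_Ici] at hx hx' ⊢ <;>
      intro y hy <;>
      simp only [mem_singleton_iff, mem_Iio, mem_Ioi, mem_Iic, mem_Ici] at hy ⊢ <;>
      linarith
  isConnected := by
    have hc : ∀ s : Set ℝ, Convex ℝ s → s.Nonempty → IsConnected (coord ⁻¹' s) := by
      rintro s hs ⟨u, hu⟩
      exact ⟨⟨linePt u, by rwa [mem_preimage, coord_linePt]⟩,
        (hs.is_linear_preimage coord.toLinearMap.isLinear).isPreconnected⟩
    rintro _ (rfl | rfl | rfl)
    · exact hc _ (convex_singleton 0) (singleton_nonempty 0)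
    · exact hc _ (convex_Iio 0) nonempty_Iio
    · exact hc _ (convex_Ioi 0) nonempty_Ioi
  isSubmanifold := by
    rintro _ (rfl | rfl | rfl)
    · exact isSubmanifold_zero
    · exact isSubmanifold_of_isOpen (isOpen_Iio.preimage coord.continuous)
    · exact isSubmanifold_of_isOpen (isOpen_Ioi.preimage coord.continuous)

/-- For an open stratum `B` the tangent spaces, and so their limit, are the whole line. For `B` the
origin, the limit point forces `A` to be the origin too, leaving no distinct `x k` and `y k`. -/
theorem isWhitney_line : lineStratification.IsWhitney := by
  intro A hA B hB p hp x y hx hy hxy hxp hyp L P _ hP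
  have hopen : IsOpen B → L ≤ P := by
    intro hBo
    obtain ⟨k, hk⟩ := hP.1.exists
    have htop : ∀ Q : Submodule ℝ Line, (∀ u, u ∈ Q) →
        Module.finrank ℝ Q = Module.finrank ℝ P → L ≤ P := by
      intro Q hQ hQP
      have hQ' : Q = ⊤ := eq_top_iff.2 fun u _ => hQ u
      rw [hQ', finrank_top] at hQP
      rw [Submodule.eq_top_of_finrank_eq hQP.symm]
      exact le_top
    refine htop _ (fun u => ?_) hk
    obtain ⟨v, hv⟩ := mfderiv_extend_surjective (J := 𝓡 1) (φ := chartAt Line p)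
      (p := y k) (IsManifold.chart_mem_maximalAtlas p) (mem_univ _) u
    refine ⟨v, ?_, hv⟩
    rw [tangentOf_eq_top_of_isOpen hBo (hy k)]
    trivial
  rcases hB with rfl | rfl | rfl
  · exfalso
    have hp0 : p ∈ coord ⁻¹' {0} :=
      (isClosed_singleton.preimage coord.continuous).mem_of_tendsto hyp (.of_forall hy)
    obtain rfl : A = coord ⁻¹' {0} :=
      (isPartition_lineStrata.2 p).unique ⟨hA, hp⟩ ⟨Or.inl rfl, hp0⟩
    have h1 : coord (x 0) = 0 := hx 0
    have h2 : coord (y 0) = 0 := hy 0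
    exact hxy 0 (coord_injective (h1.trans h2.symm))
  · exact hopen (isOpen_Iio.preimage coord.continuous)
  · exact hopen (isOpen_Ioi.preimage coord.continuous)

/-- The stratified line, with basepoint `1`. -/
def basedLine : BasedStratification (𝓡 1) Line where
  toStratification := lineStratification
  pt := linePt 1
  generic := ⟨coord ⁻¹' Ioi 0, Or.inr (Or.inr rfl), isOpen_Ioi.preimage coord.continuous, by
    rw [mem_preimage, coord_linePt]
    exact one_pos (α := ℝ)⟩

end Line

/-! ### The circle in the stereographic coordinate -/

section Circle

/-- The parametrization of the circle without its basepoint by stereographic projection. -/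
def circ (s : ℝ) : Sph 1 := sterInv (s • side 1)

theorem contMDiff_circ : ContMDiff 𝓘(ℝ, ℝ) (𝓡 1) ∞ circ :=
  contMDiff_sterInv.comp
    (f := fun s : ℝ => s • side 1) (contDiff_id.smul contDiff_const).contMDiff

theorem equator_one_eq (w : Equator 1) : w = inner ℝ (side 1) w • side 1 := by
  have h0 : inner ℝ (side 1) w = w.1 0 := by
    simp [side, EuclideanSpace.inner_single_left]
  have h1 : w.1 1 = 0 := by
    have := inner_pole w.1
    rw [Submodule.mem_orthogonal_singleton_iff_inner_right.mp w.2] at this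
    exact this.symm
  rw [h0]
  apply Subtype.ext
  ext i
  fin_cases i
  · simp [side]
  · simpa [side] using h1

theorem norm_smul_side (s : ℝ) : ‖s • side 1‖ = |s| := by
  rw [norm_smul, norm_side, mul_one, Real.norm_eq_abs]

theorem circ_mem_cap {s : ℝ} (hs : 4 ≤ |s|) : circ s ∈ cap 1 :=
  (sterInv_mem_cap_iff _).2 (by rwa [norm_smul_side])

theorem exists_circ_eq {x : Sph 1} (hx : x ≠ pole 1) : ∃ s, circ s = x :=
  ⟨_, by rw [circ, ← equator_one_eq, sterInv_ster hx]⟩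

theorem circ_last (s : ℝ) : (circ s).1 (Fin.last 1) = (s ^ 2 - 4) / (s ^ 2 + 4) := by
  rw [circ, sterInv_last, norm_smul_side, sq_abs]

theorem inner_side_ster_circ (s : ℝ) : inner ℝ (side 1) (ster (circ s)) = s := by
  rw [circ, ster_sterInv, inner_smul_right, real_inner_self_eq_norm_sq, norm_side]
  ring

theorem enlarge_circ (c s : ℝ) : enlarge (c • side 1) (circ s) = circ (4 * s + c) := by
  unfold enlarge circ
  congr 1
  have h : ster (sterInv (s • side 1)) = s • side 1 := ster_sterInv _
  refine (congrArg (fun w => (4 : ℝ) • w + c • side 1) h).trans ?_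
  module

theorem pinch_circ_of_neg {s : ℝ} (hs : s < 0) : pinch (circ s) = Sum.inl (circ (4 * s + 8)) := by
  have h : (circ s).1 0 < 0 := by rwa [← inner_side_ster_neg_iff, inner_side_ster_circ]
  rw [pinch, if_pos h, enlarge_circ]

theorem pinch_circ_of_nonneg {s : ℝ} (hs : 0 ≤ s) :
    pinch (circ s) = Sum.inr (circ (4 * s - 8)) := by
  have h : ¬ (circ s).1 0 < 0 := by
    rw [← inner_side_ster_neg_iff, inner_side_ster_circ]
    exact hs.not_gt
  rw [pinch, if_neg h, ← neg_smul, enlarge_circ, sub_eq_add_neg]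

/-- This lets transversality on the circle be read as a statement about ordinary derivatives in `s`.
-/
theorem exists_mfderiv_circ (s : ℝ) (v : TangentSpace (𝓡 1) (circ s)) :
    ∃ a : ℝ, mfderiv 𝓘(ℝ, ℝ) (𝓡 1) circ s a = v := by
  obtain ⟨w, hw⟩ := mfderiv_sterInv_surjective (s • side 1) v
  let w' : Equator 1 := w
  have hd : HasFDerivAt (fun s : ℝ => s • side 1)
      ((ContinuousLinearMap.id ℝ ℝ).smulRight (side 1)) s :=
    (hasFDerivAt_id s).smul_const (side 1)
  have h1 : mfderiv 𝓘(ℝ, ℝ) (𝓡 1) circ s =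
      (mfderiv 𝓘(ℝ, Equator 1) (𝓡 1) (sterInv : Equator 1 → Sph 1) (s • side 1)).comp
        (mfderiv 𝓘(ℝ, ℝ) 𝓘(ℝ, Equator 1) (fun s : ℝ => s • side 1) s) :=
    mfderiv_comp s ((contMDiff_sterInv _).mdifferentiableAt (by simp))
      hd.differentiableAt.mdifferentiableAt
  refine ⟨inner ℝ (side 1) w', ?_⟩
  rw [h1, mfderiv_eq_fderiv, hd.fderiv, ← hw]
  exact congrArg (mfderiv 𝓘(ℝ, Equator 1) (𝓡 1) (sterInv : Equator 1 → Sph 1) (s • side 1))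
    (equator_one_eq w').symm

end Circle

/-! ### Crossing words of loops in the plane -/

section Crossings

/-- The square of the stratified line. -/
def basedPlane : BasedStratification ((𝓡 1).prod (𝓡 1)) (Line × Line) := basedLine.prod basedLine

/-- The coordinates of the plane. -/
def coords : Bool → Line × Line → ℝ
  | false, z => coord z.1
  | true, z => coord z.2

/-- The differentials of the coordinates of the plane. -/
def coordsL : Bool → Line × Line →L[ℝ] ℝ
  | false => coord.comp (ContinuousLinearMap.fst ℝ Line Line)
  | true => coord.comp (ContinuousLinearMap.snd ℝ Line Line)

theorem contMDiff_coords (i : Bool) : ContMDiff ((𝓡 1).prod (𝓡 1)) 𝓘(ℝ, ℝ) ∞ (coords i) := by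
  cases i
  · exact coord.contDiff.contMDiff.comp contMDiff_fst
  · exact coord.contDiff.contMDiff.comp contMDiff_snd

theorem mfderiv_coords (i : Bool) (z : Line × Line) :
    mfderiv ((𝓡 1).prod (𝓡 1)) 𝓘(ℝ, ℝ) (coords i) z = coordsL i := by
  cases i
  · exact (coord.hasMFDerivAt.comp z (hasMFDerivAt_fst z)).mfderiv
  · exact (coord.hasMFDerivAt.comp z (hasMFDerivAt_snd z)).mfderiv

theorem coords_pt (i : Bool) : coords i basedPlane.pt = 1 := by
  cases i <;> exact coord_linePt 1

theorem eq_zero_of_mem_strata {C : Set (Line × Line)} (hC : C ∈ basedPlane.strata)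
    {z z' : Line × Line} (hz : z ∈ C) (hz' : z' ∈ C) {i : Bool} (h0 : coords i z = 0) :
    coords i z' = 0 := by
  obtain ⟨A, hA, B, hB, rfl⟩ := hC
  have key : ∀ A ∈ lineStrata, ∀ x ∈ A, ∀ y ∈ A, coord x = 0 → coord y = 0 := by
    intro A hA x hx y hy hx0
    obtain rfl : A = coord ⁻¹' {0} :=
      (isPartition_lineStrata.2 x).unique ⟨hA, hx⟩ ⟨Or.inl rfl, hx0⟩
    exact hy
  cases i
  · exact key A hA _ hz.1 _ hz'.1 h0
  · exact key B hB _ hz.2 _ hz'.2 h0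

/-- A coordinate that vanishes at one point of a stratum vanishes on all of it, so it is an
admissible test function for the tangent space. -/
theorem coordsL_eq_zero_of_mem_tangentOf {C : Set (Line × Line)} (hC : C ∈ basedPlane.strata)
    {z : Line × Line} (hz : z ∈ C) {i : Bool} (h0 : coords i z = 0)
    {v : TangentSpace ((𝓡 1).prod (𝓡 1)) z} (hv : v ∈ tangentOf ((𝓡 1).prod (𝓡 1)) C z) :
    coordsL i v = 0 := by
  have h1 := hv (coords i) (contMDiff_coords i z) (by
    filter_upwards [self_mem_nhdsWithin] with x hx
    exact eq_zero_of_mem_strata hC hz hx h0)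
  rw [mfderiv_coords] at h1
  exact h1

/-- A family of transversal loops crosses the coordinate axes nondegenerately. -/
theorem IsFamily.exists_genericFamily {h : Sph 1 × ℝ → Line × Line} (hh : IsFamily basedPlane h) :
    ∃ D, GenericFamily (fun i (z : ℝ × ℝ) => coords i (h (circ z.1, z.2))) D := by
  set K : Bool → ℝ × ℝ → ℝ := fun i z => coords i (h (circ z.1, z.2)) with hKdef
  have hσ : ContMDiff 𝓘(ℝ, ℝ × ℝ) ((𝓡 1).prod 𝓘(ℝ, ℝ)) ∞
      (fun z : ℝ × ℝ => (circ z.1, z.2)) :=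
    (contMDiff_circ.comp contDiff_fst.contMDiff).prodMk contDiff_snd.contMDiff
  have hK : ∀ i, ContDiff ℝ ∞ (K i) := fun i =>
    contMDiff_iff_contDiff.1 ((contMDiff_coords i).comp (hh.smooth.comp hσ))
  have hD : ∀ i s t, HasDerivAt (fun s => K i (s, t)) (fderiv ℝ (K i) (s, t) (1, 0)) s := by
    intro i s t
    have h1 : HasFDerivAt (K i) (fderiv ℝ (K i) (s, t)) (s, t) :=
      ((hK i).differentiable (by simp)).differentiableAt.hasFDerivAt
    have h2 : HasDerivAt (fun s : ℝ => (s, t)) ((1 : ℝ), (0 : ℝ)) s :=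
      (hasDerivAt_id s).prodMk (hasDerivAt_const s t)
    exact h1.comp_hasDerivAt s h2
  have hx : ∀ s t, MDifferentiableAt (𝓡 1) ((𝓡 1).prod (𝓡 1)) (fun x => h (x, t)) (circ s) :=
    fun s t => ((hh.smooth _).comp (circ s)
      (contMDiff_id.prodMk contMDiff_const).contMDiffAt).mdifferentiableAt (by simp)
  have hchain : ∀ i s t (a : ℝ), coordsL i (mfderiv (𝓡 1) ((𝓡 1).prod (𝓡 1)) (fun x => h (x, t))
      (circ s) (mfderiv 𝓘(ℝ, ℝ) (𝓡 1) circ s a)) = a * fderiv ℝ (K i) (s, t) (1, 0) := by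
    intro i s t a
    have hc : MDifferentiableAt 𝓘(ℝ, ℝ) (𝓡 1) circ s :=
      (contMDiff_circ s).mdifferentiableAt (by simp)
    have h2 : mfderiv 𝓘(ℝ, ℝ) 𝓘(ℝ, ℝ) (fun s => K i (s, t)) s =
        (mfderiv ((𝓡 1).prod (𝓡 1)) 𝓘(ℝ, ℝ) (coords i) (h (circ s, t))).comp
          ((mfderiv (𝓡 1) ((𝓡 1).prod (𝓡 1)) (fun x => h (x, t)) (circ s)).comp
            (mfderiv 𝓘(ℝ, ℝ) (𝓡 1) circ s)) := by
      rw [← mfderiv_comp s (hx s t) hc]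
      exact mfderiv_comp s (g := coords i) (f := (fun x => h (x, t)) ∘ circ)
        ((contMDiff_coords i _).mdifferentiableAt (by simp)) ((hx s t).comp s hc)
    rw [mfderiv_coords, mfderiv_eq_fderiv, (hD i s t).hasFDerivAt.fderiv] at h2
    exact (DFunLike.congr_fun h2 a).symm
  -- Transversality in coordinates. The same `a` serves every vanishing coordinate: with `w = (1,
  -- 1)` this excludes degenerate zeros, with `w = (1, 0)` common ones.
  have hsurj : ∀ s t (w : Line × Line), ∃ a : ℝ, ∀ i, K i (s, t) = 0 →
      coordsL i w = a * fderiv ℝ (K i) (s, t) (1, 0) := by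
    intro s t w
    obtain ⟨C, ⟨hC, hz⟩, -⟩ := basedPlane.isPartition.2 (h (circ s, t))
    obtain ⟨v, hv⟩ := normallySurjectiveAt_iff.1 (hh.transversal t (circ s)) C hC hz w
    obtain ⟨a, rfl⟩ := exists_mfderiv_circ s v
    refine ⟨a, fun i hi => ?_⟩
    have h1 := coordsL_eq_zero_of_mem_tangentOf hC hz hi hv
    rw [← hchain]
    have hsub : ∀ b c : Line × Line, coordsL i (b - c) = 0 → coordsL i b = coordsL i c :=
      fun b c hbc => sub_eq_zero.1 ((map_sub (coordsL i) b c).symm.trans hbc)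
    exact hsub w _ h1
  have hne : ∀ i z, K i z = 0 → fderiv ℝ (K i) z (1, 0) ≠ 0 := by
    rintro i ⟨s, t⟩ h0 hd
    obtain ⟨a, ha⟩ := hsurj s t (linePt 1, linePt 1)
    have h1 := ha i h0
    rw [hd, mul_zero] at h1
    have h2 : coordsL i (linePt 1, linePt 1) = 1 := by
      cases i <;> exact coord_linePt 1
    rw [h2] at h1
    exact one_ne_zero h1
  have hboth : ∀ z, K false z = 0 → K true z ≠ 0 := by
    rintro ⟨s, t⟩ h0 h1
    obtain ⟨a, ha⟩ := hsurj s t (linePt 1, 0)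
    have e0 := ha false h0
    have e1 := ha true h1
    have h2 : coordsL false (linePt 1, 0) = 1 := coord_linePt 1
    have h3 : coordsL true (linePt 1, 0) = 0 := map_zero coord
    rw [h2] at e0
    rw [h3] at e1
    rcases mul_eq_zero.1 e1.symm with h | h
    · rw [h, zero_mul] at e0
      exact one_ne_zero e0
    · exact hne true _ h1 h
  refine ⟨fun i z => fderiv ℝ (K i) z (1, 0), fun i => (hK i).continuous, fun i => ?_, hD, hne,
    ?_, ?_⟩
  · exact ((hK i).continuous_fderiv (by simp)).clm_apply continuous_const
  · intro i j z hij hi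
    cases i <;> cases j
    · exact absurd rfl hij
    · exact hboth z hi
    · exact fun hj => hboth z hj hi
    · exact absurd rfl hij
  · intro i s t hs
    have : K i (s, t) = coords i basedPlane.pt := congrArg (coords i) (hh.based t _ (circ_mem_cap hs))
    rw [this, coords_pt]
    exact one_ne_zero

/-- The coordinates of a loop in the plane. -/
def crossing (f : Sph 1 → Line × Line) (i : Bool) (s : ℝ) : ℝ := coords i (f (circ s))

theorem TransMap.isFamily {E H X : Type*} [NormedAddCommGroup E] [NormedSpace ℝ E]
    [TopologicalSpace H] [TopologicalSpace X] [ChartedSpace H X] {I : ModelWithCorners ℝ E H}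
    {n : ℕ} {S : BasedStratification I X} (f : TransMap n S) :
    IsFamily S fun z : Sph n × ℝ => f.toFun z.1 :=
  ⟨f.smooth.comp contMDiff_fst, fun _ => f.transversal, fun _ => f.based⟩

theorem crossing_eq_one (f : TransMap 1 basedPlane) (i : Bool) {s : ℝ} (hs : 4 ≤ |s|) :
    crossing f.toFun i s = 1 :=
  (congrArg (coords i) (f.based _ (circ_mem_cap hs))).trans (coords_pt i)

theorem crossing_ne_zero (f : TransMap 1 basedPlane) (i : Bool) (s : ℝ) (hs : 4 ≤ |s|) :
    crossing f.toFun i s ≠ 0 := by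
  rw [crossing_eq_one f i hs]
  exact one_ne_zero

theorem continuous_crossing (f : TransMap 1 basedPlane) (i : Bool) :
    Continuous (crossing f.toFun i) :=
  (contMDiff_coords i).continuous.comp (f.smooth.continuous.comp contMDiff_circ.continuous)

theorem crossing_mul (f g : TransMap 1 basedPlane) :
    crossing (f.mul g).toFun = concat (crossing f.toFun) (crossing g.toFun) := by
  funext i s
  have h : (f.mul g).toFun (circ s) = Sum.elim f.toFun g.toFun (pinch (circ s)) := rfl
  rw [crossing, h, concat]
  split_ifs with hs
  · rw [pinch_circ_of_neg hs]
    rfl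
  · rw [pinch_circ_of_nonneg (not_lt.1 hs)]
    rfl

theorem exists_hasDerivAt_crossing (f : TransMap 1 basedPlane) : ∃ d : Bool → ℝ → ℝ,
    (∀ i s, HasDerivAt (crossing f.toFun i) (d i s) s) ∧
      ∀ i s, crossing f.toFun i s = 0 → d i s ≠ 0 := by
  obtain ⟨D, hD⟩ := f.isFamily.exists_genericFamily
  exact ⟨fun i s => D i (s, 0), fun i s => hD.hasDerivAt i s 0, fun i s => hD.deriv_ne i (s, 0)⟩

/-- The set of subwords of the word of crossings of a class of loops in the plane. -/
def words : Psi 1 basedPlane → Set (List Bool) :=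
  Quotient.lift (fun f : TransMap 1 basedPlane => pattern (crossing f.toFun)) fun f g hfg => by
    obtain ⟨h, hs, ht, hb, ε, hε, he⟩ := hfg
    obtain ⟨D, hD⟩ := IsFamily.exists_genericFamily (h := h) ⟨hs, ht, hb⟩
    have e0 : crossing f.toFun = fun i s => coords i (h (circ s, 0)) := by
      funext i s
      rw [(he _ _).1 hε]
      rfl
    have e1 : crossing g.toFun = fun i s => coords i (h (circ s, 1)) := by
      funext i s
      rw [(he _ _).2 (by linarith)]
      rfl
    change pattern (crossing f.toFun) = pattern (crossing g.toFun)
    rw [e0, e1]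
    exact hD.pattern_eq 0 1

theorem NormallySurjectiveAt.of_mem_isOpen {E H X F G Y : Type*} [NormedAddCommGroup E]
    [NormedSpace ℝ E] [TopologicalSpace H] [TopologicalSpace X] [ChartedSpace H X]
    {I : ModelWithCorners ℝ E H} [NormedAddCommGroup F] [NormedSpace ℝ F] [TopologicalSpace G]
    [TopologicalSpace Y] [ChartedSpace G Y] {J : ModelWithCorners ℝ F G}
    {S : Stratification I X} {f : Y → X} {p : Y} {U : Set X} (hU : U ∈ S.strata)
    (hUo : IsOpen U) (hp : f p ∈ U) : NormallySurjectiveAt J S f p := by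
  rw [normallySurjectiveAt_iff]
  intro A hA hpA w
  obtain rfl : A = U := (S.isPartition.2 (f p)).unique ⟨hA, hpA⟩ ⟨hU, hp⟩
  refine ⟨0, ?_⟩
  rw [tangentOf_eq_top_of_isOpen hUo hpA]
  trivial

/-- A loop which does not cross the axes is null homotopic. -/
theorem homotopic_const_of_pattern (f : TransMap 1 basedPlane)
    (hf : ∀ i, [i] ∉ pattern (crossing f.toFun)) :
    Homotopic f (TransMap.const 1 basedPlane) := by
  -- Without crossings both coordinates keep their sign at the basepoint, so the loop stays in the
  -- open positive quadrant. That quadrant is a convex stratum, in which a straight-line homotopy is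
  -- transversal.
  have hpos : ∀ i x, 0 < coords i (f.toFun x) := by
    intro i x
    by_cases hx : x = pole 1
    · rw [hx, f.based _ (pole_mem_cap 1), coords_pt]
      exact one_pos
    · obtain ⟨s, rfl⟩ := exists_circ_eq hx
      have h0 : ∀ r, crossing f.toFun i r ≠ 0 := fun r hr =>
        hf i (singleton_mem_pattern_iff.2 ⟨r, hr⟩)
      by_contra! hc
      have h1 : crossing f.toFun i s < 0 := lt_of_le_of_ne hc (h0 s)
      have h4 : (0 : ℝ) < crossing f.toFun i (max s 4) := by
        rw [crossing_eq_one f i ((le_max_right s 4).trans (le_abs_self _))]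
        exact one_pos
      obtain ⟨r, -, hr⟩ := exists_zero_of_mul_neg (continuous_crossing f i) (le_max_left s 4)
        (mul_neg_of_neg_of_pos h1 h4)
      exact h0 r hr
  have hsm : ∀ (p : Line × Line → Line), ContMDiff ((𝓡 1).prod (𝓡 1)) (𝓡 1) ∞ p →
      ∀ c : Line, ContMDiff ((𝓡 1).prod 𝓘(ℝ, ℝ)) (𝓡 1) ∞
        fun z : Sph 1 × ℝ => (1 - step z.2) • p (f.toFun z.1) + step z.2 • c := by
    intro p hp c
    have hstep : ContMDiff ((𝓡 1).prod 𝓘(ℝ, ℝ)) 𝓘(ℝ, ℝ) ∞ fun z : Sph 1 × ℝ => step z.2 :=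
      contDiff_step.contMDiff.comp contMDiff_snd
    have hstep' : ContMDiff ((𝓡 1).prod 𝓘(ℝ, ℝ)) 𝓘(ℝ, ℝ) ∞ fun z : Sph 1 × ℝ => 1 - step z.2 :=
      (contDiff_const.sub contDiff_step).contMDiff.comp contMDiff_snd
    exact (hstep'.smul (hp.comp (f.smooth.comp contMDiff_fst))).add (hstep.smul contMDiff_const)
  have hcoord : ∀ (x : Line) (t : ℝ), 0 < coord x →
      0 < coord ((1 - step t) • x + step t • linePt 1) := by
    intro x t hx
    rw [map_add, map_smul, map_smul, coord_linePt]
    exact path_pos hx one_pos t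
  have hU : (coord ⁻¹' Ioi 0) ×ˢ (coord ⁻¹' Ioi 0) ∈ basedPlane.strata :=
    ⟨_, Or.inr (Or.inr rfl), _, Or.inr (Or.inr rfl), rfl⟩
  have hUo : IsOpen ((coord ⁻¹' Ioi 0) ×ˢ (coord ⁻¹' Ioi 0) : Set (Line × Line)) :=
    (isOpen_Ioi.preimage coord.continuous).prod (isOpen_Ioi.preimage coord.continuous)
  refine IsFamily.homotopic (h := fun z => ((1 - step z.2) • (f.toFun z.1).1 + step z.2 • linePt 1,
    (1 - step z.2) • (f.toFun z.1).2 + step z.2 • linePt 1)) ⟨?_, ?_, ?_⟩ ?_ ?_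
  · exact (hsm Prod.fst contMDiff_fst _).prodMk (hsm Prod.snd contMDiff_snd _)
  · intro t x
    exact NormallySurjectiveAt.of_mem_isOpen hU hUo
      ⟨hcoord _ t (hpos false x), hcoord _ t (hpos true x)⟩
  · intro t x hx
    have h1 : f.toFun x = (linePt 1, linePt 1) := f.based x hx
    simp only [h1, ← add_smul, sub_add_cancel, one_smul]
    rfl
  · intro x t ht
    simp [step_of_lt ht]
  · intro x t ht
    simp only [step_of_gt ht, sub_self, zero_smul, one_smul, zero_add]
    rfl

end Crossings

/-! ### The two wall loops and the counterexample -/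

section Loops

/-- A smooth function with the single zero `0` on `(-∞, 1]`, which is `1` on `[3 / 5, ∞)`. -/
def dip (u : ℝ) : ℝ := u + (1 - u) * Real.smoothTransition (5 * u - 1)

theorem contDiff_dip : ContDiff ℝ ∞ dip :=
  contDiff_id.add ((contDiff_const.sub contDiff_id).mul
    (Real.smoothTransition.contDiff.comp ((contDiff_const.mul contDiff_id).sub contDiff_const)))

theorem dip_of_le {u : ℝ} (hu : u ≤ 1 / 5) : dip u = u := by
  rw [dip, Real.smoothTransition.zero_of_nonpos (by linarith), mul_zero, add_zero]

theorem dip_of_ge {u : ℝ} (hu : 3 / 5 ≤ u) : dip u = 1 := by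
  rw [dip, Real.smoothTransition.one_of_one_le (by linarith)]
  ring

theorem eq_zero_of_dip_eq_zero {u : ℝ} (hu : u ≤ 1) (h : dip u = 0) : u = 0 := by
  rcases le_or_gt u (1 / 5) with h1 | h1
  · rwa [dip_of_le h1] at h
  · have h2 := mul_nonneg (sub_nonneg.2 hu) (Real.smoothTransition.nonneg (5 * u - 1))
    unfold dip at h
    linarith

/-- The function on the circle that is used to cross a wall. -/
def dipFun (x : Sph 1) : Line := linePt (dip (x.1 (Fin.last 1)))

theorem coord_dipFun_circ (s : ℝ) :
    coord (dipFun (circ s)) = dip ((s ^ 2 - 4) / (s ^ 2 + 4)) := by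
  rw [dipFun, coord_linePt, circ_last]

theorem sq_eq_of_coord_dipFun {s : ℝ} (h : coord (dipFun (circ s)) = 0) : s ^ 2 = 4 := by
  rw [coord_dipFun_circ] at h
  have h1 : (s ^ 2 - 4) / (s ^ 2 + 4) ≤ 1 := by
    rw [div_le_one (by positivity)]
    linarith
  have h2 := eq_zero_of_dip_eq_zero h1 h
  rw [div_eq_zero_iff] at h2
  rcases h2 with h2 | h2
  · linarith
  · nlinarith [sq_nonneg s]

theorem coord_dipFun_circ_two : coord (dipFun (circ 2)) = 0 := by
  rw [coord_dipFun_circ]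
  norm_num
  exact dip_of_le (by norm_num)

theorem contMDiff_dipFun : ContMDiff (𝓡 1) (𝓡 1) ∞ dipFun := by
  have : Fact (Module.finrank ℝ (EuclideanSpace ℝ (Fin (1 + 1))) = 1 + 1) := ⟨by simp⟩
  have h1 : ContDiff ℝ ∞ fun y : EuclideanSpace ℝ (Fin (1 + 1)) => linePt (dip (y (Fin.last 1))) := by
    have h2 : ContDiff ℝ ∞ fun y : EuclideanSpace ℝ (Fin (1 + 1)) => y (Fin.last 1) := by fun_prop
    exact (contDiff_dip.comp h2).smul contDiff_const
  exact h1.contMDiff.comp contMDiff_coe_sphere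

theorem isTransversal_dipFun : IsTransversal (𝓡 1) lineStratification dipFun := by
  intro p
  rcases lt_trichotomy (coord (dipFun p)) 0 with h | h | h
  · exact NormallySurjectiveAt.of_mem_isOpen (Or.inr (Or.inl rfl) : coord ⁻¹' Iio 0 ∈ lineStrata)
      (isOpen_Iio.preimage coord.continuous) h
  · have hp : p ≠ pole 1 := by
      rintro rfl
      rw [dipFun, coord_linePt, pole_last, dip_of_ge (by norm_num)] at h
      exact one_ne_zero h
    obtain ⟨s, rfl⟩ := exists_circ_eq hp
    have hs := sq_eq_of_coord_dipFun h
    -- The height `(s ^ 2 - 4) / (s ^ 2 + 4)` has derivative `16 s / (s ^ 2 + 4) ^ 2`, which is `s /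
    -- 4` at `s ^ 2 = 4`. There `dip` is the identity nearby.
    have hder : HasDerivAt (fun s => coord (dipFun (circ s))) (s / 4) s := by
      have h1 : HasDerivAt (fun s : ℝ => (s ^ 2 - 4) / (s ^ 2 + 4)) (s / 4) s := by
        have h2 := (((hasDerivAt_pow 2 s).sub_const 4).div ((hasDerivAt_pow 2 s).add_const 4)
          (by positivity))
        refine HasDerivAt.congr_deriv h2 ?_
        rw [hs]
        norm_num
        ring
      refine h1.congr_of_eventuallyEq ?_
      have h3 : (s ^ 2 - 4) / (s ^ 2 + 4) < 1 / 5 := by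
        rw [hs]
        norm_num
      filter_upwards [h1.continuousAt.eventually (isOpen_Iio.mem_nhds h3)] with r hr
      rw [coord_dipFun_circ, dip_of_le (le_of_lt hr)]
    have hs0 : s / 4 ≠ 0 := by
      intro h0
      have : s = 0 := by linarith
      rw [this] at hs
      norm_num at hs
    have hd : MDifferentiableAt (𝓡 1) (𝓡 1) dipFun (circ s) :=
      (contMDiff_dipFun _).mdifferentiableAt (by simp)
    have hc : MDifferentiableAt 𝓘(ℝ, ℝ) (𝓡 1) circ s :=
      (contMDiff_circ s).mdifferentiableAt (by simp)
    have hchain : mfderiv 𝓘(ℝ, ℝ) 𝓘(ℝ, ℝ) (fun s => coord (dipFun (circ s))) s =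
        coord.comp ((mfderiv (𝓡 1) (𝓡 1) dipFun (circ s)).comp
          (mfderiv 𝓘(ℝ, ℝ) (𝓡 1) circ s)) := by
      rw [← mfderiv_comp s hd hc]
      have h2 := mfderiv_comp s (I := 𝓘(ℝ, ℝ)) (I' := 𝓡 1) (I'' := 𝓘(ℝ, ℝ)) (g := coord)
        (f := dipFun ∘ circ) coord.mdifferentiableAt (hd.comp s hc)
      rw [coord.mfderiv_eq] at h2
      exact h2
    rw [mfderiv_eq_fderiv, hder.hasFDerivAt.fderiv] at hchain
    rw [normallySurjectiveAt_iff]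
    intro A _ _ w
    let w' : Line := w
    let a : ℝ := coord w' / (s / 4)
    refine ⟨mfderiv 𝓘(ℝ, ℝ) (𝓡 1) circ s a, ?_⟩
    have h1 : coord (mfderiv (𝓡 1) (𝓡 1) dipFun (circ s) (mfderiv 𝓘(ℝ, ℝ) (𝓡 1) circ s a))
        = a * (s / 4) := (DFunLike.congr_fun hchain a).symm
    have h2 : (mfderiv (𝓡 1) (𝓡 1) dipFun (circ s) (mfderiv 𝓘(ℝ, ℝ) (𝓡 1) circ s a) : Line)
        = w' := by
      apply coord_injective
      exact h1.trans (div_mul_cancel₀ _ hs0)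
    have h3 : w - mfderiv (𝓡 1) (𝓡 1) dipFun (circ s) (mfderiv 𝓘(ℝ, ℝ) (𝓡 1) circ s a) = 0 :=
      sub_eq_zero.2 h2.symm
    rw [h3]
    exact zero_mem _
  · exact NormallySurjectiveAt.of_mem_isOpen (Or.inr (Or.inr rfl) : coord ⁻¹' Ioi 0 ∈ lineStrata)
      (isOpen_Ioi.preimage coord.continuous) h

/-- The loop in the line that crosses the origin and comes back. -/
def dipLoop : TransMap 1 basedLine where
  toFun := dipFun
  smooth := contMDiff_dipFun
  transversal := isTransversal_dipFun
  based x hx := by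
    rw [dipFun, dip_of_ge hx]
    rfl

/-- The loops in the plane that cross one of the axes and come back. -/
def wallLoop : Bool → TransMap 1 basedPlane
  | false => dipLoop.map (isNormalSubmersion_inl basedLine basedLine)
  | true => dipLoop.map (isNormalSubmersion_inr basedLine basedLine)

theorem crossing_wallLoop (i : Bool) (s : ℝ) :
    crossing (wallLoop i).toFun i s = coord (dipFun (circ s)) := by
  cases i <;> rfl

theorem crossing_wallLoop_of_ne {i j : Bool} (h : j ≠ i) (s : ℝ) :
    crossing (wallLoop i).toFun j s = 1 := by
  cases i <;> cases j
  · exact absurd rfl h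
  · exact coord_linePt 1
  · exact coord_linePt 1
  · exact absurd rfl h

theorem eq_of_crossing_wallLoop {i j : Bool} {s : ℝ} (h : crossing (wallLoop i).toFun j s = 0) :
    j = i := by
  by_contra hij
  rw [crossing_wallLoop_of_ne hij] at h
  exact one_ne_zero h

theorem isEmpty_mulEquiv_basedPlane :
    IsEmpty (Psi 1 basedPlane ≃* Psi 1 basedLine × Psi 1 basedLine) := by
  have hM := isDaggerMonoid_psi (n := 1) basedPlane
  have hA := isDaggerMonoid_psi (n := 1) basedLine
  have hword : ∀ i, [i] ∈ words (Psi.mk (wallLoop i)) := fun i =>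
    singleton_mem_pattern_iff.2 ⟨2, (crossing_wallLoop i 2).trans coord_dipFun_circ_two⟩
  refine isEmpty_mulEquiv_of_words hM.one_mul hM.mul_one hA.one_mul hA.mul_one words
    ?_ ?_ ?_ ?_ ?_ (fun i => Psi.mk (wallLoop i)) hword ?_ ?_ (a := Psi.mk dipLoop) ?_
  · rintro ⟨f⟩ ⟨g⟩ l
    change l ∈ pattern (crossing (f.mul g).toFun) ↔ _
    rw [crossing_mul]
    exact mem_pattern_concat (crossing_ne_zero f) (crossing_ne_zero g)
  · rintro ⟨f⟩
    exact nil_mem_pattern _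
  · rintro ⟨f⟩ hf
    exact Quotient.sound (homotopic_const_of_pattern f hf)
  · rintro ⟨f⟩ i hi
    obtain ⟨d, hd, hd0⟩ := exists_hasDerivAt_crossing f
    refine pair_mem_pattern (continuous_crossing f i) (hd i) (hd0 i) (fun s hs => ?_) hi
    rw [crossing_eq_one f i hs]
    exact one_pos
  · rintro ⟨f⟩
    obtain ⟨d, hd, hd0⟩ := exists_hasDerivAt_crossing f
    exact exists_length_le hd hd0 (crossing_ne_zero f)
  · intro i l hl j hj
    obtain ⟨s, hs⟩ := exists_zero_of_mem_pattern hl hj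
    exact eq_of_crossing_wallLoop hs
  · intro i hi
    -- The loop has at most two crossings, so no word of length four.
    have hZ : ∀ j s, crossing (wallLoop i).toFun j s = 0 → s ∈ ({2, -2} : Set ℝ) := by
      intro j s h
      obtain rfl := eq_of_crossing_wallLoop h
      rw [crossing_wallLoop] at h
      have := sq_eq_of_coord_dipFun h
      have h2 : s ^ 2 = 2 ^ 2 := by linarith
      exact sq_eq_sq_iff_eq_or_eq_neg.1 h2
    have h1 := length_le_of_mem_pattern (Set.toFinite _) hZ hi
    have h2 := Set.ncard_insert_le (2 : ℝ) {-2}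
    rw [Set.ncard_singleton] at h2
    exact absurd (h1.trans h2) (by simp)
  · intro h
    -- Triviality of `dipLoop` would pass to its image in the plane, whose crossing word is not
    -- empty.
    have h1 : Psi.mk (wallLoop false) = 1 := by
      have h2 := congrArg (Psi.map 1 (isNormalSubmersion_inl basedLine basedLine)) h
      exact h2.trans (Psi.map_const _)
    have h2 := hword false
    rw [h1] at h2
    obtain ⟨s, hs⟩ := singleton_mem_pattern_iff.1 h2
    have h3 : crossing (TransMap.const 1 basedPlane).toFun false s = 1 := coords_pt false
    rw [h3] at hs
    exact one_ne_zero hs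

end Loops

end TransHtpy

end

open TransHtpy
theorem mainTheorem6 :
    (∀ (n : ℕ) [NeZero n]
      {E H X : Type*} [NormedAddCommGroup E] [NormedSpace ℝ E] [FiniteDimensional ℝ E]
      [TopologicalSpace H] {I : ModelWithCorners ℝ E H} [I.Boundaryless]
      [TopologicalSpace X] [T2Space X] [SecondCountableTopology X]
      [ChartedSpace H X] [IsManifold I ∞ X]
      {F G Y : Type*} [NormedAddCommGroup F] [NormedSpace ℝ F] [FiniteDimensional ℝ F]
      [TopologicalSpace G] {J : ModelWithCorners ℝ F G} [J.Boundaryless]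
      [TopologicalSpace Y] [T2Space Y] [SecondCountableTopology Y]
      [ChartedSpace G Y] [IsManifold J ∞ Y]
      (S : BasedStratification I X) (T : BasedStratification J Y),
      S.IsWhitney → T.IsWhitney →
        IsShortExact (Psi.map n (isNormalSubmersion_inl S T))
          (Psi.map n (isNormalSubmersion_snd S T)) ∧
        IsDaggerHom (Psi.map n (isNormalSubmersion_fst S T)) ∧
        Function.LeftInverse (Psi.map n (isNormalSubmersion_fst S T))
          (Psi.map n (isNormalSubmersion_inl S T)) ∧
        IsDaggerHom (Psi.map n (isNormalSubmersion_inr S T)) ∧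
        Function.RightInverse (Psi.map n (isNormalSubmersion_inr S T))
          (Psi.map n (isNormalSubmersion_snd S T))) ∧
    ∃ (m k : ℕ) (X Y : Type)
      (_ : TopologicalSpace X) (_ : T2Space X) (_ : SecondCountableTopology X)
      (_ : ChartedSpace (EuclideanSpace ℝ (Fin m)) X) (_ : IsManifold (𝓡 m) ∞ X)
      (_ : TopologicalSpace Y) (_ : T2Space Y) (_ : SecondCountableTopology Y)
      (_ : ChartedSpace (EuclideanSpace ℝ (Fin k)) Y) (_ : IsManifold (𝓡 k) ∞ Y)
      (S : BasedStratification (𝓡 m) X) (T : BasedStratification (𝓡 k) Y),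
      S.IsWhitney ∧ T.IsWhitney ∧
        IsEmpty (Psi 1 (S.prod T) ≃* Psi 1 S × Psi 1 T) := by
  refine ⟨?_, 1, 1, Line, Line, inferInstance, inferInstance, inferInstance, inferInstance,
    inferInstance, inferInstance, inferInstance, inferInstance, inferInstance, inferInstance,
    basedLine, basedLine, isWhitney_line, isWhitney_line, isEmpty_mulEquiv_basedPlane⟩
  intro n _ E H X _ _ _ _ I _ _ _ _ _ _ F G Y _ _ _ _ J _ _ _ _ _ _ S T _ _
  exact ⟨isShortExact_psi n S T, isDaggerHom_map _, leftInverse_fst_inl n S T, isDaggerHom_map _,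
    leftInverse_snd_inr n S T⟩
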